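/- Let $\varepsilon_1>0$ and let $X_4, X_{4+\varepsilon_1},\kappa$ be real constants. For $n\ge 1$ and $m\le \kappa n$ let $X=\{X_{jk}\}_{1\le j\le n,\,1\le k\le m}$ be a real $n\times m$ random matrix with independent (not necessarily identically distributed) entries such that $$\mathbf{E}\{X_{jk}\}=0,\qquad \mathbf{E}\{X_{jk}^2\}=1,\qquad \mathbf{E}\{X_{jk}^4\}=X_4,\qquad \mathbf{E}\{|X_{jk}|^{4+\varepsilon_1}\}\le X_{4+\varepsilon_1}<\infty$$ for all $j,k$. Let $M=n^{-1}XX^*$, let $G(z)=(M-z)^{-1}$ for $z\in\mathbb{C}\setminus\mathbb{R}$, let $\gamma_n=\gamma_n(z)=\mathrm{Tr}\,G(z)$, and let $\mathbf{Var}\{\gamma_n\}=\mathbf{E}\{|\gamma_n-\mathbf{E}\{\gamma_n\}|^2\}$. Then: 1. for every $0<\delta<1$ and every $Y>0$ there is a constant $C$, depending only on $\delta,Y,\varepsilon_1,X_4,X_{4+\varepsilon_1},\kappa$ (not on $n$, $m$, $z$ or the distributions of the entries), such that for all $z$ with $0<|\Im z|\le Y$ $$\mathbf{Var}\{\gamma_n\}\le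 \frac{C}{|\Im z|^{3+\delta}}\; n^{-1}\sum_{i=1}^{n}\mathbf{E}\{|G_{ii}(z)|^{1+\delta}\};$$ 2. there is a constant $C$, depending only on $\varepsilon_1,X_4,X_{4+\varepsilon_1},\kappa$, such that for all $z$ with $\Im z\ne 0$ $$\mathbf{Var}\{\gamma_n\}\le \frac{C}{|\Im z|^{4}}.$$ -/

import Mathlib

open MeasureTheory ProbabilityTheory

namespace SampleCov

/-- The sample covariance matrix `M = n⁻¹ X X*` of a real `n × m` matrix `X`. -/
noncomputable def sampleCov {n m : ℕ} (X : Matrix (Fin n) (Fin m) ℝ) : Matrix (Fin n) (Fin n) ℝ :=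
  (n : ℝ)⁻¹ • (X * X.transpose)

/-- The resolvent `G(z) = (M - z)⁻¹` of a real square matrix at `z : ℂ`. For symmetric `M` and
`z` off the real axis the matrix `M - z` is invertible. -/
noncomputable def greenMatrix {n : ℕ} (M : Matrix (Fin n) (Fin n) ℝ) (z : ℂ) :
    Matrix (Fin n) (Fin n) ℂ :=
  (M.map (fun x : ℝ => (x : ℂ)) - z • (1 : Matrix (Fin n) (Fin n) ℂ))⁻¹

/-- `γ_n(z) = Tr G(z)` for `M = n⁻¹ X X*`. -/
noncomputable def gammaTrace {n m : ℕ} (X : Matrix (Fin n) (Fin m) ℝ) (z : ℂ) : ℂ :=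
  (greenMatrix (sampleCov X) z).trace

/-- The variance `E{|ξ - E{ξ}|²}` of a complex random variable. -/
noncomputable def complexVar {Ω : Type*} [MeasurableSpace Ω] (ξ : Ω → ℂ) (μ : Measure Ω) : ℝ :=
  ∫ ω, ‖ξ ω - ∫ ω', ξ ω' ∂μ‖ ^ 2 ∂μ

/-- The entries of the real random `n × m` matrix `X` are independent random variables with
`E{X_jk} = 0`, `E{X_jk²} = 1`, `E{X_jk⁴} = X₄` and `E{|X_jk|^(4+ε₁)} ≤ K < ∞`. -/
structure IsSampleMatrix {Ω : Type*} [MeasurableSpace Ω] (μ : Measure Ω) {n m : ℕ}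
    (X : Ω → Matrix (Fin n) (Fin m) ℝ) (ε₁ X₄ K : ℝ) : Prop where
  measurable_entry : ∀ j k, Measurable (fun ω => X ω j k)
  indep : iIndepFun (fun (p : Fin n × Fin m) (ω : Ω) => X ω p.1 p.2) μ
  mean : ∀ j k, ∫ ω, X ω j k ∂μ = 0
  second_moment : ∀ j k, ∫ ω, X ω j k ^ 2 ∂μ = 1
  fourth_moment : ∀ j k, ∫ ω, X ω j k ^ 4 ∂μ = X₄
  higher_integrable : ∀ j k, Integrable (fun ω => |X ω j k| ^ (4 + ε₁)) μ
  higher_moment : ∀ j k, ∫ ω, |X ω j k| ^ (4 + ε₁) ∂μ ≤ K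

end SampleCov

/-!
The trace of the resolvent of `n⁻¹ X Xᵀ` differs by a constant from that of the resolvent `G` of the
Gram matrix of the normalised rows `y_i`. Removing row `i` changes the latter by `-Q / D`, where
`D = 1 + y_iᵀ G y_i` and `Q = y_iᵀ G² y_i` with `G` now the resolvent without that row, and
`G_ii = -1 / (z D)` for the original matrix. By the Efron–Stein inequality the variance is at most the
sum over `i` of the mean square of `Q / D - Q₀ / D₀`, where `D₀` (`meanDenom`) and `Q₀` are the
means of `D` and `Q` over row `i`. As `|Q / D| ≤ |Im z|⁻¹`, and as quadratic forms in a row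
have fluctuations of order `n^(-1/2)` times a Frobenius norm, each of these terms is
`O(n⁻¹ |Im z|⁻²)` times `min n (J / |D₀|²)`, with `J = n⁻¹ ∑ |G_kl|²` (`frobMean`); this is
`integral_norm_ratio_sub_sq_le`.

The second bound follows from the deterministic inequality `J / |D₀|² ≤ 16 κ / |Im z|²`
(`frobMean_le_norm_meanDenom_sq`).

For the first bound, `min n (J / |D₀|²) ≤ 2 J / P` with `P = |D₀|² + J / n`, while Jensen's
inequality bounds the conditional mean of `|G_ii| ^ (1 + δ)` from below by a constant times
`(|z|² P) ^ (-(1 + δ) / 2)` (`rowWeight_le_integral`). It remains to see that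
`J |D₀| ^ (δ - 1) |z| ^ (1 + δ)` is `O(|Im z| ^ (-(1 + δ)))`. This holds as soon as the
proportion `p` of eigenvalues above `|z| / 2` makes `p ^ δ |z| ^ (1 + δ)` bounded
(`frobMean_mul_rpow_le`), in particular for bounded `z`. For large `z` the number of these eigenvalues
is controlled by the smooth count `Tr (M (M + |z|)⁻¹) ^ k` (`smoothCount`), whose mean and variance
decay like `n` times a high power of `|z|⁻¹`, up to a term `|z|⁻²` due to exceptionally long rows
(`exists_integral_smoothCount_le`, `exists_variance_smoothCount_le`). These come from adding one row at
a time: a rank-one perturbation changes the count of order `k + 1` by a quadratic form whose mean is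
`n⁻¹` times the count of order `k`. If `n` is at most a power of `|z|` then with probability at least
one half there are no such eigenvalues at all; otherwise the exceptional event has probability
`O(n⁻¹ |z|⁻²)` by Chebyshev's inequality (`exists_integral_min_le`).
-/

namespace SampleCov

open Matrix

/-! ### Functions of a positive semidefinite matrix -/

section Spectral
variable {𝕜 : Type*} [RCLike 𝕜] {m : ℕ}

/-- The quadratic form `∑ H_kl t_k t_l` of a real vector `t`, for a real or complex matrix `H`. -/
noncomputable def quad (H : Matrix (Fin m) (Fin m) 𝕜) (t : Fin m → ℝ) : 𝕜 :=
  ∑ k, ∑ l, H k l * ((t k : 𝕜) * (t l : 𝕜))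

/-- The matrix `U diag(d) Uᵀ` for a real matrix `U`. When `U` is orthogonal and
`M = spec U lam`, the matrix `spec U (f ∘ lam)` is `f(M)`. -/
noncomputable def spec (U : Matrix (Fin m) (Fin m) ℝ) (d : Fin m → 𝕜) : Matrix (Fin m) (Fin m) 𝕜 :=
  U.map (fun x : ℝ => (x : 𝕜)) * diagonal d * (U.map (fun x : ℝ => (x : 𝕜)))ᵀ

theorem quad_eq_dotProduct (H : Matrix (Fin m) (Fin m) 𝕜) (t : Fin m → ℝ) :
    quad H t = (fun k => (t k : 𝕜)) ⬝ᵥ (H *ᵥ fun k => (t k : 𝕜)) := by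
  simp only [quad, dotProduct, mulVec, Finset.mul_sum]
  refine Finset.sum_congr rfl fun k _ => Finset.sum_congr rfl fun l _ => ?_
  ring

theorem quad_smul_right (H : Matrix (Fin m) (Fin m) 𝕜) (c : ℝ) (t : Fin m → ℝ) :
    quad H (c • t) = (c : 𝕜) ^ 2 * quad H t := by
  simp only [quad, Finset.mul_sum, Pi.smul_apply, smul_eq_mul, RCLike.ofReal_mul]
  refine Finset.sum_congr rfl fun k _ => Finset.sum_congr rfl fun l _ => ?_
  ring

theorem map_orth {U : Matrix (Fin m) (Fin m) ℝ} (hU : Uᵀ * U = 1) :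
    (U.map (fun x : ℝ => (x : 𝕜)))ᵀ * U.map (fun x : ℝ => (x : 𝕜)) = 1 := by
  have h := congrArg (fun A : Matrix (Fin m) (Fin m) ℝ => A.map (algebraMap ℝ 𝕜)) hU
  simpa [Matrix.map_mul, transpose_map, Matrix.map_one] using h

theorem map_orth' {U : Matrix (Fin m) (Fin m) ℝ} (hU : Uᵀ * U = 1) :
    U.map (fun x : ℝ => (x : 𝕜)) * (U.map (fun x : ℝ => (x : 𝕜)))ᵀ = 1 :=
  mul_eq_one_comm.mp (map_orth hU)

theorem spec_mul {U : Matrix (Fin m) (Fin m) ℝ} (hU : Uᵀ * U = 1) (d e : Fin m → 𝕜) :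
    spec U d * spec U e = spec U (fun l => d l * e l) := by
  unfold spec
  have h := map_orth (𝕜 := 𝕜) hU
  set V := U.map (fun x : ℝ => (x : 𝕜))
  calc V * diagonal d * Vᵀ * (V * diagonal e * Vᵀ)
      = V * diagonal d * (Vᵀ * V) * (diagonal e * Vᵀ) := by simp only [Matrix.mul_assoc]
    _ = _ := by
      rw [h, Matrix.mul_one, Matrix.mul_assoc V, ← Matrix.mul_assoc (diagonal d), diagonal_mul_diagonal,
        Matrix.mul_assoc]

theorem spec_one {U : Matrix (Fin m) (Fin m) ℝ} (hU : Uᵀ * U = 1) :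
    spec U (fun _ => (1 : 𝕜)) = 1 := by
  unfold spec
  rw [diagonal_one, Matrix.mul_one, map_orth' hU]

theorem spec_add (U : Matrix (Fin m) (Fin m) ℝ) (d e : Fin m → 𝕜) :
    spec U d + spec U e = spec U (fun l => d l + e l) := by
  unfold spec
  rw [← diagonal_add, Matrix.mul_add, Matrix.add_mul]

theorem spec_smul (U : Matrix (Fin m) (Fin m) ℝ) (c : 𝕜) (d : Fin m → 𝕜) :
    c • spec U d = spec U (fun l => c * d l) := by
  unfold spec
  rw [show (fun l => c * d l) = c • d from rfl, diagonal_smul, Matrix.mul_smul, Matrix.smul_mul]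

theorem spec_sub (U : Matrix (Fin m) (Fin m) ℝ) (d e : Fin m → 𝕜) :
    spec U d - spec U e = spec U (fun l => d l - e l) := by
  unfold spec
  rw [← diagonal_sub, Matrix.mul_sub, Matrix.sub_mul]

theorem spec_pow {U : Matrix (Fin m) (Fin m) ℝ} (hU : Uᵀ * U = 1) (d : Fin m → 𝕜) (k : ℕ) :
    spec U d ^ k = spec U (fun l => d l ^ k) := by
  induction k with
  | zero => simp [spec_one hU]
  | succ k ih => simp only [pow_succ, ih, spec_mul hU]

theorem trace_spec {U : Matrix (Fin m) (Fin m) ℝ} (hU : Uᵀ * U = 1) (d : Fin m → 𝕜) :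
    (spec U d).trace = ∑ l, d l := by
  unfold spec
  rw [trace_mul_comm, ← Matrix.mul_assoc, map_orth hU, Matrix.one_mul, trace_diagonal]

theorem spec_transpose (U : Matrix (Fin m) (Fin m) ℝ) (d : Fin m → 𝕜) :
    (spec U d)ᵀ = spec U d := by
  unfold spec
  simp [Matrix.transpose_mul, Matrix.mul_assoc]

theorem quad_spec (U : Matrix (Fin m) (Fin m) ℝ) (d : Fin m → 𝕜) (t : Fin m → ℝ) :
    quad (spec U d) t = ∑ l, (((Uᵀ *ᵥ t) l ^ 2 : ℝ) : 𝕜) * d l := by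
  have h : (U.map (fun x : ℝ => (x : 𝕜)))ᵀ *ᵥ (fun k => (t k : 𝕜)) =
      fun l => (((Uᵀ *ᵥ t) l : ℝ) : 𝕜) := by
    ext l
    simp [mulVec, dotProduct]
  rw [quad_eq_dotProduct, spec, ← mulVec_mulVec, ← mulVec_mulVec, dotProduct_mulVec,
    ← mulVec_transpose, h]
  simp only [dotProduct, mulVec_diagonal, RCLike.ofReal_pow]
  refine Finset.sum_congr rfl fun l _ => ?_
  ring

theorem sum_norm_sq_spec {U : Matrix (Fin m) (Fin m) ℝ} (hU : Uᵀ * U = 1) (d : Fin m → 𝕜) :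
    ∑ k, ∑ l, ‖spec U d k l‖ ^ 2 = ∑ l, ‖d l‖ ^ 2 := by
  have hH : (spec U d)ᴴ = spec U (fun l => star (d l)) := by
    unfold spec
    have : (U.map (fun x : ℝ => (x : 𝕜)))ᴴ = (U.map (fun x : ℝ => (x : 𝕜)))ᵀ := by
      ext i j; simp [conjTranspose]
    have h2 : (U.map (fun x : ℝ => (x : 𝕜)))ᵀᴴ = (U.map (fun x : ℝ => (x : 𝕜))) := by
      ext i j; simp [conjTranspose]
    rw [conjTranspose_mul, conjTranspose_mul, this, h2, diagonal_conjTranspose, Matrix.mul_assoc]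
    rfl
  have h := trace_spec hU (fun l => d l * star (d l))
  rw [← spec_mul hU, ← hH] at h
  simp only [trace, diag, Matrix.mul_apply, conjTranspose_apply, RCLike.star_def,
    RCLike.mul_conj] at h
  exact_mod_cast h

theorem map_spec (U : Matrix (Fin m) (Fin m) ℝ) (lam : Fin m → ℝ) :
    (spec U lam).map (fun x : ℝ => (x : 𝕜)) = spec U (fun l => (lam l : 𝕜)) := by
  have h : (fun x : ℝ => (x : 𝕜)) = algebraMap ℝ 𝕜 := rfl
  unfold spec
  simp only [h]
  rw [Matrix.map_mul, Matrix.map_mul, transpose_map, diagonal_map (map_zero _)]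
  rfl

/-- The spectral theorem in terms of `spec`. -/
theorem exists_spec {M : Matrix (Fin m) (Fin m) ℝ} (hM : M.PosSemidef) :
    ∃ (U : Matrix (Fin m) (Fin m) ℝ) (lam : Fin m → ℝ), Uᵀ * U = 1 ∧ (∀ l, 0 ≤ lam l) ∧
      M = spec U lam := by
  refine ⟨hM.1.eigenvectorUnitary, hM.1.eigenvalues, ?_, hM.eigenvalues_nonneg, ?_⟩
  · have := Matrix.UnitaryGroup.star_mul_self hM.1.eigenvectorUnitary
    rwa [star_eq_conjTranspose, conjTranspose_eq_transpose_of_trivial] at this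
  · have h := hM.1.spectral_theorem
    conv_lhs => rw [h]
    simp [spec, Unitary.conjStarAlgAut_apply, star_eq_conjTranspose,
      conjTranspose_eq_transpose_of_trivial]

/-- The Sherman–Morrison formula. -/
theorem sherman_morrison {A B : Matrix (Fin m) (Fin m) 𝕜} (hAB : A * B = 1) (u : Fin m → 𝕜)
    (hD : 1 + u ⬝ᵥ (B *ᵥ u) ≠ 0) :
    (A + vecMulVec u u) * (B - (1 + u ⬝ᵥ (B *ᵥ u))⁻¹ • vecMulVec (B *ᵥ u) (u ᵥ* B)) = 1 := by
  set D := 1 + u ⬝ᵥ (B *ᵥ u) with hDdef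
  have h1 : A *ᵥ (B *ᵥ u) = u := by rw [mulVec_mulVec, hAB, one_mulVec]
  rw [Matrix.mul_sub, Matrix.add_mul, Matrix.mul_smul, Matrix.add_mul, hAB, mul_vecMulVec, h1,
    vecMulVec_mul, vecMulVec_mul_vecMulVec]
  have h2 : u ⬝ᵥ (B *ᵥ u) = D - 1 := by rw [hDdef]; ring
  rw [h2, vecMulVec_smul]
  have : vecMulVec u (u ᵥ* B) + (D - 1) • vecMulVec u (u ᵥ* B) = D • vecMulVec u (u ᵥ* B) := by
    rw [sub_smul, one_smul]; abel
  rw [this, smul_smul, inv_mul_cancel₀ hD, one_smul]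
  abel

end Spectral

/-! ### The resolvent and its rank-one perturbations -/

section Resolvent
variable {m : ℕ}

theorem ofReal_sub_ne_zero {z : ℂ} (hz : z.im ≠ 0) (a : ℝ) : (a : ℂ) - z ≠ 0 := by
  intro h
  have := congrArg Complex.im h
  simp at this
  exact hz this

theorem abs_im_le_norm_sub (z : ℂ) (a : ℝ) : |z.im| ≤ ‖(a : ℂ) - z‖ := by
  have := Complex.abs_im_le_norm ((a : ℂ) - z)
  simpa using this

theorem norm_inv_sub_le {z : ℂ} (hz : z.im ≠ 0) (a : ℝ) : ‖((a : ℂ) - z)⁻¹‖ ≤ |z.im|⁻¹ := by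
  rw [norm_inv]
  exact inv_anti₀ (abs_pos.mpr hz) (abs_im_le_norm_sub z a)

theorem im_inv_sub (z : ℂ) (a : ℝ) :
    (((a : ℂ) - z)⁻¹).im = z.im * ‖((a : ℂ) - z)⁻¹‖ ^ 2 := by
  rw [Complex.inv_im, norm_inv, inv_pow, ← Complex.normSq_eq_norm_sq]
  simp [div_eq_mul_inv]

theorem im_mul_inv_sub (z : ℂ) (a : ℝ) :
    (z * ((a : ℂ) - z)⁻¹).im = z.im * (a * ‖((a : ℂ) - z)⁻¹‖ ^ 2) := by
  rw [Complex.mul_im, Complex.inv_im, Complex.inv_re, norm_inv, inv_pow,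
    ← Complex.normSq_eq_norm_sq]
  simp only [Complex.sub_re, Complex.ofReal_re, Complex.sub_im, Complex.ofReal_im, zero_sub, neg_neg]
  ring

/-- The left-hand side is `|Im (1 + ∑ w_l (λ_l - z)⁻¹)|`. -/
theorem abs_im_mul_sum_le {w lam : Fin m → ℝ} (hw : ∀ l, 0 ≤ w l) (z : ℂ) :
    |z.im| * ∑ l, w l * ‖((lam l : ℂ) - z)⁻¹‖ ^ 2 ≤
      ‖1 + ∑ l, (w l : ℂ) * ((lam l : ℂ) - z)⁻¹‖ := by
  refine le_trans (le_of_eq ?_) (Complex.abs_im_le_norm _)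
  have : (1 + ∑ l, (w l : ℂ) * ((lam l : ℂ) - z)⁻¹).im =
      z.im * ∑ l, w l * ‖((lam l : ℂ) - z)⁻¹‖ ^ 2 := by
    rw [Complex.add_im, Complex.im_sum, Complex.one_im, zero_add, Finset.mul_sum]
    refine Finset.sum_congr rfl fun l _ => ?_
    rw [Complex.im_ofReal_mul, im_inv_sub]
    ring
  rw [this, abs_mul, abs_of_nonneg (a := ∑ l, _)]
  exact Finset.sum_nonneg fun l _ => mul_nonneg (hw l) (sq_nonneg _)

/-- The imaginary part of `z (1 + ∑ w_l (λ_l - z)⁻¹)` is at least that of `z` in modulus, because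
`w` and `λ` are nonnegative. -/
theorem abs_im_le_norm_mul {w lam : Fin m → ℝ} (hw : ∀ l, 0 ≤ w l) (hlam : ∀ l, 0 ≤ lam l) (z : ℂ) :
    |z.im| ≤ ‖z‖ * ‖1 + ∑ l, (w l : ℂ) * ((lam l : ℂ) - z)⁻¹‖ := by
  rw [← norm_mul]
  refine le_trans ?_ (Complex.abs_im_le_norm _)
  have : (z * (1 + ∑ l, (w l : ℂ) * ((lam l : ℂ) - z)⁻¹)).im =
      z.im * (1 + ∑ l, w l * (lam l * ‖((lam l : ℂ) - z)⁻¹‖ ^ 2)) := by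
    rw [mul_add, mul_one, Finset.mul_sum, Complex.add_im, Complex.im_sum, mul_add, mul_one,
      Finset.mul_sum]
    congr 1
    refine Finset.sum_congr rfl fun l _ => ?_
    rw [show z * ((w l : ℂ) * ((lam l : ℂ) - z)⁻¹) = (w l : ℂ) * (z * ((lam l : ℂ) - z)⁻¹) by ring,
      Complex.im_ofReal_mul, im_mul_inv_sub]
    ring
  rw [this, abs_mul]
  have h : 0 ≤ ∑ l, w l * (lam l * ‖((lam l : ℂ) - z)⁻¹‖ ^ 2) :=
    Finset.sum_nonneg fun l _ => mul_nonneg (hw l) (mul_nonneg (hlam l) (sq_nonneg _))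
  rw [abs_of_nonneg (a := 1 + _) (by linarith)]
  nlinarith [abs_nonneg z.im]

theorem sub_mul_green_spec {U : Matrix (Fin m) (Fin m) ℝ} (hU : Uᵀ * U = 1) (lam : Fin m → ℝ) {z : ℂ}
    (hz : z.im ≠ 0) :
    ((spec U lam).map (fun x : ℝ => (x : ℂ)) - z • (1 : Matrix (Fin m) (Fin m) ℂ)) *
      spec U (fun l => ((lam l : ℂ) - z)⁻¹) = 1 := by
  have h1 := map_spec (𝕜 := ℂ) U lam
  simp only [Complex.coe_algebraMap] at h1
  rw [h1, ← spec_one (𝕜 := ℂ) hU, spec_smul, spec_sub, spec_mul hU]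
  congr 1
  ext l
  rw [mul_one, mul_inv_cancel₀ (ofReal_sub_ne_zero hz _)]

theorem green_spec {U : Matrix (Fin m) (Fin m) ℝ} (hU : Uᵀ * U = 1) (lam : Fin m → ℝ) {z : ℂ}
    (hz : z.im ≠ 0) :
    greenMatrix (spec U lam) z = spec U (fun l => ((lam l : ℂ) - z)⁻¹) :=
  Matrix.inv_eq_right_inv (sub_mul_green_spec hU lam hz)

theorem sub_mul_green {M : Matrix (Fin m) (Fin m) ℝ} (hM : M.PosSemidef) {z : ℂ} (hz : z.im ≠ 0) :
    (M.map (fun x : ℝ => (x : ℂ)) - z • (1 : Matrix (Fin m) (Fin m) ℂ)) * greenMatrix M z = 1 := by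
  obtain ⟨U, lam, hU, -, rfl⟩ := exists_spec hM
  rw [green_spec hU lam hz, sub_mul_green_spec hU lam hz]

section RankOne
variable {M : Matrix (Fin m) (Fin m) ℝ} (hM : M.PosSemidef) {z : ℂ} (hz : z.im ≠ 0) (t : Fin m → ℝ)
include hM hz

theorem abs_im_le_norm_mul_one_add_quad :
    |z.im| ≤ ‖z‖ * ‖1 + quad (greenMatrix M z) t‖ := by
  obtain ⟨U, lam, hU, hlam, rfl⟩ := exists_spec hM
  rw [green_spec hU lam hz, quad_spec]
  exact abs_im_le_norm_mul (fun l => sq_nonneg _) hlam z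

theorem one_add_quad_ne_zero : 1 + quad (greenMatrix M z) t ≠ 0 := by
  intro h
  have := abs_im_le_norm_mul_one_add_quad hM hz t
  rw [h, norm_zero, mul_zero] at this
  exact hz (abs_nonpos_iff.mp this)

/-- The numerator is at most `∑ w_l |λ_l - z|⁻²`, and `|Im z|` times this sum is the modulus of the
imaginary part of the denominator. -/
theorem norm_quad_sq_div_le :
    ‖quad (greenMatrix M z * greenMatrix M z) t / (1 + quad (greenMatrix M z) t)‖ ≤ |z.im|⁻¹ := by
  have hne := one_add_quad_ne_zero hM hz t
  obtain ⟨U, lam, hU, hlam, rfl⟩ := exists_spec hM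
  rw [green_spec hU lam hz] at hne ⊢
  rw [spec_mul hU, norm_div, div_le_iff₀ (norm_pos_iff.mpr hne), inv_mul_eq_div,
    le_div_iff₀ (abs_pos.mpr hz), quad_spec, quad_spec, mul_comm]
  refine le_trans ?_ (abs_im_mul_sum_le (w := fun l => (Uᵀ *ᵥ t) l ^ 2) (fun l => sq_nonneg _) z)
  refine mul_le_mul_of_nonneg_left ?_ (abs_nonneg _)
  refine (norm_sum_le _ _).trans (Finset.sum_le_sum fun l _ => le_of_eq ?_)
  rw [norm_mul, norm_mul, RCLike.norm_ofReal, abs_of_nonneg (sq_nonneg _)]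
  ring

theorem green_add_vecMulVec :
    greenMatrix (M + vecMulVec t t) z = greenMatrix M z - (1 + quad (greenMatrix M z) t)⁻¹ •
      vecMulVec (greenMatrix M z *ᵥ fun k => (t k : ℂ)) ((fun k => (t k : ℂ)) ᵥ* greenMatrix M z) := by
  have h := sherman_morrison (sub_mul_green hM hz) (fun k => (t k : ℂ))
  have h1 := quad_eq_dotProduct (greenMatrix M z) t
  simp only [RCLike.ofReal_eq_complex_ofReal] at h1
  rw [← h1] at h
  refine Matrix.inv_eq_right_inv ?_
  refine Eq.trans ?_ (h (one_add_quad_ne_zero hM hz t))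
  congr 1
  ext i j
  simp [vecMulVec_apply]
  ring

theorem trace_green_add_vecMulVec :
    (greenMatrix (M + vecMulVec t t) z).trace = (greenMatrix M z).trace -
      quad (greenMatrix M z * greenMatrix M z) t / (1 + quad (greenMatrix M z) t) := by
  have h1 := quad_eq_dotProduct (greenMatrix M z * greenMatrix M z) t
  simp only [RCLike.ofReal_eq_complex_ofReal] at h1
  rw [green_add_vecMulVec hM hz, trace_sub, trace_smul, trace_vecMulVec, dotProduct_comm,
    ← dotProduct_mulVec, mulVec_mulVec, ← h1, smul_eq_mul, div_eq_inv_mul]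

theorem quad_green_add_vecMulVec :
    quad (greenMatrix (M + vecMulVec t t) z) t =
      1 - (1 + quad (greenMatrix M z) t)⁻¹ := by
  have hne := one_add_quad_ne_zero hM hz t
  have h1 := quad_eq_dotProduct (greenMatrix M z) t
  have h2 := quad_eq_dotProduct (greenMatrix (M + vecMulVec t t) z) t
  simp only [RCLike.ofReal_eq_complex_ofReal] at h1 h2
  rw [h2, green_add_vecMulVec hM hz, sub_mulVec, dotProduct_sub, smul_mulVec, vecMulVec_mulVec,
    ← dotProduct_mulVec, ← h1, dotProduct_smul, op_smul_eq_smul, dotProduct_smul, ← h1]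
  simp only [smul_eq_mul]
  field_simp
  ring

end RankOne

end Resolvent

/-! ### Gram matrices of the rows -/

section Gram
variable {n m : ℕ}

/-- The Gram matrix `∑_{j ∈ s} y_j y_jᵀ` of the normalised rows `y_j = n^(-1/2) x_j`. -/
noncomputable def gram (s : Finset (Fin n)) (x : Fin n → Fin m → ℝ) : Matrix (Fin m) (Fin m) ℝ :=
  ∑ j ∈ s, vecMulVec ((√(n : ℝ))⁻¹ • x j) ((√(n : ℝ))⁻¹ • x j)

theorem gram_posSemidef (s : Finset (Fin n)) (x : Fin n → Fin m → ℝ) : (gram s x).PosSemidef := by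
  refine posSemidef_sum _ fun j _ => ?_
  simpa using posSemidef_vecMulVec_self_star ((√(n : ℝ))⁻¹ • x j)

theorem gram_insert {s : Finset (Fin n)} {i : Fin n} (hi : i ∉ s) (x : Fin n → Fin m → ℝ) :
    gram (insert i s) x =
      gram s x + vecMulVec ((√(n : ℝ))⁻¹ • x i) ((√(n : ℝ))⁻¹ • x i) := by
  rw [gram, Finset.sum_insert hi, add_comm, gram]

theorem gram_univ_eq (i : Fin n) (x : Fin n → Fin m → ℝ) :
    gram Finset.univ x = gram (Finset.univ.erase i) x +
      vecMulVec ((√(n : ℝ))⁻¹ • x i) ((√(n : ℝ))⁻¹ • x i) := by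
  rw [← gram_insert (Finset.notMem_erase i _), Finset.insert_erase (Finset.mem_univ i)]

theorem gram_update {s : Finset (Fin n)} {i : Fin n} (hi : i ∉ s) (x : Fin n → Fin m → ℝ)
    (t : Fin m → ℝ) : gram s (Function.update x i t) = gram s x := by
  refine Finset.sum_congr rfl fun j hj => ?_
  rw [Function.update_of_ne (ne_of_mem_of_not_mem hj hi)]

theorem gram_univ (X : Matrix (Fin n) (Fin m) ℝ) :
    gram Finset.univ X = ((√(n : ℝ))⁻¹ • X)ᵀ * ((√(n : ℝ))⁻¹ • X) := by
  ext k l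
  simp only [gram, Matrix.sum_apply, vecMulVec_apply, Matrix.mul_apply, transpose_apply,
    Matrix.smul_apply, Pi.smul_apply]

theorem sampleCov_eq (X : Matrix (Fin n) (Fin m) ℝ) :
    sampleCov X = ((√(n : ℝ))⁻¹ • X) * ((√(n : ℝ))⁻¹ • X)ᵀ := by
  have : (√(n : ℝ))⁻¹ * (√(n : ℝ))⁻¹ = (n : ℝ)⁻¹ := by
    rw [← mul_inv, Real.mul_self_sqrt (Nat.cast_nonneg n)]
  rw [sampleCov, transpose_smul, Matrix.smul_mul, Matrix.mul_smul, smul_smul, this]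

/-- The resolvent of `Y Yᵀ` in terms of that of `Yᵀ Y`. -/
theorem green_mul_transpose (Y : Matrix (Fin n) (Fin m) ℝ) {z : ℂ} (hz : z.im ≠ 0) :
    greenMatrix (Y * Yᵀ) z = z⁻¹ • (Y.map (fun x : ℝ => (x : ℂ)) * greenMatrix (Yᵀ * Y) z *
      (Y.map (fun x : ℝ => (x : ℂ)))ᵀ - 1) := by
  have hz0 : z ≠ 0 := fun h => hz (by simp [h])
  have hpsd : (Yᵀ * Y).PosSemidef := by
    have := posSemidef_conjTranspose_mul_self Y
    rwa [conjTranspose_eq_transpose_of_trivial] at this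
  have h := sub_mul_green hpsd hz
  have hm : ∀ {a b c : ℕ} (A : Matrix (Fin a) (Fin b) ℝ) (B : Matrix (Fin b) (Fin c) ℝ),
      (A * B).map (fun x : ℝ => (x : ℂ)) =
        A.map (fun x : ℝ => (x : ℂ)) * B.map (fun x : ℝ => (x : ℂ)) := by
    intro a b c A B
    exact Matrix.map_mul (f := algebraMap ℝ ℂ)
  rw [hm, transpose_map] at h
  refine Matrix.inv_eq_right_inv ?_
  rw [hm, transpose_map]
  set C := Y.map (fun x : ℝ => (x : ℂ))
  set G := greenMatrix (Yᵀ * Y) z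
  have h2 : Cᵀ * C * G = 1 + z • G := by
    rw [Matrix.sub_mul, Matrix.smul_mul, Matrix.one_mul] at h
    rw [← h]; abel
  have h3 : C * Cᵀ * (C * G * Cᵀ) = C * Cᵀ + z • (C * G * Cᵀ) := by
    calc C * Cᵀ * (C * G * Cᵀ) = C * (Cᵀ * C * G) * Cᵀ := by simp only [Matrix.mul_assoc]
      _ = _ := by
        rw [h2, Matrix.mul_add, Matrix.mul_one, Matrix.add_mul, Matrix.mul_smul, Matrix.smul_mul]
  rw [Matrix.mul_smul, Matrix.sub_mul, Matrix.mul_sub, Matrix.mul_one, h3, Matrix.smul_mul,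
    Matrix.one_mul, add_sub_cancel_left, smul_sub z, sub_sub_cancel, smul_smul,
    inv_mul_cancel₀ hz0, one_smul]

/-- `Y Yᵀ` and `Yᵀ Y` have the same nonzero eigenvalues; the term `z⁻¹ (m - n)` accounts for the
multiplicities of zero. -/
theorem gammaTrace_eq (X : Matrix (Fin n) (Fin m) ℝ) {z : ℂ} (hz : z.im ≠ 0) :
    gammaTrace X z = (greenMatrix (gram Finset.univ X) z).trace + z⁻¹ * ((m : ℂ) - n) := by
  have hz0 : z ≠ 0 := fun h => hz (by simp [h])
  rw [gammaTrace, sampleCov_eq, green_mul_transpose _ hz, ← gram_univ]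
  have h := congrArg Matrix.trace (sub_mul_green (gram_posSemidef Finset.univ X) hz)
  have hm : (gram Finset.univ X).map (fun x : ℝ => (x : ℂ)) =
      (((√(n : ℝ))⁻¹ • X).map (fun x : ℝ => (x : ℂ)))ᵀ * ((√(n : ℝ))⁻¹ • X).map (fun x : ℝ => (x : ℂ)) := by
    rw [gram_univ, ← transpose_map]
    exact Matrix.map_mul (f := algebraMap ℝ ℂ)
  rw [Matrix.sub_mul, trace_sub, Matrix.smul_mul, Matrix.one_mul, trace_smul, trace_one, hm,
    Fintype.card_fin, Matrix.mul_assoc, trace_mul_comm] at h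
  rw [trace_smul, trace_sub, trace_one, Fintype.card_fin, sub_eq_iff_eq_add.mp h]
  simp only [smul_eq_mul]
  field_simp
  ring

/-- The Schur complement formula: a diagonal entry of the resolvent of `n⁻¹ X Xᵀ` in terms of the
corresponding row and of the Gram matrix of the others. -/
theorem green_diag_eq (X : Matrix (Fin n) (Fin m) ℝ) {z : ℂ} (hz : z.im ≠ 0) (i : Fin n) :
    greenMatrix (sampleCov X) z i i =
      -(z * (1 + quad (greenMatrix (gram (Finset.univ.erase i) X) z) ((√(n : ℝ))⁻¹ • X i)))⁻¹ := by
  have hz0 : z ≠ 0 := fun h => hz (by simp [h])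
  have h := quad_green_add_vecMulVec (gram_posSemidef (Finset.univ.erase i) X) hz
    ((√(n : ℝ))⁻¹ • X i)
  have hg := gram_univ_eq i (fun j => X j)
  rw [← hg] at h
  have h2 : greenMatrix (sampleCov X) z i i =
      z⁻¹ * (quad (greenMatrix (gram Finset.univ X) z) ((√(n : ℝ))⁻¹ • X i) - 1) := by
    rw [sampleCov_eq, green_mul_transpose _ hz, ← gram_univ, quad_eq_dotProduct,
      Matrix.smul_apply, Matrix.sub_apply, one_apply_eq, Matrix.mul_assoc]
    rfl
  rw [h2, h, mul_inv]
  ring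

end Gram

section Scalars
variable {m : ℕ}

/-- `1 + n⁻¹ Tr G(z)`: the mean of `1 + yᵀ G(z) y` over a random vector `y` with covariance `n⁻¹`. -/
noncomputable def meanDenom (n : ℕ) (M : Matrix (Fin m) (Fin m) ℝ) (z : ℂ) : ℂ :=
  1 + (n : ℂ)⁻¹ * (greenMatrix M z).trace

/-- The normalised squared Frobenius norm `n⁻¹ ∑ |G_kl(z)|²`. -/
noncomputable def frobMean (n : ℕ) (M : Matrix (Fin m) (Fin m) ℝ) (z : ℂ) : ℝ :=
  (n : ℝ)⁻¹ * ∑ k, ∑ l, ‖greenMatrix M z k l‖ ^ 2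

/-- `Tr (M (M + r)⁻¹)^k`, a smooth count of the eigenvalues of `M` that are not small
compared with `r`. -/
noncomputable def smoothCount (r : ℝ) (k : ℕ) (M : Matrix (Fin m) (Fin m) ℝ) : ℝ :=
  ((1 - r • (M + r • (1 : Matrix (Fin m) (Fin m) ℝ))⁻¹) ^ k).trace

theorem inv_add_spec {U : Matrix (Fin m) (Fin m) ℝ} (hU : Uᵀ * U = 1) {lam : Fin m → ℝ}
    (hlam : ∀ l, 0 ≤ lam l) {r : ℝ} (hr : 0 < r) :
    (spec U lam + r • (1 : Matrix (Fin m) (Fin m) ℝ))⁻¹ = spec U (fun l => (lam l + r)⁻¹) := by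
  refine Matrix.inv_eq_right_inv ?_
  rw [← spec_one (𝕜 := ℝ) hU, spec_smul, spec_add, spec_mul hU]
  congr 1
  ext l
  have := hlam l
  rw [mul_one, mul_inv_cancel₀ (by positivity)]

theorem psi_spec {U : Matrix (Fin m) (Fin m) ℝ} (hU : Uᵀ * U = 1) {lam : Fin m → ℝ}
    (hlam : ∀ l, 0 ≤ lam l) {r : ℝ} (hr : 0 < r) :
    1 - r • (spec U lam + r • (1 : Matrix (Fin m) (Fin m) ℝ))⁻¹ =
      spec U (fun l => lam l / (lam l + r)) := by
  rw [inv_add_spec hU hlam hr, ← spec_one (𝕜 := ℝ) hU, spec_smul, spec_sub]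
  congr 1
  ext l
  have := hlam l
  field_simp
  ring

theorem smoothCount_spec {U : Matrix (Fin m) (Fin m) ℝ} (hU : Uᵀ * U = 1) {lam : Fin m → ℝ}
    (hlam : ∀ l, 0 ≤ lam l) {r : ℝ} (hr : 0 < r) (k : ℕ) :
    smoothCount r k (spec U lam) = ∑ l, (lam l / (lam l + r)) ^ k := by
  rw [smoothCount, psi_spec hU hlam hr, spec_pow hU, trace_spec hU]

theorem meanDenom_spec {U : Matrix (Fin m) (Fin m) ℝ} (hU : Uᵀ * U = 1) (lam : Fin m → ℝ) (n : ℕ)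
    {z : ℂ} (hz : z.im ≠ 0) :
    meanDenom n (spec U lam) z = 1 + ∑ l, (((n : ℝ)⁻¹ : ℝ) : ℂ) * ((lam l : ℂ) - z)⁻¹ := by
  rw [meanDenom, green_spec hU lam hz, trace_spec hU, Finset.mul_sum]
  simp

theorem frobMean_spec {U : Matrix (Fin m) (Fin m) ℝ} (hU : Uᵀ * U = 1) (lam : Fin m → ℝ) (n : ℕ)
    {z : ℂ} (hz : z.im ≠ 0) :
    frobMean n (spec U lam) z = (n : ℝ)⁻¹ * ∑ l, ‖((lam l : ℂ) - z)⁻¹‖ ^ 2 := by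
  rw [frobMean, green_spec hU lam hz, sum_norm_sq_spec hU]

end Scalars

/-! ### Deterministic bounds in terms of the spectrum -/

section Deterministic
variable {m n : ℕ}

theorem norm_inv_sub_le_of_le {z : ℂ} (hz : z.im ≠ 0) {a : ℝ} (ha : 0 ≤ a) (h : a ≤ ‖z‖ / 2) :
    ‖((a : ℂ) - z)⁻¹‖ ≤ 2 / ‖z‖ := by
  have hz0 : 0 < ‖z‖ := norm_pos_iff.mpr fun h => hz (by simp [h])
  have h1 : ‖z‖ / 2 ≤ ‖(a : ℂ) - z‖ := by
    have := norm_sub_norm_le z (a : ℂ)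
    rw [norm_sub_rev, Complex.norm_real, Real.norm_of_nonneg ha] at this
    linarith
  rw [norm_inv, ← inv_div]
  exact inv_anti₀ (by positivity) h1

/-- The part of `frobMean` carried by the eigenvalues above `‖z‖ / 2`. -/
theorem sum_filter_norm_sq_le (lam : Fin m → ℝ) {z : ℂ} (hz : z.im ≠ 0) :
    ∑ l with ‖z‖ / 2 < lam l, ‖((lam l : ℂ) - z)⁻¹‖ ^ 2 ≤
      (Finset.univ.filter fun l => ‖z‖ / 2 < lam l).card / |z.im| ^ 2 := by
  refine (Finset.sum_le_card_nsmul _ _ (|z.im|⁻¹ ^ 2) fun l _ => ?_).trans (le_of_eq ?_)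
  · exact pow_le_pow_left₀ (norm_nonneg _) (norm_inv_sub_le hz _) 2
  · rw [nsmul_eq_mul, inv_pow, ← div_eq_mul_inv]

theorem sum_filter_not_norm_le {lam : Fin m → ℝ} (hlam : ∀ l, 0 ≤ lam l) {z : ℂ} (hz : z.im ≠ 0)
    (p : ℕ) :
    ∑ l with ¬ ‖z‖ / 2 < lam l, ‖((lam l : ℂ) - z)⁻¹‖ ^ p ≤ m * (2 / ‖z‖) ^ p := by
  have hz0 : 0 ≤ 2 / ‖z‖ := by positivity
  refine (Finset.sum_le_card_nsmul _ _ ((2 / ‖z‖) ^ p) fun l hl => ?_).trans ?_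
  · refine pow_le_pow_left₀ (norm_nonneg _) (norm_inv_sub_le_of_le hz (hlam l) ?_) p
    simpa using (Finset.mem_filter.mp hl).2
  · rw [nsmul_eq_mul]
    refine mul_le_mul_of_nonneg_right ?_ (by positivity)
    exact_mod_cast (Finset.card_filter_le _ _).trans (by simp)

theorem card_filter_le_sum_pow {lam : Fin m → ℝ} (hlam : ∀ l, 0 ≤ lam l) {r : ℝ} (hr : 0 < r) (k : ℕ) :
    ((Finset.univ.filter fun l => r / 2 < lam l).card : ℝ) ≤
      3 ^ k * ∑ l, (lam l / (lam l + r)) ^ k := by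
  have h1 : ∑ l with r / 2 < lam l, (1 : ℝ) ≤
      ∑ l with r / 2 < lam l, 3 ^ k * (lam l / (lam l + r)) ^ k := by
    refine Finset.sum_le_sum fun l hl => ?_
    have hl := (Finset.mem_filter.mp hl).2
    have h0 := hlam l
    rw [← mul_pow]
    refine one_le_pow₀ ?_
    rw [mul_div_assoc', le_div_iff₀ (by positivity)]
    linarith
  rw [Finset.sum_const, nsmul_eq_mul, mul_one] at h1
  refine h1.trans ?_
  rw [Finset.mul_sum]
  exact Finset.sum_le_sum_of_subset_of_nonneg (Finset.filter_subset _ _) fun l _ _ => by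
    have := hlam l
    positivity

variable {κ : ℝ} {M : Matrix (Fin m) (Fin m) ℝ} (hM : M.PosSemidef) {z : ℂ} (hz : z.im ≠ 0)
include hM hz

theorem abs_im_mul_frobMean_le (n : ℕ) : |z.im| * frobMean n M z ≤ ‖meanDenom n M z‖ := by
  obtain ⟨U, lam, hU, hlam, rfl⟩ := exists_spec hM
  rw [frobMean_spec hU lam n hz, meanDenom_spec hU lam n hz, Finset.mul_sum]
  exact abs_im_mul_sum_le (fun _ => by positivity) z

theorem abs_im_le_norm_mul_meanDenom (n : ℕ) : |z.im| ≤ ‖z‖ * ‖meanDenom n M z‖ := by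
  obtain ⟨U, lam, hU, hlam, rfl⟩ := exists_spec hM
  rw [meanDenom_spec hU lam n hz]
  exact abs_im_le_norm_mul (fun _ => by positivity) hlam z

theorem meanDenom_ne_zero (n : ℕ) : meanDenom n M z ≠ 0 := by
  intro h
  have := abs_im_le_norm_mul_meanDenom hM hz n
  rw [h, norm_zero, mul_zero] at this
  exact hz (abs_nonpos_iff.mp this)

omit hM hz in
theorem frobMean_nonneg (n : ℕ) : 0 ≤ frobMean n M z := by
  unfold frobMean; positivity

theorem frobMean_le (hn : 1 ≤ n) (hmn : (m : ℝ) ≤ κ * n) : frobMean n M z ≤ κ / |z.im| ^ 2 := by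
  have hn0 : (0 : ℝ) < n := by exact_mod_cast hn
  obtain ⟨U, lam, hU, hlam, rfl⟩ := exists_spec hM
  rw [frobMean_spec hU lam n hz, inv_mul_le_iff₀ hn0]
  refine (Finset.sum_le_card_nsmul _ _ (|z.im|⁻¹ ^ 2) fun l _ => ?_).trans ?_
  · exact pow_le_pow_left₀ (norm_nonneg _) (norm_inv_sub_le hz _) 2
  · rw [nsmul_eq_mul, inv_pow, Finset.card_univ, Fintype.card_fin, mul_div_assoc', div_eq_mul_inv]
    refine mul_le_mul_of_nonneg_right ?_ (by positivity)
    linarith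

theorem norm_meanDenom_le (hn : 1 ≤ n) (hmn : (m : ℝ) ≤ κ * n) :
    ‖meanDenom n M z‖ ≤ 1 + κ / |z.im| := by
  have hn0 : (0 : ℝ) < n := by exact_mod_cast hn
  obtain ⟨U, lam, hU, hlam, rfl⟩ := exists_spec hM
  rw [meanDenom_spec hU lam n hz, ← Finset.mul_sum]
  refine (norm_add_le _ _).trans ?_
  rw [norm_one, norm_mul, Complex.norm_real, Real.norm_of_nonneg (by positivity)]
  gcongr
  rw [inv_mul_le_iff₀ hn0]
  refine (norm_sum_le _ _).trans ((Finset.sum_le_card_nsmul _ _ |z.im|⁻¹ fun l _ =>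
    norm_inv_sub_le hz _).trans ?_)
  rw [nsmul_eq_mul, Finset.card_univ, Fintype.card_fin, mul_div_assoc', div_eq_mul_inv]
  refine mul_le_mul_of_nonneg_right ?_ (by positivity)
  linarith

/-- Either `|1 + g| ≥ 1/4`, and the bound on `frobMean` suffices, or `|g|` is of order one for
`g = n⁻¹ Tr G`, and then `frobMean` is bounded below by Cauchy–Schwarz. -/
theorem frobMean_le_norm_meanDenom_sq (hn : 1 ≤ n) (hmn : (m : ℝ) ≤ κ * n) :
    |z.im| ^ 2 * frobMean n M z ≤ 16 * κ * ‖meanDenom n M z‖ ^ 2 := by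
  have hn0 : (0 : ℝ) < n := by exact_mod_cast hn
  have hv : 0 < |z.im| := abs_pos.mpr hz
  have hJ := frobMean_le hM hz hn hmn
  have hd1 := abs_im_mul_frobMean_le hM hz n
  have hJ0 := frobMean_nonneg (M := M) (z := z) n
  rw [le_div_iff₀ (by positivity)] at hJ
  set J := frobMean n M z with hJdef
  set D := meanDenom n M z with hD
  have hκ : 0 ≤ κ := by
    by_contra h
    have : κ * n < 0 := mul_neg_of_neg_of_pos (not_le.mp h) hn0
    linarith [(Nat.cast_nonneg m : (0 : ℝ) ≤ m)]
  by_cases hcase : 1 / 4 ≤ ‖D‖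
  · have : 1 / 16 ≤ ‖D‖ ^ 2 := by nlinarith
    nlinarith
  · push Not at hcase
    have hg : (3 / 4 : ℝ) ^ 2 ≤ κ * J := by
      obtain ⟨U, lam, hU, hlam, rfl⟩ := exists_spec hM
      have hDe := meanDenom_spec hU lam n hz
      rw [← Finset.mul_sum] at hDe
      set S := ∑ l, ((lam l : ℂ) - z)⁻¹
      have h1 : 3 / 4 ≤ (n : ℝ)⁻¹ * ∑ l, ‖((lam l : ℂ) - z)⁻¹‖ := by
        have h2 : ‖(((n : ℝ)⁻¹ : ℝ) : ℂ) * S‖ ≤ (n : ℝ)⁻¹ * ∑ l, ‖((lam l : ℂ) - z)⁻¹‖ := by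
          rw [norm_mul, Complex.norm_real, Real.norm_of_nonneg (by positivity)]
          gcongr
          exact norm_sum_le _ _
        have h3 : (1 : ℝ) ≤ ‖D‖ + ‖(((n : ℝ)⁻¹ : ℝ) : ℂ) * S‖ := by
          have := norm_sub_le D ((((n : ℝ)⁻¹ : ℝ) : ℂ) * S)
          rw [hD, hDe, add_sub_cancel_right, norm_one, ← hDe] at this
          exact this
        linarith
      have h4 := sq_sum_le_card_mul_sum_sq (s := Finset.univ)
        (f := fun l => ‖((lam l : ℂ) - z)⁻¹‖)
      rw [Finset.card_univ, Fintype.card_fin] at h4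
      rw [hJdef, frobMean_spec hU lam n hz]
      have hS2 : 0 ≤ ∑ l, ‖((lam l : ℂ) - z)⁻¹‖ ^ 2 := by positivity
      calc (3 / 4 : ℝ) ^ 2 ≤ ((n : ℝ)⁻¹ * ∑ l, ‖((lam l : ℂ) - z)⁻¹‖) ^ 2 := by gcongr
        _ = (n : ℝ)⁻¹ ^ 2 * (∑ l, ‖((lam l : ℂ) - z)⁻¹‖) ^ 2 := by ring
        _ ≤ (n : ℝ)⁻¹ ^ 2 * (κ * n * ∑ l, ‖((lam l : ℂ) - z)⁻¹‖ ^ 2) := by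
          gcongr
          exact h4.trans (mul_le_mul_of_nonneg_right hmn hS2)
        _ = _ := by field_simp
    have h5 : (|z.im| * J) ^ 2 ≤ ‖D‖ ^ 2 := by gcongr
    have h6 : |z.im| ^ 2 * J ≤ 16 * κ * (|z.im| * J) ^ 2 := by
      have : 0 ≤ |z.im| ^ 2 * J * (16 * (κ * J) - 1) := by
        refine mul_nonneg (by positivity) (by linarith)
      nlinarith
    exact h6.trans (mul_le_mul_of_nonneg_left h5 (by positivity))

/-- If no eigenvalue exceeds `‖z‖ / 2`, then `1 + n⁻¹ Tr G(z)` is close to one for large `z`. -/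
theorem meanDenom_bounds_of_smoothCount_lt (hn : 1 ≤ n) (hmn : (m : ℝ) ≤ κ * n) (k : ℕ)
    (hκz : 8 * κ ≤ ‖z‖) (hS : 3 ^ k * smoothCount ‖z‖ k M < 1) :
    frobMean n M z ≤ 4 * κ / ‖z‖ ^ 2 ∧ 3 / 4 ≤ ‖meanDenom n M z‖ ∧ ‖meanDenom n M z‖ ≤ 5 / 4 := by
  have hn0 : (0 : ℝ) < n := by exact_mod_cast hn
  have hz0 : 0 < ‖z‖ := norm_pos_iff.mpr fun h => hz (by simp [h])
  obtain ⟨U, lam, hU, hlam, rfl⟩ := exists_spec hM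
  rw [smoothCount_spec hU hlam hz0] at hS
  have hcard := (card_filter_le_sum_pow hlam hz0 k).trans_lt hS
  have h0 : (Finset.univ.filter fun l => ‖z‖ / 2 < lam l).card = 0 := by
    have : (Finset.univ.filter fun l => ‖z‖ / 2 < lam l).card < 1 := by exact_mod_cast hcard
    omega
  have hempty : (Finset.univ.filter fun l => ¬ ‖z‖ / 2 < lam l) = Finset.univ := by
    rw [Finset.card_eq_zero] at h0
    refine Finset.filter_true_of_mem fun l _ hl => ?_
    have : l ∈ Finset.univ.filter fun l => ‖z‖ / 2 < lam l := by simp [hl]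
    rw [h0] at this
    simp at this
  have h1 := sum_filter_not_norm_le hlam hz 1
  have h2 := sum_filter_not_norm_le hlam hz 2
  rw [hempty] at h1 h2
  have hD : ‖∑ l, (((n : ℝ)⁻¹ : ℝ) : ℂ) * ((lam l : ℂ) - z)⁻¹‖ ≤ 1 / 4 := by
    rw [← Finset.mul_sum, norm_mul, Complex.norm_real, Real.norm_of_nonneg (by positivity),
      inv_mul_le_iff₀ hn0]
    simp only [pow_one] at h1
    refine (norm_sum_le _ _).trans (h1.trans ?_)
    rw [mul_div_assoc', div_le_iff₀ hz0]
    nlinarith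
  refine ⟨?_, ?_, ?_⟩
  · rw [frobMean_spec hU lam n hz, inv_mul_le_iff₀ hn0]
    refine h2.trans ?_
    rw [div_pow]
    calc (m : ℝ) * (2 ^ 2 / ‖z‖ ^ 2) ≤ κ * n * (2 ^ 2 / ‖z‖ ^ 2) := by gcongr
      _ = _ := by ring
  · rw [meanDenom_spec hU lam n hz]
    have := norm_sub_norm_le (1 : ℂ) (-∑ l, (((n : ℝ)⁻¹ : ℝ) : ℂ) * ((lam l : ℂ) - z)⁻¹)
    rw [norm_neg, norm_one, sub_neg_eq_add] at this
    linarith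
  · rw [meanDenom_spec hU lam n hz]
    refine (norm_add_le _ _).trans ?_
    rw [norm_one]
    linarith

/-- Far from the origin, `min (n, J / |D|²)`, with `J = frobMean` and `D = meanDenom`, is at most of
the order of `N / |Im z|` with `N` the number of eigenvalues above `‖z‖ / 2`, up to `O(‖z‖⁻²)`. When
`|D|` is small these eigenvalues alone make `n⁻¹ Tr G` of order one, so that `J ≥ n / (4 N)`. -/
theorem min_le_smoothCount (hn : 1 ≤ n) (hmn : (m : ℝ) ≤ κ * n) (k : ℕ)
    (hκz : 8 * κ ≤ ‖z‖) :
    min (n : ℝ) (frobMean n M z / ‖meanDenom n M z‖ ^ 2) ≤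
      64 * κ / ‖z‖ ^ 2 + 4 * (3 ^ k * smoothCount ‖z‖ k M) / |z.im| := by
  have hn0 : (0 : ℝ) < n := by exact_mod_cast hn
  have hz0 : 0 < ‖z‖ := norm_pos_iff.mpr fun h => hz (by simp [h])
  have hv : 0 < |z.im| := abs_pos.mpr hz
  have hd1 := abs_im_mul_frobMean_le hM hz n
  have hD0 : 0 < ‖meanDenom n M z‖ := norm_pos_iff.mpr (meanDenom_ne_zero hM hz n)
  have hJ0 := frobMean_nonneg (M := M) (z := z) n
  have hκ : 0 ≤ κ := by
    by_contra h
    have : κ * n < 0 := mul_neg_of_neg_of_pos (not_le.mp h) hn0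
    linarith [(Nat.cast_nonneg m : (0 : ℝ) ≤ m)]
  have hbd := meanDenom_bounds_of_smoothCount_lt hM hz hn hmn k hκz
  obtain ⟨U, lam, hU, hlam, rfl⟩ := exists_spec hM
  have hcard := card_filter_le_sum_pow hlam hz0 k
  rw [← smoothCount_spec hU hlam hz0] at hcard
  set N := (Finset.univ.filter fun l => ‖z‖ / 2 < lam l).card with hN
  have hS0 : 0 ≤ 3 ^ k * smoothCount ‖z‖ k (spec U lam) := le_trans (Nat.cast_nonneg _) hcard
  by_cases hS : 3 ^ k * smoothCount ‖z‖ k (spec U lam) < 1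
  · obtain ⟨hJ, hDl, -⟩ := hbd hS
    refine (min_le_right _ _).trans ?_
    have h1 : frobMean n (spec U lam) z / ‖meanDenom n (spec U lam) z‖ ^ 2 ≤ 64 * κ / ‖z‖ ^ 2 := by
      rw [div_le_iff₀ (by positivity)]
      have h2 : 1 / 16 ≤ ‖meanDenom n (spec U lam) z‖ ^ 2 := by nlinarith
      calc frobMean n (spec U lam) z ≤ 4 * κ / ‖z‖ ^ 2 := hJ
        _ = 64 * κ / ‖z‖ ^ 2 * (1 / 16) := by ring
        _ ≤ _ := by gcongr
    have : 0 ≤ 4 * (3 ^ k * smoothCount ‖z‖ k (spec U lam)) / |z.im| := by positivity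
    linarith
  · push Not at hS
    refine le_trans ?_ (le_add_of_nonneg_left (by positivity))
    by_cases hcase : 1 / 4 ≤ ‖meanDenom n (spec U lam) z‖
    · refine (min_le_right _ _).trans ?_
      rw [div_le_div_iff₀ (by positivity) hv]
      set D := ‖meanDenom n (spec U lam) z‖
      calc frobMean n (spec U lam) z * |z.im| ≤ D := by linarith
        _ ≤ 4 * D ^ 2 := by nlinarith
        _ ≤ _ := by nlinarith
    · push Not at hcase
      have hDe := meanDenom_spec hU lam n hz
      set J := frobMean n (spec U lam) z with hJdef
      set D := meanDenom n (spec U lam) z with hD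
      rw [← Finset.mul_sum, ← Finset.sum_filter_add_sum_filter_not _ (fun l => ‖z‖ / 2 < lam l)]
        at hDe
      have h1 := sum_filter_not_norm_le hlam hz 1
      simp only [pow_one] at h1
      have h2 := sq_sum_le_card_mul_sum_sq (s := Finset.univ.filter fun l => ‖z‖ / 2 < lam l)
        (f := fun l => ‖((lam l : ℂ) - z)⁻¹‖)
      have h3 : ∑ l with ‖z‖ / 2 < lam l, ‖((lam l : ℂ) - z)⁻¹‖ ^ 2 ≤ n * J := by
        rw [hJdef, frobMean_spec hU lam n hz, mul_inv_cancel_left₀ hn0.ne']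
        exact Finset.sum_le_sum_of_subset_of_nonneg (Finset.filter_subset _ _)
          fun l _ _ => by positivity
      have h4 := norm_sum_le (Finset.univ.filter fun l => ‖z‖ / 2 < lam l)
        (fun l => ((lam l : ℂ) - z)⁻¹)
      have h5 := norm_sum_le (Finset.univ.filter fun l => ¬ ‖z‖ / 2 < lam l)
        (fun l => ((lam l : ℂ) - z)⁻¹)
      set A := ∑ l with ‖z‖ / 2 < lam l, ((lam l : ℂ) - z)⁻¹
      set B := ∑ l with ¬ ‖z‖ / 2 < lam l, ((lam l : ℂ) - z)⁻¹
      set a := ∑ l with ‖z‖ / 2 < lam l, ‖((lam l : ℂ) - z)⁻¹‖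
      have h6 : (n : ℝ) ≤ n * ‖D‖ + ‖A‖ + ‖B‖ := by
        have h7 : (n : ℂ) = n * D - A - B := by
          have : (n : ℂ) ≠ 0 := by exact_mod_cast hn0.ne'
          rw [hDe]; push_cast; field_simp; ring
        have h8 : ‖(n : ℂ)‖ ≤ ‖(n : ℂ) * D‖ + ‖A‖ + ‖B‖ := by
          conv_lhs => rw [h7]
          exact (norm_sub_le _ _).trans (add_le_add (norm_sub_le _ _) le_rfl)
        rwa [norm_mul, Complex.norm_natCast] at h8
      have h9 : (m : ℝ) * (2 / ‖z‖) ≤ n / 4 := by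
        rw [mul_div_assoc', div_le_iff₀ hz0]
        nlinarith
      have ha : (n : ℝ) / 2 ≤ a := by nlinarith
      have hNJ : (n : ℝ) ≤ 4 * N * J := by
        have : ((n : ℝ) / 2) ^ 2 ≤ N * (n * J) :=
          (pow_le_pow_left₀ (by positivity) ha 2).trans (h2.trans (by gcongr))
        nlinarith
      have hN1 : (1 : ℝ) ≤ N := by
        have : N ≠ 0 := by
          intro h
          rw [h] at hNJ
          simp at hNJ
          linarith
        exact_mod_cast Nat.one_le_iff_ne_zero.mpr this
      have hsq : min (n : ℝ) (J / ‖D‖ ^ 2) ^ 2 ≤ (2 * N / |z.im|) ^ 2 := by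
        have h0 : 0 ≤ min (n : ℝ) (J / ‖D‖ ^ 2) := le_min hn0.le (by positivity)
        calc min (n : ℝ) (J / ‖D‖ ^ 2) ^ 2
            ≤ n * (J / ‖D‖ ^ 2) := by
              rw [sq]; exact mul_le_mul (min_le_left _ _) (min_le_right _ _) h0 hn0.le
          _ ≤ 4 * N / |z.im| ^ 2 := by
              rw [mul_div_assoc', div_le_div_iff₀ (by positivity) (by positivity)]
              have h10 : (|z.im| * J) ^ 2 ≤ ‖D‖ ^ 2 := by gcongr
              calc (n : ℝ) * J * |z.im| ^ 2 ≤ 4 * N * J * J * |z.im| ^ 2 := by gcongr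
                _ = 4 * N * (|z.im| * J) ^ 2 := by ring
                _ ≤ _ := by gcongr
          _ ≤ _ := by
              rw [div_pow]
              gcongr
              nlinarith
      have h11 := le_of_sq_le_sq hsq (by positivity)
      refine h11.trans ?_
      gcongr
      linarith

/-- Eigenvalues below `‖z‖ / 2` contribute `O(‖z‖⁻²)` to `frobMean`, and for them the bound
`|meanDenom| ≥ |Im z| / ‖z‖` suffices. The contribution `A` of the others is at most their proportion
over `|Im z|²`, and for it the bound `|meanDenom| ≥ |Im z| A` is used. -/
theorem frobMean_mul_rpow_le (hn : 1 ≤ n) (hmn : (m : ℝ) ≤ κ * n) (k : ℕ) {δ Y c : ℝ}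
    (hδ : 0 < δ) (hδ1 : δ < 1) (hY : |z.im| ≤ Y)
    (hS : (3 ^ k * smoothCount ‖z‖ k M / n) ^ δ * ‖z‖ ^ (1 + δ) ≤ c) :
    frobMean n M z * ‖meanDenom n M z‖ ^ (δ - 1) * ‖z‖ ^ (1 + δ) ≤
      (4 * κ * Y ^ (2 * δ) + c) * |z.im| ^ (-(1 + δ)) := by
  have hn0 : (0 : ℝ) < n := by exact_mod_cast hn
  have hz0 : 0 < ‖z‖ := norm_pos_iff.mpr fun h => hz (by simp [h])
  have hv : 0 < |z.im| := abs_pos.mpr hz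
  have hd1 := abs_im_mul_frobMean_le hM hz n
  have hd2 := abs_im_le_norm_mul_meanDenom hM hz n
  have hD0 : 0 < ‖meanDenom n M z‖ := norm_pos_iff.mpr (meanDenom_ne_zero hM hz n)
  have hκ : 0 ≤ κ := by
    by_contra h
    have : κ * n < 0 := mul_neg_of_neg_of_pos (not_le.mp h) hn0
    linarith [(Nat.cast_nonneg m : (0 : ℝ) ≤ m)]
  obtain ⟨U, lam, hU, hlam, rfl⟩ := exists_spec hM
  have hcard := card_filter_le_sum_pow hlam hz0 k
  rw [← smoothCount_spec hU hlam hz0] at hcard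
  set N := (Finset.univ.filter fun l => ‖z‖ / 2 < lam l).card with hN
  set D := ‖meanDenom n (spec U lam) z‖
  have hJ := frobMean_spec hU lam n hz
  rw [← Finset.sum_filter_add_sum_filter_not _ (fun l => ‖z‖ / 2 < lam l), mul_add] at hJ
  have h1 := sum_filter_norm_sq_le lam hz
  have h2 := sum_filter_not_norm_le hlam hz 2
  rw [← hN] at h1
  set A := ∑ l with ‖z‖ / 2 < lam l, ‖((lam l : ℂ) - z)⁻¹‖ ^ 2
  set B := ∑ l with ¬ ‖z‖ / 2 < lam l, ‖((lam l : ℂ) - z)⁻¹‖ ^ 2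
  set R := ‖z‖
  set v := |z.im|
  have hA0 : 0 ≤ A := Finset.sum_nonneg fun l _ => by positivity
  have hB0 : 0 ≤ B := Finset.sum_nonneg fun l _ => by positivity
  have hB : (n : ℝ)⁻¹ * B ≤ 4 * κ * R ^ (-2 : ℝ) := by
    rw [inv_mul_le_iff₀ hn0]
    refine h2.trans ?_
    rw [div_pow, Real.rpow_neg hz0.le, Real.rpow_ofNat]
    calc (m : ℝ) * (2 ^ 2 / R ^ 2) ≤ κ * n * (2 ^ 2 / R ^ 2) := by gcongr
      _ = _ := by ring
  have hsmall : (n : ℝ)⁻¹ * B * D ^ (δ - 1) * R ^ (1 + δ) ≤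
      4 * κ * Y ^ (2 * δ) * v ^ (-(1 + δ)) := by
    have hDv : D ^ (δ - 1) ≤ (v / R) ^ (δ - 1) :=
      Real.rpow_le_rpow_of_nonpos (by positivity) (by rwa [div_le_iff₀' hz0]) (by linarith)
    calc (n : ℝ)⁻¹ * B * D ^ (δ - 1) * R ^ (1 + δ)
        ≤ 4 * κ * R ^ (-2 : ℝ) * (v / R) ^ (δ - 1) * R ^ (1 + δ) := by gcongr
      _ = 4 * κ * v ^ (δ - 1) * (R ^ (-2 : ℝ) * R ^ (-(δ - 1)) * R ^ (1 + δ)) := by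
          rw [Real.div_rpow hv.le hz0.le, Real.rpow_neg hz0.le (δ - 1)]
          ring
      _ = 4 * κ * (v ^ (2 * δ) * v ^ (-(1 + δ))) := by
          rw [← Real.rpow_add hz0, ← Real.rpow_add hz0, ← Real.rpow_add hv,
            show (-2 : ℝ) + -(δ - 1) + (1 + δ) = 0 by ring, Real.rpow_zero,
            show 2 * δ + -(1 + δ) = δ - 1 by ring, mul_one]
      _ ≤ 4 * κ * (Y ^ (2 * δ) * v ^ (-(1 + δ))) := by gcongr
      _ = _ := by ring
  have hlarge : (n : ℝ)⁻¹ * A * D ^ (δ - 1) * R ^ (1 + δ) ≤ c * v ^ (-(1 + δ)) := by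
    rcases hA0.eq_or_lt with hA | hA
    · have hc : 0 ≤ c := le_trans (mul_nonneg (Real.rpow_nonneg (by
        have : (0 : ℝ) ≤ N := Nat.cast_nonneg _
        exact div_nonneg (this.trans hcard) hn0.le) _) (by positivity)) hS
      rw [← hA, mul_zero, zero_mul, zero_mul]
      positivity
    have hAn : 0 < (n : ℝ)⁻¹ * A := by positivity
    have hDv : D ^ (δ - 1) ≤ (v * ((n : ℝ)⁻¹ * A)) ^ (δ - 1) := by
      refine Real.rpow_le_rpow_of_nonpos (by positivity) (le_trans ?_ hd1) (by linarith)
      refine mul_le_mul_of_nonneg_left ?_ hv.le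
      rw [hJ]
      exact le_add_of_nonneg_right (by positivity)
    have hAN : (n : ℝ)⁻¹ * A ≤ 3 ^ k * smoothCount R k (spec U lam) / n * v ^ (-2 : ℝ) := by
      rw [inv_mul_le_iff₀ hn0, Real.rpow_neg hv.le, Real.rpow_ofNat]
      refine (h1.trans (div_le_div_of_nonneg_right hcard (by positivity))).trans (le_of_eq ?_)
      field_simp
    have hS0 : 0 ≤ 3 ^ k * smoothCount R k (spec U lam) / n :=
      div_nonneg (le_trans (Nat.cast_nonneg _) hcard) hn0.le
    calc (n : ℝ)⁻¹ * A * D ^ (δ - 1) * R ^ (1 + δ)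
        ≤ (n : ℝ)⁻¹ * A * (v * ((n : ℝ)⁻¹ * A)) ^ (δ - 1) * R ^ (1 + δ) := by gcongr
      _ = v ^ (δ - 1) * ((n : ℝ)⁻¹ * A) ^ δ * R ^ (1 + δ) := by
          rw [Real.mul_rpow hv.le hAn.le, Real.rpow_sub_one hAn.ne']
          field_simp
      _ ≤ v ^ (δ - 1) * (3 ^ k * smoothCount R k (spec U lam) / n * v ^ (-2 : ℝ)) ^ δ *
            R ^ (1 + δ) := by gcongr
      _ = (3 ^ k * smoothCount R k (spec U lam) / n) ^ δ * R ^ (1 + δ) *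
            (v ^ (δ - 1) * v ^ (-2 * δ)) := by
          rw [Real.mul_rpow hS0 (by positivity), ← Real.rpow_mul hv.le]
          ring
      _ ≤ c * (v ^ (δ - 1) * v ^ (-2 * δ)) := by gcongr
      _ = _ := by
          rw [← Real.rpow_add hv, show δ - 1 + -2 * δ = -(1 + δ) by ring]
  calc frobMean n (spec U lam) z * D ^ (δ - 1) * R ^ (1 + δ)
      = (n : ℝ)⁻¹ * A * D ^ (δ - 1) * R ^ (1 + δ) +
        (n : ℝ)⁻¹ * B * D ^ (δ - 1) * R ^ (1 + δ) := by rw [hJ]; ring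
    _ ≤ _ := by linarith

/-- `frobMean` controls the Frobenius norm of `G²`. -/
theorem sum_norm_sq_green_sq_le (n : ℕ) :
    (n : ℝ)⁻¹ * ∑ k, ∑ l, ‖(greenMatrix M z * greenMatrix M z) k l‖ ^ 2 ≤
      frobMean n M z / |z.im| ^ 2 := by
  obtain ⟨U, lam, hU, hlam, rfl⟩ := exists_spec hM
  rw [frobMean_spec hU lam n hz, green_spec hU lam hz, spec_mul hU, sum_norm_sq_spec hU, mul_div_assoc,
    Finset.sum_div]
  refine mul_le_mul_of_nonneg_left (Finset.sum_le_sum fun l _ => ?_) (by positivity)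
  rw [norm_mul, mul_pow, div_eq_mul_inv, ← inv_pow]
  gcongr
  exact norm_inv_sub_le hz _

/-- `n⁻¹ Tr G² / (1 + n⁻¹ Tr G)` obeys the bound of `norm_quad_sq_div_le`. -/
theorem norm_trace_sq_div_le (n : ℕ) :
    ‖(n : ℂ)⁻¹ * (greenMatrix M z * greenMatrix M z).trace / meanDenom n M z‖ ≤ |z.im|⁻¹ := by
  have hD0 : 0 < ‖meanDenom n M z‖ := norm_pos_iff.mpr (meanDenom_ne_zero hM hz n)
  have hd1 := abs_im_mul_frobMean_le hM hz n
  have hv : 0 < |z.im| := abs_pos.mpr hz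
  rw [norm_div, div_le_iff₀ hD0, le_inv_mul_iff₀ hv]
  refine le_trans (mul_le_mul_of_nonneg_left ?_ hv.le) hd1
  obtain ⟨U, lam, hU, hlam, rfl⟩ := exists_spec hM
  rw [frobMean_spec hU lam n hz, green_spec hU lam hz, spec_mul hU, trace_spec hU, norm_mul, norm_inv,
    Complex.norm_natCast]
  refine mul_le_mul_of_nonneg_left ((norm_sum_le _ _).trans (le_of_eq ?_)) (by positivity)
  simp_rw [norm_mul, sq]

theorem norm_trace_green_le : ‖(greenMatrix M z).trace‖ ≤ m * |z.im|⁻¹ := by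
  obtain ⟨U, lam, hU, hlam, rfl⟩ := exists_spec hM
  rw [green_spec hU lam hz, trace_spec hU]
  refine (norm_sum_le _ _).trans ((Finset.sum_le_card_nsmul _ _ |z.im|⁻¹ fun l _ =>
    norm_inv_sub_le hz _).trans ?_)
  simp

end Deterministic

/-! ### Product measures and the Efron–Stein inequality -/

section Product
variable {ι E : Type*} [Fintype ι] [DecidableEq ι] [MeasurableSpace E] (μ : ι → Measure E)
  [∀ i, IsProbabilityMeasure (μ i)]

/-- Resampling one coordinate of a product measure preserves it. -/
theorem measurePreserving_update (i : ι) :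
    MeasurePreserving (fun p : (ι → E) × E => Function.update p.1 i p.2)
      ((Measure.pi μ).prod (μ i)) (Measure.pi μ) := by
  have hmeas : Measurable (fun p : (ι → E) × E => Function.update p.1 i p.2) := by
    refine measurable_pi_lambda _ fun j => ?_
    by_cases h : j = i
    · subst h; simpa using measurable_snd
    · simp only [Function.update_of_ne h]
      exact (measurable_pi_apply j).comp measurable_fst
  refine ⟨hmeas, (Measure.pi_eq fun s hs => ?_).symm⟩
  rw [Measure.map_apply hmeas (MeasurableSet.univ_pi hs)]
  have : (fun p : (ι → E) × E => Function.update p.1 i p.2) ⁻¹' (Set.univ.pi s) =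
      (Set.univ.pi (Function.update s i Set.univ)) ×ˢ s i := by
    ext ⟨x, t⟩
    simp only [Set.mem_preimage, Set.mem_univ_pi, Set.mem_prod]
    constructor
    · refine fun h => ⟨fun j => ?_, by simpa using h i⟩
      by_cases hj : j = i
      · subst hj; simp
      · simpa [Function.update_of_ne hj] using h j
    · rintro ⟨h1, h2⟩ j
      by_cases hj : j = i
      · subst hj; simpa using h2
      · simpa [Function.update_of_ne hj] using h1 j
  rw [this, Measure.prod_prod, Measure.pi_pi, ← Finset.mul_prod_erase _ _ (Finset.mem_univ i),
    ← Finset.mul_prod_erase Finset.univ (fun j => μ j (s j)) (Finset.mem_univ i),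
    Function.update_self, measure_univ, one_mul, mul_comm]
  congr 1
  refine Finset.prod_congr rfl fun j hj => ?_
  rw [Function.update_of_ne (Finset.ne_of_mem_erase hj)]

theorem integral_eq_integral_update {F : Type*} [NormedAddCommGroup F] [NormedSpace ℝ F]
    {f : (ι → E) → F} (hf : Integrable f (Measure.pi μ)) (i : ι) :
    ∫ x, f x ∂Measure.pi μ = ∫ x, ∫ t, f (Function.update x i t) ∂μ i ∂Measure.pi μ := by
  have mp := measurePreserving_update μ i
  have h := (mp.integrable_comp hf.aestronglyMeasurable).mpr hf
  have h2 := integral_map mp.measurable.aemeasurable (f := f)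
    (by rw [mp.map_eq]; exact hf.aestronglyMeasurable)
  rw [mp.map_eq] at h2
  rw [h2]
  exact integral_prod (fun p : (ι → E) × E => f (Function.update p.1 i p.2)) h

theorem integral_le_of_integral_update_le {f g : (ι → E) → ℝ} (hf : Integrable f (Measure.pi μ))
    (hg : Integrable g (Measure.pi μ)) (i : ι)
    (h : ∀ x, ∫ t, f (Function.update x i t) ∂μ i ≤ g x) :
    ∫ x, f x ∂Measure.pi μ ≤ ∫ x, g x ∂Measure.pi μ := by
  rw [integral_eq_integral_update μ hf i]
  have mp := measurePreserving_update μ i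
  have h' := (mp.integrable_comp hf.aestronglyMeasurable).mpr hf
  exact integral_mono h'.integral_prod_left hg h

end Product

section EfronStein
variable {F : Type*} [NormedAddCommGroup F] [InnerProductSpace ℝ F] [CompleteSpace F]

theorem integrable_of_bound {α G : Type*} [MeasurableSpace α] {ν : Measure α} [IsFiniteMeasure ν]
    [NormedAddCommGroup G] {f : α → G} (hf : StronglyMeasurable f) {B : ℝ} (hB : ∀ x, ‖f x‖ ≤ B) :
    Integrable f ν :=
  Integrable.of_bound hf.aestronglyMeasurable B (Filter.Eventually.of_forall hB)

theorem integrable_norm_sq_of_bound {α G : Type*} [MeasurableSpace α] {ν : Measure α}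
    [IsFiniteMeasure ν] [NormedAddCommGroup G] {f : α → G} (hf : StronglyMeasurable f) {B : ℝ}
    (hB : ∀ x, ‖f x‖ ≤ B) : Integrable (fun x => ‖f x‖ ^ 2) ν :=
  integrable_of_bound (hf.norm.pow 2) (B := B ^ 2) fun x => by
    rw [norm_pow, norm_norm]
    exact pow_le_pow_left₀ (norm_nonneg _) (hB x) 2

/-- The bias–variance decomposition. -/
theorem integral_norm_sub_sq {α : Type*} [MeasurableSpace α] {ν : Measure α}
    [IsProbabilityMeasure ν] {f : α → F} (hf : StronglyMeasurable f) {B : ℝ}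
    (hB : ∀ x, ‖f x‖ ≤ B) (c : F) :
    ∫ x, ‖f x - c‖ ^ 2 ∂ν = ∫ x, ‖f x - ∫ y, f y ∂ν‖ ^ 2 ∂ν + ‖∫ y, f y ∂ν - c‖ ^ 2 := by
  set e := ∫ y, f y ∂ν
  have hfi : Integrable f ν := integrable_of_bound hf hB
  have h1 : Integrable (fun x => ‖f x - e‖ ^ 2) ν :=
    integrable_norm_sq_of_bound (hf.sub stronglyMeasurable_const) (B := B + ‖e‖) fun x =>
      (norm_sub_le _ _).trans (add_le_add (hB x) le_rfl)
  have h2 : Integrable (fun x => 2 * inner ℝ (e - c) (f x - e)) ν :=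
    ((hfi.sub (integrable_const e)).const_inner (𝕜 := ℝ) (e - c)).const_mul 2
  have h3 : ∫ x, inner ℝ (e - c) (f x - e) ∂ν = 0 := by
    have h := integral_inner (𝕜 := ℝ) (hfi.sub (integrable_const e)) (e - c)
    simp only [Pi.sub_apply] at h
    rw [h, integral_sub hfi (integrable_const e)]
    simp [e]
  have h4 : ∀ x, ‖f x - c‖ ^ 2 =
      ‖f x - e‖ ^ 2 + 2 * inner ℝ (e - c) (f x - e) + ‖e - c‖ ^ 2 := by
    intro x
    have := norm_add_sq_real (f x - e) (e - c)
    rw [sub_add_sub_cancel] at this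
    rw [this, real_inner_comm]
  simp_rw [h4]
  rw [integral_add (by exact h1.add h2) (integrable_const _), integral_add h1 h2,
    integral_const_mul, h3]
  simp

theorem norm_integral_sq_le {α : Type*} [MeasurableSpace α] {ν : Measure α}
    [IsProbabilityMeasure ν] {f : α → F} (hf : StronglyMeasurable f) {B : ℝ}
    (hB : ∀ x, ‖f x‖ ≤ B) : ‖∫ x, f x ∂ν‖ ^ 2 ≤ ∫ x, ‖f x‖ ^ 2 ∂ν := by
  have h := integral_norm_sub_sq (ν := ν) hf hB 0
  simp only [sub_zero] at h
  rw [h]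
  exact le_add_of_nonneg_left (integral_nonneg fun x => by positivity)

theorem measurePreserving_cons {E : Type*} [MeasurableSpace E] {n : ℕ} (μ : Fin (n + 1) → Measure E)
    [∀ i, IsProbabilityMeasure (μ i)] :
    MeasurePreserving (fun p : E × (Fin n → E) => (Fin.cons p.1 p.2 : Fin (n + 1) → E))
      ((μ 0).prod (Measure.pi fun j : Fin n => μ j.succ)) (Measure.pi μ) := by
  have := (measurePreserving_piFinSuccAbove μ 0).symm
  simp only [Fin.zero_succAbove, MeasurableEquiv.piFinSuccAbove_symm_apply, Fin.insertNthEquiv_zero] at this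
  exact this

theorem integral_pi_cons {E G : Type*} [MeasurableSpace E] {n : ℕ} (μ : Fin (n + 1) → Measure E)
    [∀ i, IsProbabilityMeasure (μ i)] [NormedAddCommGroup G] [NormedSpace ℝ G]
    {g : (Fin (n + 1) → E) → G} (hg : StronglyMeasurable g) {C : ℝ} (hC : ∀ x, ‖g x‖ ≤ C) :
    ∫ x, g x ∂Measure.pi μ = ∫ y : Fin n → E, ∫ t, g (Fin.cons t y) ∂μ 0
      ∂Measure.pi fun j : Fin n => μ j.succ := by
  have mp := measurePreserving_cons μ
  have hgc : Integrable (fun p : E × (Fin n → E) => g (Fin.cons p.1 p.2))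
      ((μ 0).prod (Measure.pi fun j : Fin n => μ j.succ)) :=
    integrable_of_bound (hg.comp_measurable mp.measurable) (B := C) fun p => hC _
  rw [← integral_prod_symm (fun p : E × (Fin n → E) => g (Fin.cons p.1 p.2)) hgc, ← mp.map_eq]
  exact integral_map mp.measurable.aemeasurable hg.aestronglyMeasurable

/-- The Efron–Stein inequality: the variance of a function of independent variables is at most the
sum over `i` of its mean squared distances to functions `h i` that do not depend on variable
`i`. -/
theorem efron_stein {E : Type*} [MeasurableSpace E] {n : ℕ} (μ : Fin n → Measure E)
    [∀ i, IsProbabilityMeasure (μ i)] {f : (Fin n → E) → F} (hf : StronglyMeasurable f) {B : ℝ}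
    (hB : ∀ x, ‖f x‖ ≤ B) {h : Fin n → (Fin n → E) → F} (hh : ∀ i, StronglyMeasurable (h i))
    (hhB : ∀ i x, ‖h i x‖ ≤ B) (hinv : ∀ i x t, h i (Function.update x i t) = h i x) :
    ∫ x, ‖f x - ∫ y, f y ∂Measure.pi μ‖ ^ 2 ∂Measure.pi μ ≤
      ∑ i, ∫ x, ‖f x - h i x‖ ^ 2 ∂Measure.pi μ := by
  induction n with
  | zero =>
    have hc : ∀ x, f x = f default := fun x => congrArg f (Subsingleton.elim _ _)
    simp [hc]
  | succ n ih =>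
    set ν := μ 0
    set π := Measure.pi fun j : Fin n => μ j.succ
    have hne : Nonempty E := by
      by_contra hE
      rw [not_nonempty_iff] at hE
      have := measure_univ (μ := ν)
      simp [Measure.eq_zero_of_isEmpty] at this
    obtain ⟨t₀⟩ := hne
    set c : E × (Fin n → E) → (Fin (n + 1) → E) := fun p => Fin.cons p.1 p.2
    have hcm : Measurable c := (measurePreserving_cons μ).measurable
    have hbd : ∀ {g : (Fin (n + 1) → E) → F} {C : ℝ} (_ : ∀ x, ‖g x‖ ≤ C) (y : Fin n → E),
        ‖∫ t, g (c (t, y)) ∂ν‖ ≤ C := by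
      intro g C hC y
      have := norm_integral_le_of_norm_le_const (μ := ν) (f := fun t => g (c (t, y)))
        (Filter.Eventually.of_forall fun t => hC _)
      simpa using this
    have hsm : ∀ {g : (Fin (n + 1) → E) → F} (_ : StronglyMeasurable g),
        StronglyMeasurable fun y => ∫ t, g (c (t, y)) ∂ν := by
      intro g hg
      exact StronglyMeasurable.integral_prod_left' (f := fun p => g (c p)) (hg.comp_measurable hcm)
    have hsec : ∀ {g : (Fin (n + 1) → E) → F} (_ : StronglyMeasurable g) (y : Fin n → E),
        StronglyMeasurable fun t => g (c (t, y)) := by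
      intro g hg y
      exact hg.comp_measurable (hcm.comp (by fun_prop))
    set fbar : (Fin n → E) → F := fun y => ∫ t, f (c (t, y)) ∂ν with hfbar
    have hmean : ∫ y, f y ∂Measure.pi μ = ∫ y, fbar y ∂π := integral_pi_cons μ hf hB
    set e := ∫ y, f y ∂Measure.pi μ with he
    have hsq : ∀ {g : (Fin (n + 1) → E) → F} (_ : StronglyMeasurable g) {C : ℝ}
        (_ : ∀ x, ‖g x‖ ≤ C),
        ∫ x, ‖g x‖ ^ 2 ∂Measure.pi μ = ∫ y, ∫ t, ‖g (c (t, y))‖ ^ 2 ∂ν ∂π := by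
      intro g hg C hC
      refine integral_pi_cons μ (g := fun x => ‖g x‖ ^ 2) (hg.norm.pow 2) (C := C ^ 2) fun x => ?_
      rw [norm_pow, norm_norm]
      exact pow_le_pow_left₀ (norm_nonneg _) (hC x) 2
    have hsqi : ∀ {g : (Fin (n + 1) → E) → F} (_ : StronglyMeasurable g) {C : ℝ}
        (_ : ∀ x, ‖g x‖ ≤ C), Integrable (fun y => ∫ t, ‖g (c (t, y))‖ ^ 2 ∂ν) π := by
      intro g hg C hC
      have : Integrable (fun p => ‖g (c p)‖ ^ 2) (ν.prod π) :=
        integrable_norm_sq_of_bound (hg.comp_measurable hcm) (B := C) fun p => hC _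
      exact this.integral_prod_right
    have hfe : StronglyMeasurable fun x => f x - e := hf.sub stronglyMeasurable_const
    have hfeB : ∀ x, ‖f x - e‖ ≤ B + ‖e‖ := fun x =>
      (norm_sub_le _ _).trans (add_le_add (hB x) le_rfl)
    have hfh : ∀ i, StronglyMeasurable fun x => f x - h i x := fun i => hf.sub (hh i)
    have hfhB : ∀ i x, ‖f x - h i x‖ ≤ B + B := fun i x =>
      (norm_sub_le _ _).trans (add_le_add (hB x) (hhB i x))
    have hstep : ∀ y, ∫ t, ‖f (c (t, y)) - e‖ ^ 2 ∂ν ≤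
        ∫ t, ‖f (c (t, y)) - h 0 (c (t, y))‖ ^ 2 ∂ν + ‖fbar y - e‖ ^ 2 := by
      intro y
      rw [integral_norm_sub_sq (hsec hf y) (fun t => hB _) e]
      refine add_le_add ?_ le_rfl
      have h0 : ∀ t, h 0 (c (t, y)) = h 0 (c (t₀, y)) := by
        intro t
        rw [← hinv 0 (c (t₀, y)) t]
        simp [c, Fin.update_cons_zero]
      simp_rw [h0]
      rw [integral_norm_sub_sq (hsec hf y) (fun t => hB _) (h 0 (c (t₀, y)))]
      exact le_add_of_nonneg_right (by positivity)
    have hih := ih (fun j => μ j.succ) (f := fbar) (hsm hf) (hbd hB)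
      (h := fun j y => ∫ t, h j.succ (c (t, y)) ∂ν) (fun j => hsm (hh _)) (fun j => hbd (hhB _))
      (by
        intro j y s
        refine integral_congr_ae (Filter.Eventually.of_forall fun t => ?_)
        show h j.succ (Fin.cons t (Function.update y j s)) = h j.succ (Fin.cons t y)
        rw [Fin.cons_update, hinv])
    rw [← hmean] at hih
    have hfbari : Integrable (fun y => ‖fbar y - e‖ ^ 2) π :=
      integrable_norm_sq_of_bound ((hsm hf).sub stronglyMeasurable_const) (B := B + ‖e‖) fun y =>
        (norm_sub_le _ _).trans (add_le_add (hbd hB y) le_rfl)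
    rw [hsq hfe hfeB, Fin.sum_univ_succ]
    calc ∫ y, ∫ t, ‖f (c (t, y)) - e‖ ^ 2 ∂ν ∂π
        ≤ ∫ y, (∫ t, ‖f (c (t, y)) - h 0 (c (t, y))‖ ^ 2 ∂ν + ‖fbar y - e‖ ^ 2) ∂π :=
          integral_mono (hsqi hfe hfeB) ((hsqi (hfh 0) (hfhB 0)).add hfbari) hstep
      _ = ∫ x, ‖f x - h 0 x‖ ^ 2 ∂Measure.pi μ + ∫ y, ‖fbar y - e‖ ^ 2 ∂π := by
          rw [integral_add (hsqi (hfh 0) (hfhB 0)) hfbari, hsq (hfh 0) (hfhB 0)]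
      _ ≤ _ := by
          refine add_le_add le_rfl (hih.trans (Finset.sum_le_sum fun j _ => ?_))
          rw [hsq (hfh j.succ) (hfhB j.succ)]
          refine integral_mono ?_ (hsqi (hfh j.succ) (hfhB j.succ)) fun y => ?_
          · exact integrable_norm_sq_of_bound ((hsm hf).sub (hsm (hh _))) (B := B + B) fun y =>
              (norm_sub_le _ _).trans (add_le_add (hbd hB y) (hbd (hhB _) y))
          · have hi1 : Integrable (fun t => f (c (t, y))) ν :=
              integrable_of_bound (hsec hf y) fun t => hB _
            have hi2 : Integrable (fun t => h j.succ (c (t, y))) ν :=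
              integrable_of_bound (hsec (hh _) y) fun t => hhB _ _
            simp only [hfbar]
            rw [← integral_sub hi1 hi2]
            exact norm_integral_sq_le (hsec (hfh j.succ) y) fun t => hfhB _ _

end EfronStein

/-! ### Quadratic forms in independent variables -/

section QuadraticForms

/-- A probability law on `ℝ` with mean `0`, variance `1` and fourth moment at most `X₄`. -/
structure HasUnitMoments (ν : Measure ℝ) (X₄ : ℝ) : Prop where
  isProb : IsProbabilityMeasure ν
  integrable_four : Integrable (fun t => t ^ 4) ν
  mean : ∫ t, t ∂ν = 0
  second : ∫ t, t ^ 2 ∂ν = 1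
  fourth : ∫ t, t ^ 4 ∂ν ≤ X₄

theorem HasUnitMoments.integrable_sq {ν : Measure ℝ} {X₄ : ℝ} (h : HasUnitMoments ν X₄) :
    Integrable (fun t => t ^ 2) ν := by
  have := h.isProb
  refine Integrable.mono' (h.integrable_four.add (integrable_const 1)) (by fun_prop)
    (Filter.Eventually.of_forall fun t => ?_)
  rw [Real.norm_of_nonneg (sq_nonneg t)]
  simp only [Pi.add_apply]
  nlinarith [sq_nonneg (t ^ 2 - 1)]

variable {m : ℕ} {ν : Fin m → Measure ℝ} {X₄ : ℝ}

/-- The centred products `t_k t_l - δ_kl`. -/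
noncomputable def prodDev (p : Fin m × Fin m) (t : Fin m → ℝ) : ℝ :=
  t p.1 * t p.2 - if p.1 = p.2 then 1 else 0

theorem measurable_prodDev (p : Fin m × Fin m) : Measurable (prodDev p) := by
  unfold prodDev; fun_prop

theorem prodDev_sq_le (p : Fin m × Fin m) (t : Fin m → ℝ) :
    prodDev p t ^ 2 ≤ (t p.1 ^ 4 + t p.2 ^ 4) / 2 + 1 := by
  unfold prodDev
  split_ifs with h
  · rw [h]; nlinarith [sq_nonneg (t p.2)]
  · nlinarith [sq_nonneg (t p.1 ^ 2 - t p.2 ^ 2)]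

theorem integrable_eval_pow_four (hν : ∀ k, HasUnitMoments (ν k) X₄) (k : Fin m) :
    Integrable (fun t : Fin m → ℝ => t k ^ 4) (Measure.pi ν) := by
  have := fun k => (hν k).isProb
  exact ((measurePreserving_eval ν k).integrable_comp
    (hν k).integrable_four.aestronglyMeasurable).mpr (hν k).integrable_four

theorem integral_eval_pow_four_le (hν : ∀ k, HasUnitMoments (ν k) X₄) (k : Fin m) :
    ∫ t : Fin m → ℝ, t k ^ 4 ∂Measure.pi ν ≤ X₄ := by
  have := fun k => (hν k).isProb
  have mp := measurePreserving_eval ν k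
  refine le_trans (le_of_eq ?_) (hν k).fourth
  rw [← mp.map_eq]
  exact (integral_map (f := fun s : ℝ => s ^ 4) mp.measurable.aemeasurable
    (continuous_pow 4).aestronglyMeasurable).symm

theorem integrable_prodDev_sq (hν : ∀ k, HasUnitMoments (ν k) X₄) (p : Fin m × Fin m) :
    Integrable (fun t => prodDev p t ^ 2) (Measure.pi ν) := by
  have := fun k => (hν k).isProb
  refine Integrable.mono' ((((integrable_eval_pow_four hν p.1).add
    (integrable_eval_pow_four hν p.2)).div_const 2).add (integrable_const 1))
    ((measurable_prodDev p).pow_const 2).aestronglyMeasurable (Filter.Eventually.of_forall fun t => ?_)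
  rw [Real.norm_of_nonneg (sq_nonneg _)]
  exact prodDev_sq_le p t

theorem integral_prodDev_sq_le (hν : ∀ k, HasUnitMoments (ν k) X₄) (p : Fin m × Fin m) :
    ∫ t, prodDev p t ^ 2 ∂Measure.pi ν ≤ X₄ + 1 := by
  have := fun k => (hν k).isProb
  have h1 := (integrable_eval_pow_four hν p.1).add (integrable_eval_pow_four hν p.2)
  refine (integral_mono (integrable_prodDev_sq hν p) ((h1.div_const 2).add (integrable_const 1))
    (prodDev_sq_le p)).trans ?_
  simp only [Pi.add_apply]
  rw [integral_add (by exact h1.div_const 2) (integrable_const 1), integral_div,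
    integral_add (integrable_eval_pow_four hν p.1) (integrable_eval_pow_four hν p.2)]
  have h2 := integral_eval_pow_four_le hν p.1
  have h3 := integral_eval_pow_four_le hν p.2
  simp only [integral_const, probReal_univ, smul_eq_mul]
  linarith

theorem memLp_prodDev (hν : ∀ k, HasUnitMoments (ν k) X₄) (p : Fin m × Fin m) :
    MemLp (prodDev p) 2 (Measure.pi ν) :=
  (memLp_two_iff_integrable_sq (measurable_prodDev p).aestronglyMeasurable).mpr
    (integrable_prodDev_sq hν p)

theorem integrable_prodDev_mul (hν : ∀ k, HasUnitMoments (ν k) X₄) (p q : Fin m × Fin m) :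
    Integrable (fun t => prodDev p t * prodDev q t) (Measure.pi ν) :=
  (memLp_prodDev hν p).integrable_mul (memLp_prodDev hν q)

theorem integrable_prodDev (hν : ∀ k, HasUnitMoments (ν k) X₄) (p : Fin m × Fin m) :
    Integrable (prodDev p) (Measure.pi ν) := by
  have := fun k => (hν k).isProb
  exact (memLp_prodDev hν p).integrable (by norm_num)

/-- Averaging `t_k t_l - δ_kl` over one of its variables gives zero. -/
theorem integral_prodDev_update (hν : ∀ k, HasUnitMoments (ν k) X₄) {p : Fin m × Fin m} {i : Fin m}
    (hi : i = p.1 ∨ i = p.2) (x : Fin m → ℝ) :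
    ∫ s, prodDev p (Function.update x i s) ∂ν i = 0 := by
  have := (hν i).isProb
  obtain ⟨k, l⟩ := p
  simp only [prodDev]
  by_cases hkl : k = l
  · subst hkl
    obtain rfl : i = k := by simpa using hi
    simp only [Function.update_self, if_true, ← sq]
    rw [integral_sub (hν i).integrable_sq (integrable_const 1), (hν i).second]
    simp
  · simp only [hkl, if_false, sub_zero]
    rcases hi with rfl | rfl
    · simp only [Function.update_self, Function.update_of_ne (Ne.symm hkl)]
      rw [integral_mul_const, (hν i).mean, zero_mul]
    · simp only [Function.update_self, Function.update_of_ne hkl]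
      rw [integral_const_mul, (hν i).mean, mul_zero]

theorem integral_prodDev (hν : ∀ k, HasUnitMoments (ν k) X₄) (p : Fin m × Fin m) :
    ∫ t, prodDev p t ∂Measure.pi ν = 0 := by
  have := fun k => (hν k).isProb
  rw [integral_eq_integral_update ν (integrable_prodDev hν p) p.1]
  simp [integral_prodDev_update hν (p := p) (i := p.1) (Or.inl rfl)]

theorem integral_prodDev_mul_eq_zero_of_mem (hν : ∀ k, HasUnitMoments (ν k) X₄)
    {p q : Fin m × Fin m} {i : Fin m} (hi : i = p.1 ∨ i = p.2) (h1 : q.1 ≠ i) (h2 : q.2 ≠ i) :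
    ∫ t, prodDev p t * prodDev q t ∂Measure.pi ν = 0 := by
  have := fun k => (hν k).isProb
  rw [integral_eq_integral_update ν (integrable_prodDev_mul hν p q) i]
  have h : ∀ x s, prodDev q (Function.update x i s) = prodDev q x := by
    intro x s
    simp [prodDev, Function.update_of_ne h1, Function.update_of_ne h2]
  simp [h, integral_mul_const, integral_prodDev_update hν hi]

theorem integral_prodDev_mul_eq_zero (hν : ∀ k, HasUnitMoments (ν k) X₄)
    {p q : Fin m × Fin m} (h1 : q ≠ p) (h2 : q ≠ p.swap) :
    ∫ t, prodDev p t * prodDev q t ∂Measure.pi ν = 0 := by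
  by_cases h : ∃ i, (i = p.1 ∨ i = p.2) ∧ q.1 ≠ i ∧ q.2 ≠ i
  · obtain ⟨i, hi, hq1, hq2⟩ := h
    exact integral_prodDev_mul_eq_zero_of_mem hν hi hq1 hq2
  · have h' : ∃ i, (i = q.1 ∨ i = q.2) ∧ p.1 ≠ i ∧ p.2 ≠ i := by
      obtain ⟨a, b⟩ := p
      obtain ⟨c, d⟩ := q
      simp only [ne_eq, Prod.mk.injEq, Prod.swap_prod_mk] at h1 h2 h ⊢
      by_contra h'
      push Not at h h'
      have ha := h a (Or.inl rfl)
      have hb := h b (Or.inr rfl)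
      have hc := h' c (Or.inl rfl)
      have hd := h' d (Or.inr rfl)
      grind
    obtain ⟨i, hi, hp1, hp2⟩ := h'
    simp_rw [mul_comm (prodDev p _)]
    exact integral_prodDev_mul_eq_zero_of_mem hν hi hp1 hp2

theorem abs_integral_prodDev_mul_le (hν : ∀ k, HasUnitMoments (ν k) X₄) (p q : Fin m × Fin m) :
    |∫ t, prodDev p t * prodDev q t ∂Measure.pi ν| ≤ X₄ + 1 := by
  rw [← Real.norm_eq_abs]
  refine (norm_integral_le_integral_norm _).trans ?_
  have h1 := integrable_prodDev_sq hν p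
  have h2 := integrable_prodDev_sq hν q
  calc ∫ t, ‖prodDev p t * prodDev q t‖ ∂Measure.pi ν
      ≤ ∫ t, (prodDev p t ^ 2 + prodDev q t ^ 2) / 2 ∂Measure.pi ν := by
        refine integral_mono (integrable_prodDev_mul hν p q).norm ((h1.add h2).div_const 2) fun t => ?_
        simp only [norm_mul, Real.norm_eq_abs]
        nlinarith [sq_nonneg (|prodDev p t| - |prodDev q t|), sq_abs (prodDev p t),
          sq_abs (prodDev q t)]
    _ ≤ X₄ + 1 := by
        rw [integral_div, integral_add h1 h2]
        linarith [integral_prodDev_sq_le hν p, integral_prodDev_sq_le hν q]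

variable {F : Type*} [NormedAddCommGroup F] [InnerProductSpace ℝ F]

theorem norm_sum_smul_sq (v : Fin m × Fin m → F) (c : Fin m × Fin m → ℝ) :
    ‖∑ p, c p • v p‖ ^ 2 = ∑ p, ∑ q, c p * c q * inner ℝ (v p) (v q) := by
  rw [← real_inner_self_eq_norm_sq, sum_inner]
  refine Finset.sum_congr rfl fun p _ => ?_
  rw [inner_sum]
  refine Finset.sum_congr rfl fun q _ => ?_
  rw [real_inner_smul_left, real_inner_smul_right]
  ring

/-- The centred products `t_k t_l - δ_kl` are orthogonal up to the symmetry `(k, l) ↔ (l, k)`, so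
the second moment of a linear combination is controlled by the sum of the squares. -/
theorem integral_norm_sum_prodDev_sq_le (hν : ∀ k, HasUnitMoments (ν k) X₄)
    (v : Fin m × Fin m → F) :
    Integrable (fun t => ‖∑ p, prodDev p t • v p‖ ^ 2) (Measure.pi ν) ∧
    ∫ t, ‖∑ p, prodDev p t • v p‖ ^ 2 ∂Measure.pi ν ≤ 2 * (X₄ + 1) * ∑ p, ‖v p‖ ^ 2 := by
  have hi : ∀ p q, Integrable (fun t => prodDev p t * prodDev q t * inner ℝ (v p) (v q))
      (Measure.pi ν) := fun p q => (integrable_prodDev_mul hν p q).mul_const _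
  simp_rw [norm_sum_smul_sq]
  refine ⟨integrable_finsetSum _ fun p _ => integrable_finsetSum _ fun q _ => hi p q, ?_⟩
  rw [integral_finsetSum _ fun p _ => integrable_finsetSum _ fun q _ => hi p q]
  rcases isEmpty_or_nonempty (Fin m × Fin m) with hm | ⟨⟨p₀⟩⟩
  · simp
  have hC : 0 ≤ X₄ + 1 := (abs_nonneg _).trans (abs_integral_prodDev_mul_le hν p₀ p₀)
  have hterm : ∀ p q, ∫ t, prodDev p t * prodDev q t * inner ℝ (v p) (v q) ∂Measure.pi ν ≤
      (if q = p then (X₄ + 1) * (‖v p‖ * ‖v q‖) else 0) +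
        (if q = p.swap then (X₄ + 1) * (‖v p‖ * ‖v q‖) else 0) := by
    intro p q
    rw [integral_mul_const]
    have h1 : (∫ t, prodDev p t * prodDev q t ∂Measure.pi ν) * inner ℝ (v p) (v q) ≤
        (X₄ + 1) * (‖v p‖ * ‖v q‖) := by
      refine (le_abs_self _).trans ?_
      rw [abs_mul]
      exact mul_le_mul (abs_integral_prodDev_mul_le hν p q) (abs_real_inner_le_norm _ _)
        (abs_nonneg _) hC
    have h2 : 0 ≤ (X₄ + 1) * (‖v p‖ * ‖v q‖) := by positivity
    by_cases hq1 : q = p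
    · rw [if_pos hq1]
      split_ifs <;> linarith
    · by_cases hq2 : q = p.swap
      · rw [if_pos hq2, if_neg hq1]; linarith
      · rw [integral_prodDev_mul_eq_zero hν hq1 hq2, if_neg hq1, if_neg hq2]; simp
  calc ∑ p, ∫ t, ∑ q, prodDev p t * prodDev q t * inner ℝ (v p) (v q) ∂Measure.pi ν
      = ∑ p, ∑ q, ∫ t, prodDev p t * prodDev q t * inner ℝ (v p) (v q) ∂Measure.pi ν :=
        Finset.sum_congr rfl fun p _ => integral_finsetSum _ fun q _ => hi p q
    _ ≤ ∑ p, ((X₄ + 1) * (‖v p‖ * ‖v p‖) + (X₄ + 1) * (‖v p‖ * ‖v p.swap‖)) := by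
        refine Finset.sum_le_sum fun p _ => (Finset.sum_le_sum fun q _ => hterm p q).trans ?_
        rw [Finset.sum_add_distrib, Finset.sum_ite_eq', Finset.sum_ite_eq']
        simp
    _ ≤ ∑ p, ((X₄ + 1) * ‖v p‖ ^ 2 + (X₄ + 1) * ((‖v p‖ ^ 2 + ‖v p.swap‖ ^ 2) / 2)) := by
        refine Finset.sum_le_sum fun p _ => ?_
        have : ‖v p‖ * ‖v p.swap‖ ≤ (‖v p‖ ^ 2 + ‖v p.swap‖ ^ 2) / 2 := by
          nlinarith [sq_nonneg (‖v p‖ - ‖v p.swap‖)]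
        rw [← sq]
        gcongr
    _ = 2 * (X₄ + 1) * ∑ p, ‖v p‖ ^ 2 := by
        have hsw : ∑ p : Fin m × Fin m, ‖v p.swap‖ ^ 2 = ∑ p, ‖v p‖ ^ 2 :=
          Equiv.sum_comp (Equiv.prodComm _ _) (fun p => ‖v p‖ ^ 2)
        rw [Finset.sum_add_distrib, ← Finset.mul_sum, ← Finset.mul_sum, ← Finset.sum_div,
          Finset.sum_add_distrib, hsw]
        ring

theorem quad_sub_trace {𝕜 : Type*} [RCLike 𝕜] (H : Matrix (Fin m) (Fin m) 𝕜) (t : Fin m → ℝ) :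
    quad H t - H.trace = ∑ p : Fin m × Fin m, prodDev p t • H p.1 p.2 := by
  rw [Fintype.sum_prod_type, quad, trace, ← Finset.sum_sub_distrib]
  refine Finset.sum_congr rfl fun k _ => ?_
  simp only [prodDev, sub_smul, Finset.sum_sub_distrib, ite_smul, zero_smul, one_smul,
    Finset.sum_ite_eq, Finset.mem_univ, if_true, diag_apply, RCLike.real_smul_eq_coe_mul]
  congr 1
  refine Finset.sum_congr rfl fun l _ => ?_
  push_cast
  ring

theorem continuous_quad {𝕜 : Type*} [RCLike 𝕜] (H : Matrix (Fin m) (Fin m) 𝕜) :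
    Continuous (quad H) := by
  unfold quad
  fun_prop

theorem integrable_quad {𝕜 : Type*} [RCLike 𝕜] (hν : ∀ k, HasUnitMoments (ν k) X₄)
    (H : Matrix (Fin m) (Fin m) 𝕜) : Integrable (quad H) (Measure.pi ν) := by
  have := fun k => (hν k).isProb
  have h : quad H = fun t => (∑ p : Fin m × Fin m, prodDev p t • H p.1 p.2) + H.trace := by
    ext t; rw [← quad_sub_trace, sub_add_cancel]
  rw [h]
  exact (integrable_finsetSum _ fun p _ => (integrable_prodDev hν p).smul_const _).add
    (integrable_const _)

theorem integral_quad {𝕜 : Type*} [RCLike 𝕜] (hν : ∀ k, HasUnitMoments (ν k) X₄)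
    (H : Matrix (Fin m) (Fin m) 𝕜) : ∫ t, quad H t ∂Measure.pi ν = H.trace := by
  have := fun k => (hν k).isProb
  have h : quad H = fun t => (∑ p : Fin m × Fin m, prodDev p t • H p.1 p.2) + H.trace := by
    ext t; rw [← quad_sub_trace, sub_add_cancel]
  have hi : ∀ p : Fin m × Fin m, Integrable (fun t => prodDev p t • H p.1 p.2) (Measure.pi ν) :=
    fun p => (integrable_prodDev hν p).smul_const _
  rw [h, integral_add (integrable_finsetSum _ fun p _ => hi p) (integrable_const _),
    integral_finsetSum _ fun p _ => hi p]
  simp [integral_smul_const, integral_prodDev hν]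

theorem integral_norm_quad_sub_trace_sq_le (hν : ∀ k, HasUnitMoments (ν k) X₄)
    (H : Matrix (Fin m) (Fin m) ℂ) :
    Integrable (fun t => ‖quad H t - H.trace‖ ^ 2) (Measure.pi ν) ∧
    ∫ t, ‖quad H t - H.trace‖ ^ 2 ∂Measure.pi ν ≤ 2 * (X₄ + 1) * ∑ k, ∑ l, ‖H k l‖ ^ 2 := by
  have h := integral_norm_sum_prodDev_sq_le hν (fun p => H p.1 p.2)
  rw [Fintype.sum_prod_type] at h
  simpa only [quad_sub_trace] using h

/-- The squared length of a row concentrates at its mean `m`. -/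
theorem integral_sum_sq_sub_sq_le (hν : ∀ k, HasUnitMoments (ν k) X₄) :
    Integrable (fun t : Fin m → ℝ => (∑ k, t k ^ 2 - m) ^ 2) (Measure.pi ν) ∧
    ∫ t : Fin m → ℝ, (∑ k, t k ^ 2 - m) ^ 2 ∂Measure.pi ν ≤ 2 * (X₄ + 1) * m := by
  have h := integral_norm_sum_prodDev_sq_le hν (fun p => (1 : Matrix (Fin m) (Fin m) ℝ) p.1 p.2)
  rw [Fintype.sum_prod_type] at h
  simp only [← quad_sub_trace] at h
  have h2 : ∀ t : Fin m → ℝ, quad (1 : Matrix (Fin m) (Fin m) ℝ) t = ∑ k, t k ^ 2 := by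
    intro t
    simp [quad, Matrix.one_apply, sq]
  simpa [h2, Matrix.one_apply] using h

end QuadraticForms

/-! ### Rank-one perturbations of the smooth eigenvalue count -/

section RankOnePowers
variable {m : ℕ}

theorem quad_real_eq (H : Matrix (Fin m) (Fin m) ℝ) (t : Fin m → ℝ) : quad H t = t ⬝ᵥ (H *ᵥ t) := by
  simpa using quad_eq_dotProduct H t

theorem quad_add (A B : Matrix (Fin m) (Fin m) ℝ) (t : Fin m → ℝ) :
    quad (A + B) t = quad A t + quad B t := by
  simp only [quad_real_eq, add_mulVec, dotProduct_add]

theorem quad_vecMulVec (u v t : Fin m → ℝ) :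
    quad (vecMulVec u v) t = (t ⬝ᵥ u) * (v ⬝ᵥ t) := by
  rw [quad_real_eq, vecMulVec_mulVec, op_smul_eq_smul, dotProduct_smul, smul_eq_mul, mul_comm]

theorem quad_transpose (A : Matrix (Fin m) (Fin m) ℝ) (t : Fin m → ℝ) : quad Aᵀ t = quad A t := by
  rw [quad_real_eq, quad_real_eq, mulVec_transpose, dotProduct_comm, ← dotProduct_mulVec]

theorem quad_pow_mul_pow_succ {P : Matrix (Fin m) (Fin m) ℝ} (w : Fin m → ℝ) (a b : ℕ) :
    quad (P ^ a * (P + vecMulVec w w) ^ (b + 1)) w =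
      quad (P ^ (a + 1) * (P + vecMulVec w w) ^ b) w +
        quad (P ^ a) w * quad ((P + vecMulVec w w) ^ b) w := by
  have h : P ^ a * (P + vecMulVec w w) ^ (b + 1) = P ^ (a + 1) * (P + vecMulVec w w) ^ b +
      vecMulVec (P ^ a *ᵥ w) (w ᵥ* (P + vecMulVec w w) ^ b) := by
    rw [pow_succ', ← Matrix.mul_assoc, Matrix.mul_add, Matrix.add_mul, ← pow_succ, mul_vecMulVec,
      vecMulVec_mul]
  rw [h, quad_add, quad_vecMulVec, ← dotProduct_mulVec, quad_real_eq (P ^ a),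
    quad_real_eq ((P + vecMulVec w w) ^ b)]

theorem trace_pow_mul_pow_succ {P : Matrix (Fin m) (Fin m) ℝ} (hP : Pᵀ = P) (w : Fin m → ℝ)
    (a b : ℕ) :
    (P ^ a * (P + vecMulVec w w) ^ (b + 1)).trace =
      (P ^ (a + 1) * (P + vecMulVec w w) ^ b).trace +
        quad (P ^ a * (P + vecMulVec w w) ^ b) w := by
  have h : P ^ a * (P + vecMulVec w w) ^ (b + 1) = P ^ (a + 1) * (P + vecMulVec w w) ^ b +
      vecMulVec (P ^ a *ᵥ w) (w ᵥ* (P + vecMulVec w w) ^ b) := by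
    rw [pow_succ', ← Matrix.mul_assoc, Matrix.mul_add, Matrix.add_mul, ← pow_succ, mul_vecMulVec,
      vecMulVec_mul]
  rw [h, trace_add, trace_vecMulVec, ← quad_transpose (P ^ a * _), transpose_mul, transpose_pow,
    transpose_pow, transpose_add, hP, transpose_vecMulVec, quad_real_eq, ← mulVec_mulVec,
    dotProduct_comm, ← dotProduct_mulVec]

/-- Chebyshev's sum inequality for the nonnegative weights `w` and powers of `θ`. -/
theorem sum_pow_mul_sum_pow_le {w θ : Fin m → ℝ} (hw : ∀ l, 0 ≤ w l) (hθ : ∀ l, 0 ≤ θ l) (a b : ℕ) :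
    (∑ l, w l * θ l ^ a) * (∑ l, w l * θ l ^ b) ≤ (∑ l, w l) * ∑ l, w l * θ l ^ (a + b) := by
  have h : ∀ i j, w i * θ i ^ a * (w j * θ j ^ b) + w j * θ j ^ a * (w i * θ i ^ b) ≤
      w i * (w j * θ j ^ (a + b)) + w j * (w i * θ i ^ (a + b)) := by
    intro i j
    have h1 : 0 ≤ (θ i ^ a - θ j ^ a) * (θ i ^ b - θ j ^ b) := by
      rcases le_total (θ i) (θ j) with hij | hij
      · exact mul_nonneg_of_nonpos_of_nonpos (sub_nonpos.mpr (pow_le_pow_left₀ (hθ i) hij a))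
          (sub_nonpos.mpr (pow_le_pow_left₀ (hθ i) hij b))
      · exact mul_nonneg (sub_nonneg.mpr (pow_le_pow_left₀ (hθ j) hij a))
          (sub_nonneg.mpr (pow_le_pow_left₀ (hθ j) hij b))
    have h2 := mul_nonneg (mul_nonneg (hw i) (hw j)) h1
    rw [pow_add, pow_add]
    nlinarith
  have hsum := Finset.sum_le_sum fun i (_ : i ∈ Finset.univ) =>
    Finset.sum_le_sum fun j (_ : j ∈ Finset.univ) => h i j
  simp only [Finset.sum_add_distrib] at hsum
  rw [Finset.sum_comm (f := fun i j => w j * θ j ^ a * (w i * θ i ^ b)),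
    Finset.sum_comm (f := fun i j => w j * (w i * θ i ^ (a + b))),
    ← Finset.sum_mul_sum, ← Finset.sum_mul_sum] at hsum
  linarith

/-- For a rank-one perturbation `P' = P + w wᵀ` the mixed moments `wᵀ Pᵃ P'ᵇ w` expand into products
of the moments `wᵀ Pʲ w`. All of these are absorbed by the moments of
`max θ (wᵀ w)`, `θ` the spectrum of `P`. -/
theorem quad_pow_mul_pow_le {U : Matrix (Fin m) (Fin m) ℝ} (hU : Uᵀ * U = 1) {θ : Fin m → ℝ}
    (hθ : ∀ l, 0 ≤ θ l) (w : Fin m → ℝ) (a b : ℕ) :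
    0 ≤ quad (spec U θ ^ a * (spec U θ + vecMulVec w w) ^ b) w ∧
    quad (spec U θ ^ a * (spec U θ + vecMulVec w w) ^ b) w ≤
      2 ^ b * ∑ l, (Uᵀ *ᵥ w) l ^ 2 * max (θ l) (∑ i, (Uᵀ *ᵥ w) i ^ 2) ^ (a + b) := by
  set q₀ := ∑ i, (Uᵀ *ᵥ w) i ^ 2 with hq₀
  have hq0 : 0 ≤ q₀ := Finset.sum_nonneg fun i _ => sq_nonneg _
  have hmom : ∀ a, quad (spec U θ ^ a) w = ∑ l, (Uᵀ *ᵥ w) l ^ 2 * θ l ^ a := by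
    intro a
    rw [spec_pow hU, quad_spec]
    rfl
  have hmomle : ∀ a, ∑ l, (Uᵀ *ᵥ w) l ^ 2 * θ l ^ a ≤ ∑ l, (Uᵀ *ᵥ w) l ^ 2 * max (θ l) q₀ ^ a :=
    fun a => Finset.sum_le_sum fun l _ => mul_le_mul_of_nonneg_left
      (pow_le_pow_left₀ (hθ l) (le_max_left _ _) a) (sq_nonneg _)
  have hmom0 : ∀ a, 0 ≤ ∑ l, (Uᵀ *ᵥ w) l ^ 2 * θ l ^ a := fun a =>
    Finset.sum_nonneg fun l _ => mul_nonneg (sq_nonneg _) (pow_nonneg (hθ l) a)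
  induction b generalizing a with
  | zero =>
    rw [pow_zero, Matrix.mul_one, hmom, pow_zero, one_mul]
    exact ⟨hmom0 a, hmomle a⟩
  | succ b ih =>
    rw [quad_pow_mul_pow_succ, hmom]
    obtain ⟨h1, h2⟩ := ih (a + 1)
    obtain ⟨h3, h4⟩ := ih 0
    rw [pow_zero, Matrix.one_mul] at h3 h4
    refine ⟨add_nonneg h1 (mul_nonneg (hmom0 a) h3), ?_⟩
    have hprod : (∑ l, (Uᵀ *ᵥ w) l ^ 2 * θ l ^ a) *
        (∑ l, (Uᵀ *ᵥ w) l ^ 2 * max (θ l) q₀ ^ (0 + b)) ≤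
        ∑ l, (Uᵀ *ᵥ w) l ^ 2 * max (θ l) q₀ ^ (a + (b + 1)) := by
      have hmax0 : ∀ l, 0 ≤ max (θ l) q₀ := fun l => le_max_of_le_right hq0
      have hs0 : 0 ≤ ∑ l, (Uᵀ *ᵥ w) l ^ 2 * max (θ l) q₀ ^ b :=
        Finset.sum_nonneg fun l _ => mul_nonneg (sq_nonneg _) (pow_nonneg (hmax0 l) _)
      rw [zero_add]
      refine (mul_le_mul_of_nonneg_right (hmomle a) hs0).trans
        ((sum_pow_mul_sum_pow_le (fun l => sq_nonneg _) hmax0 a b).trans ?_)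
      rw [← hq₀, Finset.mul_sum]
      refine Finset.sum_le_sum fun l _ => ?_
      rw [← add_assoc, pow_succ, mul_left_comm, mul_comm q₀]
      exact mul_le_mul_of_nonneg_left (mul_le_mul_of_nonneg_left (le_max_right _ _)
        (pow_nonneg (hmax0 l) _)) (sq_nonneg _)
    have h5 := mul_le_mul_of_nonneg_left h4 (hmom0 a)
    rw [show a + 1 + b = a + (b + 1) by ring] at h2
    have h6 : (0 : ℝ) ≤ 2 ^ b := by positivity
    have h7 := mul_le_mul_of_nonneg_left hprod h6
    rw [pow_succ (2 : ℝ)]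
    linarith

theorem abs_trace_pow_sub_le {U : Matrix (Fin m) (Fin m) ℝ} (hU : Uᵀ * U = 1) {θ : Fin m → ℝ}
    (hθ : ∀ l, 0 ≤ θ l) (w : Fin m → ℝ) (k : ℕ) :
    |((spec U θ + vecMulVec w w) ^ (k + 1)).trace - (spec U θ ^ (k + 1)).trace| ≤
      2 ^ (k + 1) * (quad (spec U θ ^ k) w + quad (1 : Matrix (Fin m) (Fin m) ℝ) w ^ (k + 1)) := by
  set q₀ := ∑ i, (Uᵀ *ᵥ w) i ^ 2 with hq₀
  have hq0 : 0 ≤ q₀ := Finset.sum_nonneg fun i _ => sq_nonneg _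
  set μ : ℕ → ℝ := fun t => ∑ l, (Uᵀ *ᵥ w) l ^ 2 * max (θ l) q₀ ^ t
  have key : ∀ b a, 0 ≤ (spec U θ ^ a * (spec U θ + vecMulVec w w) ^ b).trace -
        (spec U θ ^ (a + b)).trace ∧
      (spec U θ ^ a * (spec U θ + vecMulVec w w) ^ b).trace - (spec U θ ^ (a + b)).trace ≤
        (2 ^ b - 1) * μ (a + b - 1) := by
    intro b
    induction b with
    | zero => intro a; simp
    | succ b ih =>
      intro a
      rw [trace_pow_mul_pow_succ (spec_transpose U θ)]
      obtain ⟨h1, h2⟩ := ih (a + 1)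
      obtain ⟨h3, h4⟩ := quad_pow_mul_pow_le hU hθ w a b
      rw [show a + 1 + b = a + (b + 1) by ring] at h1 h2
      rw [show a + (b + 1) - 1 = a + b by omega] at h2 ⊢
      refine ⟨by linarith, ?_⟩
      have : μ (a + b) = ∑ l, (Uᵀ *ᵥ w) l ^ 2 * max (θ l) q₀ ^ (a + b) := rfl
      rw [← this] at h4
      rw [pow_succ (2 : ℝ)]
      linarith
  obtain ⟨h1, h2⟩ := key (k + 1) 0
  simp only [pow_zero, Matrix.one_mul, zero_add, Nat.add_sub_cancel] at h1 h2
  rw [abs_of_nonneg h1]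
  have hq : quad (1 : Matrix (Fin m) (Fin m) ℝ) w = q₀ := by
    rw [← spec_one (𝕜 := ℝ) hU, quad_spec]
    simp [q₀]
  have hμ : μ k ≤ quad (spec U θ ^ k) w + quad (1 : Matrix (Fin m) (Fin m) ℝ) w ^ (k + 1) := by
    rw [hq, spec_pow hU, quad_spec, pow_succ', hq₀, Finset.sum_mul, ← hq₀, ← Finset.sum_add_distrib]
    refine Finset.sum_le_sum fun l _ => ?_
    rw [RCLike.ofReal_real_eq_id, id, ← mul_add]
    refine mul_le_mul_of_nonneg_left ?_ (sq_nonneg _)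
    rcases max_cases (θ l) q₀ with ⟨h, -⟩ | ⟨h, -⟩ <;> rw [h]
    · linarith [pow_nonneg hq0 k]
    · linarith [pow_nonneg (hθ l) k]
  have hμ0 : 0 ≤ μ k := Finset.sum_nonneg fun l _ =>
    mul_nonneg (sq_nonneg _) (pow_nonneg (le_max_of_le_right hq0) _)
  calc _ ≤ (2 ^ (k + 1) - 1) * μ k := h2
    _ ≤ 2 ^ (k + 1) * μ k := by nlinarith
    _ ≤ _ := by gcongr

theorem quad_mulVec (P H : Matrix (Fin m) (Fin m) ℝ) (t : Fin m → ℝ) :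
    quad P (H *ᵥ t) = quad (Hᵀ * P * H) t := by
  rw [quad_real_eq, quad_real_eq, ← mulVec_mulVec, ← mulVec_mulVec, dotProduct_mulVec t Hᵀ,
    vecMul_transpose]

/-- A rank-one perturbation `y yᵀ` of `M` perturbs `M (M + r)⁻¹` by `w wᵀ`, with `w` a multiple of
`(M + r)⁻¹ y` of length at most one. -/
theorem exists_psi_add_vecMulVec {U : Matrix (Fin m) (Fin m) ℝ} (hU : Uᵀ * U = 1) {lam : Fin m → ℝ}
    (hlam : ∀ l, 0 ≤ lam l) {r : ℝ} (hr : 0 < r) (y : Fin m → ℝ) :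
    ∃ w : Fin m → ℝ,
      1 - r • (spec U lam + vecMulVec y y + r • (1 : Matrix (Fin m) (Fin m) ℝ))⁻¹ =
        spec U (fun l => lam l / (lam l + r)) + vecMulVec w w ∧
      (∀ j : ℕ, quad (spec U (fun l => lam l / (lam l + r)) ^ j) w ≤
        r⁻¹ * quad (spec U (fun l => lam l / (lam l + r)) ^ j) y) ∧
      quad (1 : Matrix (Fin m) (Fin m) ℝ) w ≤ 1 := by
  have hlr : ∀ l, 0 < lam l + r := fun l => by linarith [hlam l]
  set H := spec U (fun l => (lam l + r)⁻¹) with hH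
  have hinv : (spec U lam + r • (1 : Matrix (Fin m) (Fin m) ℝ)) * H = 1 := by
    rw [hH, ← spec_one (𝕜 := ℝ) hU, spec_smul, spec_add, spec_mul hU]
    congr 1
    ext l
    rw [mul_one, mul_inv_cancel₀ (hlr l).ne']
  set D := 1 + quad H y with hD
  have hq : quad H y = ∑ l, (Uᵀ *ᵥ y) l ^ 2 * (lam l + r)⁻¹ := quad_spec U _ y
  have hq0 : 0 ≤ quad H y := by
    rw [hq]
    exact Finset.sum_nonneg fun l _ => mul_nonneg (sq_nonneg _) (inv_nonneg.mpr (hlr l).le)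
  have hD1 : 1 ≤ D := by linarith
  have hsm := sherman_morrison hinv y (by rw [← quad_real_eq]; positivity)
  rw [← quad_real_eq, ← hD] at hsm
  have hyH : y ᵥ* H = H *ᵥ y := by
    rw [← mulVec_transpose, hH, spec_transpose]
  have hquad : ∀ (d : Fin m → ℝ), quad (spec U d) (√(r / D) • (H *ᵥ y)) =
      ∑ l, (Uᵀ *ᵥ y) l ^ 2 * (r / D * ((lam l + r)⁻¹ ^ 2 * d l)) := by
    intro d
    rw [quad_smul_right, quad_mulVec, hH, spec_transpose, spec_mul hU, spec_mul hU, quad_spec,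
      RCLike.ofReal_real_eq_id, id, Real.sq_sqrt (by positivity), Finset.mul_sum]
    refine Finset.sum_congr rfl fun l _ => ?_
    rw [id]
    ring
  refine ⟨√(r / D) • (H *ᵥ y), ?_, fun j => ?_, ?_⟩
  · have : (spec U lam + vecMulVec y y + r • (1 : Matrix (Fin m) (Fin m) ℝ))⁻¹ =
        H - D⁻¹ • vecMulVec (H *ᵥ y) (y ᵥ* H) := by
      refine Matrix.inv_eq_right_inv ?_
      refine Eq.trans ?_ hsm
      congr 1
      abel
    rw [this, ← psi_spec hU hlam hr, inv_add_spec hU hlam hr, ← hH, hyH, smul_sub,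
      smul_vecMulVec, vecMulVec_smul, smul_smul, smul_smul, Real.mul_self_sqrt (by positivity),
      div_eq_mul_inv, sub_add]
  · rw [spec_pow hU, hquad, quad_spec, Finset.mul_sum]
    refine Finset.sum_le_sum fun l _ => ?_
    rw [RCLike.ofReal_real_eq_id, id]
    have h1 : r / D * (lam l + r)⁻¹ ^ 2 ≤ r⁻¹ := by
      calc r / D * (lam l + r)⁻¹ ^ 2 ≤ r / 1 * r⁻¹ ^ 2 := by
            have h3 : (lam l + r)⁻¹ ≤ r⁻¹ := inv_anti₀ hr (by linarith [hlam l])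
            have h4 : 0 ≤ (lam l + r)⁻¹ := inv_nonneg.mpr (hlr l).le
            gcongr
        _ = r⁻¹ := by field_simp
    have h2 : 0 ≤ (Uᵀ *ᵥ y) l ^ 2 * (lam l / (lam l + r)) ^ j :=
      mul_nonneg (sq_nonneg _) (pow_nonneg (div_nonneg (hlam l) (hlr l).le) _)
    nlinarith [mul_le_mul_of_nonneg_right h1 h2]
  · rw [← spec_one (𝕜 := ℝ) hU, hquad]
    calc ∑ l, (Uᵀ *ᵥ y) l ^ 2 * (r / D * ((lam l + r)⁻¹ ^ 2 * 1))
        ≤ ∑ l, D⁻¹ * ((Uᵀ *ᵥ y) l ^ 2 * (lam l + r)⁻¹) := by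
          refine Finset.sum_le_sum fun l _ => ?_
          have h1 : r * (lam l + r)⁻¹ ≤ 1 := by
            rw [← div_eq_mul_inv, div_le_one (hlr l)]; linarith [hlam l]
          have h2 : 0 ≤ D⁻¹ * ((Uᵀ *ᵥ y) l ^ 2 * (lam l + r)⁻¹) :=
            mul_nonneg (by positivity) (mul_nonneg (sq_nonneg _) (inv_nonneg.mpr (hlr l).le))
          calc (Uᵀ *ᵥ y) l ^ 2 * (r / D * ((lam l + r)⁻¹ ^ 2 * 1))
              = (r * (lam l + r)⁻¹) * (D⁻¹ * ((Uᵀ *ᵥ y) l ^ 2 * (lam l + r)⁻¹)) := by ring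
            _ ≤ 1 * (D⁻¹ * ((Uᵀ *ᵥ y) l ^ 2 * (lam l + r)⁻¹)) := by gcongr
            _ = _ := one_mul _
      _ = D⁻¹ * quad H y := by rw [← Finset.mul_sum, hq]
      _ ≤ 1 := by rw [inv_mul_le_iff₀ (by positivity)]; linarith

theorem quad_one (y : Fin m → ℝ) : quad (1 : Matrix (Fin m) (Fin m) ℝ) y = ∑ k, y k ^ 2 := by
  simp [quad, Matrix.one_apply, sq]

theorem smoothCount_nonneg {M : Matrix (Fin m) (Fin m) ℝ} (hM : M.PosSemidef) {r : ℝ} (hr : 0 < r)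
    (k : ℕ) : 0 ≤ smoothCount r k M := by
  obtain ⟨U, lam, hU, hlam, rfl⟩ := exists_spec hM
  rw [smoothCount_spec hU hlam hr]
  exact Finset.sum_nonneg fun l _ => pow_nonneg (div_nonneg (hlam l) (by linarith [hlam l])) _

theorem smoothCount_le {M : Matrix (Fin m) (Fin m) ℝ} (hM : M.PosSemidef) {r : ℝ} (hr : 0 < r)
    (k : ℕ) : smoothCount r k M ≤ m := by
  obtain ⟨U, lam, hU, hlam, rfl⟩ := exists_spec hM
  rw [smoothCount_spec hU hlam hr]
  refine (Finset.sum_le_card_nsmul _ _ 1 fun l _ => ?_).trans (by simp)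
  have := hlam l
  exact pow_le_one₀ (by positivity) ((div_le_one (by positivity)).mpr (by linarith))

theorem abs_smoothCount_sub_le {M : Matrix (Fin m) (Fin m) ℝ} (hM : M.PosSemidef) {r : ℝ} (hr : 0 < r)
    (k : ℕ) (y : Fin m → ℝ) :
    |smoothCount r (k + 1) (M + vecMulVec y y) - smoothCount r (k + 1) M| ≤
      2 ^ (k + 1) * (r⁻¹ * quad ((1 - r • (M + r • (1 : Matrix (Fin m) (Fin m) ℝ))⁻¹) ^ k) y +
        min 1 (r⁻¹ * ∑ k, y k ^ 2) ^ (k + 1)) := by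
  obtain ⟨U, lam, hU, hlam, rfl⟩ := exists_spec hM
  obtain ⟨w, hw, hj, h1⟩ := exists_psi_add_vecMulVec hU hlam hr y
  have h0 := hj 0
  rw [pow_zero, quad_one y] at h0
  rw [smoothCount, smoothCount, hw, psi_spec hU hlam hr]
  have hθ : ∀ l, 0 ≤ lam l / (lam l + r) := fun l => div_nonneg (hlam l) (by linarith [hlam l])
  have hw0 : 0 ≤ quad (1 : Matrix (Fin m) (Fin m) ℝ) w := by
    rw [quad_one]; positivity
  refine (abs_trace_pow_sub_le hU hθ w k).trans ?_
  gcongr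
  · exact hj k
  · exact le_min h1 h0

/-- The squared form of `abs_smoothCount_sub_le`; by Cauchy–Schwarz the quadratic form stays
linear in the outer product of `y`. -/
theorem smoothCount_sub_sq_le {M : Matrix (Fin m) (Fin m) ℝ} (hM : M.PosSemidef) {r : ℝ} (hr : 0 < r)
    (k : ℕ) (y : Fin m → ℝ) :
    (smoothCount r (k + 1) (M + vecMulVec y y) - smoothCount r (k + 1) M) ^ 2 ≤
      2 * 4 ^ (k + 1) *
        (r⁻¹ * quad ((1 - r • (M + r • (1 : Matrix (Fin m) (Fin m) ℝ))⁻¹) ^ (2 * k)) y +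
        min 1 (r⁻¹ * ∑ k, y k ^ 2) ^ (2 * k + 2)) := by
  obtain ⟨U, lam, hU, hlam, rfl⟩ := exists_spec hM
  obtain ⟨w, hw, hj, h1⟩ := exists_psi_add_vecMulVec hU hlam hr y
  have h0 := hj 0
  rw [pow_zero, quad_one y] at h0
  rw [smoothCount, smoothCount, hw, psi_spec hU hlam hr]
  have hθ : ∀ l, 0 ≤ lam l / (lam l + r) := fun l => div_nonneg (hlam l) (by linarith [hlam l])
  have hw0 : 0 ≤ quad (1 : Matrix (Fin m) (Fin m) ℝ) w := by
    rw [quad_one]; positivity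
  have hcs : quad (spec U (fun l => lam l / (lam l + r)) ^ k) w ^ 2 ≤
      quad (spec U (fun l => lam l / (lam l + r)) ^ (2 * k)) w := by
    have h2 : 0 ≤ quad (spec U (fun l => lam l / (lam l + r)) ^ (2 * k)) w := by
      rw [spec_pow hU, quad_spec]
      exact Finset.sum_nonneg fun l _ => mul_nonneg (sq_nonneg _) (pow_nonneg (hθ l) _)
    refine le_trans ?_ (mul_le_of_le_one_left h2 h1)
    rw [← spec_one (𝕜 := ℝ) hU, spec_pow hU, spec_pow hU, quad_spec, quad_spec, quad_spec]
    refine Finset.sum_sq_le_sum_mul_sum_of_sq_le_mul _ (fun l _ => ?_) (fun l _ => ?_) fun l _ => ?_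
    · exact mul_nonneg (sq_nonneg _) zero_le_one
    · exact mul_nonneg (sq_nonneg _) (pow_nonneg (hθ l) _)
    · exact le_of_eq (by ring)
  rw [← sq_abs]
  set Q := quad (spec U (fun l => lam l / (lam l + r)) ^ k) w
  set q := quad (1 : Matrix (Fin m) (Fin m) ℝ) w
  calc _ ≤ (2 ^ (k + 1) * (Q + q ^ (k + 1))) ^ 2 :=
        pow_le_pow_left₀ (abs_nonneg _) (abs_trace_pow_sub_le hU hθ w k) 2
    _ = 4 ^ (k + 1) * (Q + q ^ (k + 1)) ^ 2 := by
        rw [mul_pow, ← pow_mul, mul_comm (k + 1) 2, pow_mul]; norm_num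
    _ ≤ 4 ^ (k + 1) * (2 * (Q ^ 2 + q ^ (2 * k + 2))) := by
        gcongr
        rw [show q ^ (2 * k + 2) = (q ^ (k + 1)) ^ 2 by ring]
        nlinarith [sq_nonneg (Q - q ^ (k + 1))]
    _ = 2 * 4 ^ (k + 1) * (Q ^ 2 + q ^ (2 * k + 2)) := by ring
    _ ≤ _ := by
        gcongr
        · exact hcs.trans (hj _)
        · exact le_min h1 h0

end RankOnePowers

/-! ### Mean and variance of the smooth eigenvalue count -/

section Measurability
variable {α 𝕜 : Type*} [MeasurableSpace α] [RCLike 𝕜] [MeasurableSpace 𝕜] [BorelSpace 𝕜] {m n : ℕ}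

/-- Stated for compositions because matrices carry no measurable structure of their own. -/
theorem measurable_comp_matrix {A : α → Matrix (Fin m) (Fin m) 𝕜}
    (hA : ∀ i j, Measurable fun x => A x i j) {g : Matrix (Fin m) (Fin m) 𝕜 → 𝕜}
    (hg : Continuous g) : Measurable fun x => g (A x) := by
  have h1 : @Measurable α (Fin m → Fin m → 𝕜) _ _ fun x => A x :=
    measurable_pi_lambda _ fun i => measurable_pi_lambda _ fun j => hA i j
  have h2 : @Measurable (Fin m → Fin m → 𝕜) 𝕜 _ _ g :=
    Continuous.measurable (show @Continuous (Fin m → Fin m → 𝕜) 𝕜 _ _ g from hg)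
  exact h2.comp h1

theorem measurable_inv_apply {A : α → Matrix (Fin m) (Fin m) 𝕜}
    (hA : ∀ i j, Measurable fun x => A x i j) (i j : Fin m) :
    Measurable fun x => (A x)⁻¹ i j := by
  simp only [Matrix.inv_def, Ring.inverse_eq_inv', Matrix.smul_apply, smul_eq_mul]
  refine Measurable.mul (Measurable.inv ?_) ?_
  · exact measurable_comp_matrix hA (g := fun B => B.det) (continuous_id.matrix_det)
  · exact measurable_comp_matrix hA (g := fun B => B.adjugate i j)
      ((continuous_id.matrix_adjugate).matrix_elem i j)

theorem measurable_gram (s : Finset (Fin n)) (k l : Fin m) :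
    Measurable fun x : Fin n → Fin m → ℝ => gram s x k l := by
  simp only [gram, Matrix.sum_apply, vecMulVec_apply, Pi.smul_apply, smul_eq_mul]
  fun_prop

theorem measurable_green {A : α → Matrix (Fin m) (Fin m) ℝ}
    (hA : ∀ i j, Measurable fun x => A x i j) (z : ℂ) (i j : Fin m) :
    Measurable fun x => greenMatrix (A x) z i j := by
  unfold greenMatrix
  refine measurable_inv_apply (fun i j => ?_) i j
  simp only [Matrix.sub_apply, Matrix.map_apply]
  exact (Complex.measurable_ofReal.comp (hA i j)).sub_const _

theorem measurable_psi {A : α → Matrix (Fin m) (Fin m) ℝ}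
    (hA : ∀ i j, Measurable fun x => A x i j) (r : ℝ) (i j : Fin m) :
    Measurable fun x => (1 - r • (A x + r • (1 : Matrix (Fin m) (Fin m) ℝ))⁻¹) i j := by
  simp only [Matrix.sub_apply, Matrix.smul_apply]
  refine Measurable.const_sub (Measurable.const_smul (measurable_inv_apply (fun i j => ?_) i j) r) _
  simp only [Matrix.add_apply]
  exact (hA i j).add_const _

theorem measurable_smoothCount (r : ℝ) (k : ℕ) (s : Finset (Fin n)) :
    Measurable fun x : Fin n → Fin m → ℝ => smoothCount r k (gram s x) :=
  measurable_comp_matrix (measurable_psi (measurable_gram s) r) (g := fun B => (B ^ k).trace)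
    ((continuous_id.pow k).matrix_trace)

end Measurability

section SmoothCount
variable {n m : ℕ} {ν : Fin n → Fin m → Measure ℝ} {X₄ κ : ℝ}

/-- The law of a matrix with independent entries, of law `ν i k` at `(i, k)`, as a product over the
rows. -/
noncomputable abbrev ensemble (ν : Fin n → Fin m → Measure ℝ) : Measure (Fin n → Fin m → ℝ) :=
  Measure.pi fun i => Measure.pi (ν i)

theorem isProb_row (hν : ∀ i k, HasUnitMoments (ν i k) X₄) (i : Fin n) :
    IsProbabilityMeasure (Measure.pi (ν i)) := by
  have := fun k => (hν i k).isProb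
  infer_instance

theorem integral_quad_row (hν : ∀ i k, HasUnitMoments (ν i k) X₄) (i : Fin n)
    (P : Matrix (Fin m) (Fin m) ℝ) :
    Integrable (fun t => quad P ((√(n : ℝ))⁻¹ • t)) (Measure.pi (ν i)) ∧
    ∫ t, quad P ((√(n : ℝ))⁻¹ • t) ∂Measure.pi (ν i) = (n : ℝ)⁻¹ * P.trace := by
  simp only [quad_smul_right, RCLike.ofReal_real_eq_id, id, inv_pow,
    Real.sq_sqrt (Nat.cast_nonneg n)]
  refine ⟨(integrable_quad (hν i) P).const_mul _, ?_⟩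
  rw [integral_const_mul, integral_quad (hν i)]

theorem min_one_pow_le {r s a : ℝ} (hr : 0 < r) (hs : 0 ≤ s) (ha : 0 ≤ a) (haκ : a ≤ κ) {k : ℕ}
    (hk : 2 ≤ k) : min 1 (r⁻¹ * s) ^ k ≤ (2 * κ / r) ^ k + 4 * (s - a) ^ 2 / r ^ 2 := by
  have h0 : 0 ≤ min 1 (r⁻¹ * s) := le_min zero_le_one (by positivity)
  have hκ : 0 ≤ κ := ha.trans haκ
  by_cases h : s ≤ 2 * κ
  · have h1 : min 1 (r⁻¹ * s) ≤ 2 * κ / r := by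
      refine (min_le_right _ _).trans ?_
      rw [inv_mul_eq_div]
      gcongr
    have := pow_le_pow_left₀ h0 h1 k
    have h2 : 0 ≤ 4 * (s - a) ^ 2 / r ^ 2 := by positivity
    linarith
  · push Not at h
    have h1 : min 1 (r⁻¹ * s) ^ k ≤ min 1 (r⁻¹ * s) ^ 2 :=
      pow_le_pow_of_le_one h0 (min_le_left _ _) hk
    have h2 : min 1 (r⁻¹ * s) ^ 2 ≤ (r⁻¹ * s) ^ 2 := pow_le_pow_left₀ h0 (min_le_right _ _) 2
    have h3 : (r⁻¹ * s) ^ 2 ≤ 4 * (s - a) ^ 2 / r ^ 2 := by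
      rw [inv_mul_eq_div, div_pow]
      gcongr
      nlinarith
    have h4 : 0 ≤ (2 * κ / r) ^ k := by positivity
    linarith

/-- The squared length of a normalised row has mean at most `κ` and variance `O(n⁻¹)`, so it exceeds
`2 κ` with probability `O(n⁻¹)` only. -/
theorem integral_min_row_le (hν : ∀ i k, HasUnitMoments (ν i k) X₄) (hX : 0 ≤ X₄) (hn : 1 ≤ n)
    (hmn : (m : ℝ) ≤ κ * n) {r : ℝ} (hr : 0 < r) {k : ℕ} (hk : 2 ≤ k) (i : Fin n) :
    Integrable (fun t : Fin m → ℝ => min 1 (r⁻¹ * ∑ l, ((√(n : ℝ))⁻¹ • t) l ^ 2) ^ k)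
      (Measure.pi (ν i)) ∧
    ∫ t : Fin m → ℝ, min 1 (r⁻¹ * ∑ l, ((√(n : ℝ))⁻¹ • t) l ^ 2) ^ k ∂Measure.pi (ν i) ≤
      (2 * κ) ^ k / r ^ k + 8 * (X₄ + 1) * κ / (n * r ^ 2) := by
  have hn0 : (0 : ℝ) < n := by exact_mod_cast hn
  have hprob := isProb_row hν i
  have hs : ∀ t : Fin m → ℝ, ∑ l, ((√(n : ℝ))⁻¹ • t) l ^ 2 = (n : ℝ)⁻¹ * ∑ l, t l ^ 2 := by
    intro t
    simp only [Pi.smul_apply, smul_eq_mul, mul_pow, inv_pow, Real.sq_sqrt hn0.le, Finset.mul_sum]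
  have hint : Integrable (fun t : Fin m → ℝ => min 1 (r⁻¹ * ∑ l, ((√(n : ℝ))⁻¹ • t) l ^ 2) ^ k)
      (Measure.pi (ν i)) := by
    refine integrable_of_bound (B := 1) (Measurable.stronglyMeasurable (by fun_prop)) fun t => ?_
    have h0 : 0 ≤ min 1 (r⁻¹ * ∑ l, ((√(n : ℝ))⁻¹ • t) l ^ 2) := le_min zero_le_one (by positivity)
    rw [Real.norm_of_nonneg (pow_nonneg h0 _)]
    exact pow_le_one₀ h0 (min_le_left _ _)
  obtain ⟨h1, h2⟩ := integral_sum_sq_sub_sq_le (hν i)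
  refine ⟨hint, ?_⟩
  calc ∫ t : Fin m → ℝ, min 1 (r⁻¹ * ∑ l, ((√(n : ℝ))⁻¹ • t) l ^ 2) ^ k ∂Measure.pi (ν i)
      ≤ ∫ t : Fin m → ℝ, ((2 * κ / r) ^ k + 4 / (n ^ 2 * r ^ 2) * (∑ l, t l ^ 2 - m) ^ 2)
          ∂Measure.pi (ν i) := by
        refine integral_mono hint ((integrable_const _).add (h1.const_mul _)) fun t => ?_
        rw [hs]
        refine (min_one_pow_le hr (s := (n : ℝ)⁻¹ * ∑ l, t l ^ 2) (a := m / n) (κ := κ)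
          (by positivity) (by positivity) ?_ hk).trans (le_of_eq ?_)
        · rwa [div_le_iff₀ hn0]
        · field_simp
    _ = (2 * κ / r) ^ k + 4 / (n ^ 2 * r ^ 2) * ∫ t : Fin m → ℝ, (∑ l, t l ^ 2 - m) ^ 2
          ∂Measure.pi (ν i) := by
        rw [integral_add (integrable_const _) (h1.const_mul _), integral_const_mul]
        simp
    _ ≤ (2 * κ / r) ^ k + 4 / (n ^ 2 * r ^ 2) * (2 * (X₄ + 1) * (κ * n)) := by
        gcongr
        exact h2.trans (by gcongr)
    _ = _ := by
        rw [div_pow]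
        field_simp
        ring

theorem integrable_smoothCount (hν : ∀ i k, HasUnitMoments (ν i k) X₄) {r : ℝ} (hr : 0 < r) (k : ℕ)
    (s : Finset (Fin n)) :
    Integrable (fun x => smoothCount r k (gram s x)) (ensemble ν) := by
  have := isProb_row hν
  refine integrable_of_bound (measurable_smoothCount r k s).stronglyMeasurable (B := m) fun x => ?_
  rw [Real.norm_of_nonneg (smoothCount_nonneg (gram_posSemidef s x) hr k)]
  exact smoothCount_le (gram_posSemidef s x) hr k

theorem smoothCount_gram_empty {r : ℝ} (hr : 0 < r) (k : ℕ) (x : Fin n → Fin m → ℝ) :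
    smoothCount r (k + 1) (gram ∅ x) = 0 := by
  have h : (r • (1 : Matrix (Fin m) (Fin m) ℝ))⁻¹ = r⁻¹ • 1 := by
    refine Matrix.inv_eq_right_inv ?_
    rw [Matrix.smul_mul, Matrix.one_mul, smul_smul, mul_inv_cancel₀ hr.ne', one_smul]
  simp [smoothCount, gram, h, smul_smul, hr.ne']

/-- Adding one row: the expected increase of the count of one order is governed by the count of the
order before. -/
theorem integral_smoothCount_insert_le (hν : ∀ i k, HasUnitMoments (ν i k) X₄) (hX : 0 ≤ X₄)
    (hn : 1 ≤ n) (hmn : (m : ℝ) ≤ κ * n) {r : ℝ} (hr : 0 < r) {k : ℕ} (hk : 1 ≤ k)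
    {s : Finset (Fin n)} {i : Fin n} (hi : i ∉ s) :
    ∫ x, smoothCount r (k + 1) (gram (insert i s) x) ∂ensemble ν ≤
      ∫ x, smoothCount r (k + 1) (gram s x) ∂ensemble ν +
        2 ^ (k + 1) * (r⁻¹ * ((n : ℝ)⁻¹ * ∫ x, smoothCount r k (gram s x) ∂ensemble ν) +
          ((2 * κ) ^ (k + 1) / r ^ (k + 1) + 8 * (X₄ + 1) * κ / (n * r ^ 2))) := by
  have := isProb_row hν
  have hI := fun k s => integrable_smoothCount hν hr k s
  set c := (2 * κ) ^ (k + 1) / r ^ (k + 1) + 8 * (X₄ + 1) * κ / (n * r ^ 2)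
  have h := integral_le_of_integral_update_le (fun i => Measure.pi (ν i)) (hI (k + 1) (insert i s))
    (g := fun x => smoothCount r (k + 1) (gram s x) +
      2 ^ (k + 1) * (r⁻¹ * ((n : ℝ)⁻¹ * smoothCount r k (gram s x)) + c))
    ((hI _ s).add (((((hI k s).const_mul _).const_mul _).add (integrable_const c)).const_mul _)) i
    (fun x => by
      obtain ⟨h1, h2⟩ := integral_quad_row hν i
        ((1 - r • (gram s x + r • (1 : Matrix (Fin m) (Fin m) ℝ))⁻¹) ^ k)
      obtain ⟨h3, h4⟩ := integral_min_row_le hν hX hn hmn hr (k := k + 1) (by omega) i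
      have h5 : ∀ t, smoothCount r (k + 1) (gram (insert i s) (Function.update x i t)) ≤
          smoothCount r (k + 1) (gram s x) + 2 ^ (k + 1) * (r⁻¹ *
            quad ((1 - r • (gram s x + r • (1 : Matrix (Fin m) (Fin m) ℝ))⁻¹) ^ k)
              ((√(n : ℝ))⁻¹ • t) + min 1 (r⁻¹ * ∑ l, ((√(n : ℝ))⁻¹ • t) l ^ 2) ^ (k + 1)) := by
        intro t
        rw [gram_insert hi, gram_update hi, Function.update_self]
        have := le_of_abs_le (abs_smoothCount_sub_le (gram_posSemidef s x) hr k ((√(n : ℝ))⁻¹ • t))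
        linarith
      refine (integral_mono_of_nonneg (Filter.Eventually.of_forall fun t =>
        smoothCount_nonneg (gram_posSemidef _ _) hr _)
        ((integrable_const _).add (((h1.const_mul _).add h3).const_mul _))
        (Filter.Eventually.of_forall h5)).trans ?_
      simp only [Pi.add_apply]
      rw [integral_add (integrable_const _) (by exact ((h1.const_mul _).add h3).const_mul _),
        integral_const_mul, integral_add (h1.const_mul _) h3, integral_const_mul, h2]
      simp only [integral_const, probReal_univ, one_smul]
      gcongr
      rfl)
  refine h.trans (le_of_eq ?_)
  rw [integral_add (hI _ s) (by
    exact ((((hI k s).const_mul _).const_mul _).add (integrable_const c)).const_mul _),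
    integral_const_mul, integral_add (by exact ((hI k s).const_mul _).const_mul _)
    (integrable_const c), integral_const_mul, integral_const_mul]
  simp

/-- The expected number of eigenvalues of order at least `r` is `O(n r^(-k) + r^(-2))` for every `k`:
the first term bounds the bulk and the second comes from exceptionally long rows. Each step of the
induction adds the rows one at a time and gains a factor `r⁻¹`. -/
theorem exists_integral_smoothCount_le (hκ : 0 ≤ κ) (hX : 0 ≤ X₄) (k : ℕ) :
    ∃ C : ℝ, 0 ≤ C ∧ ∀ (n m : ℕ) (ν : Fin n → Fin m → Measure ℝ) (r : ℝ) (s : Finset (Fin n)),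
      1 ≤ n → (m : ℝ) ≤ κ * n → (∀ i k, HasUnitMoments (ν i k) X₄) → 1 ≤ r →
      ∫ x, smoothCount r (k + 1) (gram s x) ∂ensemble ν ≤ C * (n / r ^ k + 1 / r ^ 2) := by
  induction k with
  | zero =>
    refine ⟨κ, hκ, fun n m ν r s hn hmn hν hr => ?_⟩
    have := isProb_row hν
    have hr0 : 0 < r := by linarith
    calc ∫ x, smoothCount r (0 + 1) (gram s x) ∂ensemble ν ≤ ∫ x, (m : ℝ) ∂ensemble ν :=
          integral_mono (integrable_smoothCount hν hr0 _ s) (integrable_const _) fun x =>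
            smoothCount_le (gram_posSemidef s x) hr0 _
      _ = m := by simp
      _ ≤ κ * n := hmn
      _ ≤ κ * (n / r ^ 0 + 1 / r ^ 2) := by
          gcongr
          rw [pow_zero, div_one]
          exact le_add_of_nonneg_right (by positivity)
  | succ k ih =>
    obtain ⟨C, hC, h⟩ := ih
    refine ⟨2 ^ (k + 2) * (C + (2 * κ) ^ (k + 2) + 8 * (X₄ + 1) * κ), by positivity,
      fun n m ν r s hn hmn hν hr => ?_⟩
    have := isProb_row hν
    have hr0 : 0 < r := by linarith
    have hn0 : (0 : ℝ) < n := by exact_mod_cast hn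
    set B := 2 ^ (k + 2) * (r⁻¹ * ((n : ℝ)⁻¹ * (C * (n / r ^ k + 1 / r ^ 2))) +
          ((2 * κ) ^ (k + 2) / r ^ (k + 2) + 8 * (X₄ + 1) * κ / (n * r ^ 2))) with hB
    have hB0 : 0 ≤ B := by positivity
    have hs : ∀ s : Finset (Fin n),
        ∫ x, smoothCount r (k + 1 + 1) (gram s x) ∂ensemble ν ≤ s.card * B := by
      intro s
      induction s using Finset.induction_on with
      | empty => simp [smoothCount_gram_empty hr0]
      | insert i s hi ihs =>
        refine (integral_smoothCount_insert_le hν hX hn hmn hr0 (by omega) hi).trans ?_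
        rw [Finset.card_insert_of_notMem hi, Nat.cast_succ, add_mul, one_mul]
        refine add_le_add ihs ?_
        rw [hB]
        gcongr
        exact h n m ν r s hn hmn hν hr
    have hcard : (s.card : ℝ) ≤ n := by
      exact_mod_cast (Finset.card_le_univ s).trans (by simp)
    refine (hs s).trans ((mul_le_mul_of_nonneg_right hcard hB0).trans ?_)
    have e1 : (n : ℝ) * B = 2 ^ (k + 2) * (C * (n / r ^ (k + 1) + 1 / r ^ 2 * r⁻¹) +
        (2 * κ) ^ (k + 2) * (n / r ^ (k + 1) * r⁻¹) + 8 * (X₄ + 1) * κ * (1 / r ^ 2)) := by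
      rw [hB]
      field_simp
      ring
    rw [e1]
    have hri : r⁻¹ ≤ 1 := inv_le_one_of_one_le₀ hr
    have h1 : 1 / r ^ 2 * r⁻¹ ≤ 1 / r ^ 2 := mul_le_of_le_one_right (by positivity) hri
    have h2 : (n : ℝ) / r ^ (k + 1) * r⁻¹ ≤ n / r ^ (k + 1) + 1 / r ^ 2 :=
      (mul_le_of_le_one_right (by positivity) hri).trans (le_add_of_nonneg_right (by positivity))
    have h3 : 1 / r ^ 2 ≤ n / r ^ (k + 1) + 1 / r ^ 2 := le_add_of_nonneg_left (by positivity)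
    calc 2 ^ (k + 2) * (C * (n / r ^ (k + 1) + 1 / r ^ 2 * r⁻¹) +
        (2 * κ) ^ (k + 2) * (n / r ^ (k + 1) * r⁻¹) + 8 * (X₄ + 1) * κ * (1 / r ^ 2))
        ≤ 2 ^ (k + 2) * (C * (n / r ^ (k + 1) + 1 / r ^ 2) +
        (2 * κ) ^ (k + 2) * (n / r ^ (k + 1) + 1 / r ^ 2) +
        8 * (X₄ + 1) * κ * (n / r ^ (k + 1) + 1 / r ^ 2)) := by gcongr
      _ = _ := by ring

/-- The variance of the smooth count, by the Efron–Stein inequality. -/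
theorem exists_variance_smoothCount_le (hκ : 0 ≤ κ) (hX : 0 ≤ X₄) {k : ℕ} (hk : 1 ≤ k) :
    ∃ C : ℝ, 0 ≤ C ∧ ∀ (n m : ℕ) (ν : Fin n → Fin m → Measure ℝ) (r : ℝ) (s : Finset (Fin n)),
      1 ≤ n → (m : ℝ) ≤ κ * n → (∀ i k, HasUnitMoments (ν i k) X₄) → 1 ≤ r →
      ∫ x, (smoothCount r (k + 1) (gram s x) -
        ∫ y, smoothCount r (k + 1) (gram s y) ∂ensemble ν) ^ 2 ∂ensemble ν ≤
        C * (n / r ^ (2 * k) + 1 / r ^ 2) := by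
  obtain ⟨C, hC, h⟩ := exists_integral_smoothCount_le hκ hX (2 * k - 1)
  rw [show 2 * k - 1 + 1 = 2 * k by omega] at h
  refine ⟨2 * 4 ^ (k + 1) * (C + (2 * κ) ^ (2 * k + 2) + 8 * (X₄ + 1) * κ), by positivity,
    fun n m ν r s hn hmn hν hr => ?_⟩
  have := isProb_row hν
  have hr0 : 0 < r := by linarith
  have hn0 : (0 : ℝ) < n := by exact_mod_cast hn
  have hSB : ∀ (s : Finset (Fin n)) (x : Fin n → Fin m → ℝ), ‖smoothCount r (k + 1) (gram s x)‖ ≤ m := by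
    intro s x
    rw [Real.norm_of_nonneg (smoothCount_nonneg (gram_posSemidef s x) hr0 _)]
    exact smoothCount_le (gram_posSemidef s x) hr0 _
  have hes := efron_stein (fun i => Measure.pi (ν i))
    (measurable_smoothCount (m := m) r (k + 1) s).stronglyMeasurable (B := m) (hSB s)
    (h := fun i x => smoothCount r (k + 1) (gram (s.erase i) x))
    (fun i => (measurable_smoothCount (m := m) r (k + 1) (s.erase i)).stronglyMeasurable)
    (fun i => hSB _) (fun i x t => by
      simp only [gram_update (Finset.notMem_erase i s)])
  simp only [Real.norm_eq_abs, sq_abs] at hes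
  refine hes.trans ?_
  set B := 2 * 4 ^ (k + 1) * (r⁻¹ * ((n : ℝ)⁻¹ * (C * (n / r ^ (2 * k - 1) + 1 / r ^ 2))) +
          ((2 * κ) ^ (2 * k + 2) / r ^ (2 * k + 2) + 8 * (X₄ + 1) * κ / (n * r ^ 2))) with hB
  have hB0 : 0 ≤ B := by positivity
  have hterm : ∀ i, ∫ x, (smoothCount r (k + 1) (gram s x) -
      smoothCount r (k + 1) (gram (s.erase i) x)) ^ 2 ∂ensemble ν ≤ B := by
    intro i
    by_cases hi : i ∈ s
    swap
    · simp [Finset.erase_eq_of_notMem hi, hB0]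
    have hI := integrable_smoothCount hν hr0 (2 * k) (s.erase i)
    set c := (2 * κ) ^ (2 * k + 2) / r ^ (2 * k + 2) + 8 * (X₄ + 1) * κ / (n * r ^ 2)
    have hf : Integrable (fun x => (smoothCount r (k + 1) (gram s x) -
        smoothCount r (k + 1) (gram (s.erase i) x)) ^ 2) (ensemble ν) := by
      have := integrable_norm_sq_of_bound (ν := ensemble ν)
        (((measurable_smoothCount (m := m) r (k + 1) s).sub
        (measurable_smoothCount (m := m) r (k + 1) (s.erase i))).stronglyMeasurable) (B := m + m)
        (fun x => (norm_sub_le _ _).trans (add_le_add (hSB _ x) (hSB _ x)))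
      simpa only [Real.norm_eq_abs, sq_abs, Pi.sub_apply] using this
    have h' := integral_le_of_integral_update_le (fun i => Measure.pi (ν i)) hf
      (g := fun x => 2 * 4 ^ (k + 1) *
        (r⁻¹ * ((n : ℝ)⁻¹ * smoothCount r (2 * k) (gram (s.erase i) x)) + c))
      ((((hI.const_mul _).const_mul _).add (integrable_const c)).const_mul _) i
      (fun x => by
        obtain ⟨h1, h2⟩ := integral_quad_row hν i
          ((1 - r • (gram (s.erase i) x + r • (1 : Matrix (Fin m) (Fin m) ℝ))⁻¹) ^ (2 * k))
        obtain ⟨h3, h4⟩ := integral_min_row_le hν hX hn hmn hr0 (k := 2 * k + 2) (by omega) i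
        have h5 : ∀ t, (smoothCount r (k + 1) (gram s (Function.update x i t)) -
            smoothCount r (k + 1) (gram (s.erase i) (Function.update x i t))) ^ 2 ≤
            2 * 4 ^ (k + 1) * (r⁻¹ *
            quad ((1 - r • (gram (s.erase i) x + r • (1 : Matrix (Fin m) (Fin m) ℝ))⁻¹) ^ (2 * k))
              ((√(n : ℝ))⁻¹ • t) + min 1 (r⁻¹ * ∑ l, ((√(n : ℝ))⁻¹ • t) l ^ 2) ^ (2 * k + 2)) := by
          intro t
          have e : gram s (Function.update x i t) = gram (s.erase i) x +
              vecMulVec ((√(n : ℝ))⁻¹ • t) ((√(n : ℝ))⁻¹ • t) := by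
            conv_lhs => rw [← Finset.insert_erase hi]
            rw [gram_insert (Finset.notMem_erase i s), gram_update (Finset.notMem_erase i s),
              Function.update_self]
          rw [e, gram_update (Finset.notMem_erase i s)]
          exact smoothCount_sub_sq_le (gram_posSemidef _ x) hr0 k _
        refine (integral_mono_of_nonneg (Filter.Eventually.of_forall fun t => sq_nonneg _)
          (((h1.const_mul _).add h3).const_mul _) (Filter.Eventually.of_forall h5)).trans ?_
        simp only [Pi.add_apply]
        rw [integral_const_mul, integral_add (h1.const_mul _) h3, integral_const_mul, h2]
        gcongr
        rfl)
    refine h'.trans ?_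
    rw [integral_const_mul, integral_add (by exact (hI.const_mul _).const_mul _)
      (integrable_const c), integral_const_mul, integral_const_mul, hB]
    simp only [integral_const, probReal_univ, one_smul]
    gcongr
    exact h n m ν r _ hn hmn hν hr
  refine (Finset.sum_le_card_nsmul _ _ B fun i _ => hterm i).trans ?_
  rw [Finset.card_univ, Fintype.card_fin, nsmul_eq_mul]
  have hr2 : r ^ (2 * k) = r ^ (2 * k - 1) * r := by
    rw [← pow_succ]; congr 1; omega
  have e1 : (n : ℝ) * B = 2 * 4 ^ (k + 1) * (C * (n / r ^ (2 * k) + 1 / r ^ 2 * r⁻¹) +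
      (2 * κ) ^ (2 * k + 2) * (n / r ^ (2 * k) * (1 / r ^ 2)) +
        8 * (X₄ + 1) * κ * (1 / r ^ 2)) := by
    rw [hB, hr2, pow_add r (2 * k) 2, hr2]
    field_simp
    ring
  rw [e1]
  have hri : r⁻¹ ≤ 1 := inv_le_one_of_one_le₀ hr
  have hri2 : 1 / r ^ 2 ≤ 1 := by
    rw [div_le_one (by positivity)]
    exact one_le_pow₀ hr
  have h1 : 1 / r ^ 2 * r⁻¹ ≤ 1 / r ^ 2 := mul_le_of_le_one_right (by positivity) hri
  have h2 : (n : ℝ) / r ^ (2 * k) * (1 / r ^ 2) ≤ n / r ^ (2 * k) + 1 / r ^ 2 :=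
    (mul_le_of_le_one_right (by positivity) hri2).trans (le_add_of_nonneg_right (by positivity))
  have h3 : 1 / r ^ 2 ≤ n / r ^ (2 * k) + 1 / r ^ 2 := le_add_of_nonneg_left (by positivity)
  calc 2 * 4 ^ (k + 1) * (C * (n / r ^ (2 * k) + 1 / r ^ 2 * r⁻¹) +
      (2 * κ) ^ (2 * k + 2) * (n / r ^ (2 * k) * (1 / r ^ 2)) + 8 * (X₄ + 1) * κ * (1 / r ^ 2))
      ≤ 2 * 4 ^ (k + 1) * (C * (n / r ^ (2 * k) + 1 / r ^ 2) +
      (2 * κ) ^ (2 * k + 2) * (n / r ^ (2 * k) + 1 / r ^ 2) +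
      8 * (X₄ + 1) * κ * (n / r ^ (2 * k) + 1 / r ^ 2)) := by gcongr
    _ = _ := by ring

end SmoothCount

/-! ### The contribution of one row -/

section Row
variable {n m : ℕ} {ν : Fin m → Measure ℝ} {X₄ κ : ℝ} {M : Matrix (Fin m) (Fin m) ℝ} {z : ℂ}

theorem quad_inv_sqrt_smul (H : Matrix (Fin m) (Fin m) ℂ) (t : Fin m → ℝ) :
    quad H ((√(n : ℝ))⁻¹ • t) = (n : ℂ)⁻¹ * quad H t := by
  rw [quad_smul_right]
  congr 1
  simp only [Complex.coe_algebraMap, ← Complex.ofReal_pow, inv_pow,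
    Real.sq_sqrt (Nat.cast_nonneg n)]
  simp

theorem integral_norm_quad_row_sub_sq_le (hν : ∀ k, HasUnitMoments (ν k) X₄)
    (H : Matrix (Fin m) (Fin m) ℂ) :
    Integrable (fun t => ‖quad H ((√(n : ℝ))⁻¹ • t) - (n : ℂ)⁻¹ * H.trace‖ ^ 2) (Measure.pi ν) ∧
    ∫ t, ‖quad H ((√(n : ℝ))⁻¹ • t) - (n : ℂ)⁻¹ * H.trace‖ ^ 2 ∂Measure.pi ν ≤
      2 * (X₄ + 1) * ((n : ℝ)⁻¹ * ((n : ℝ)⁻¹ * ∑ k, ∑ l, ‖H k l‖ ^ 2)) := by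
  obtain ⟨h1, h2⟩ := integral_norm_quad_sub_trace_sq_le hν H
  have e : ∀ t, ‖quad H ((√(n : ℝ))⁻¹ • t) - (n : ℂ)⁻¹ * H.trace‖ ^ 2 =
      (n : ℝ)⁻¹ ^ 2 * ‖quad H t - H.trace‖ ^ 2 := by
    intro t
    rw [quad_inv_sqrt_smul, ← mul_sub, norm_mul, mul_pow]
    simp
  simp only [e]
  refine ⟨h1.const_mul _, ?_⟩
  rw [integral_const_mul]
  calc (n : ℝ)⁻¹ ^ 2 * ∫ t, ‖quad H t - H.trace‖ ^ 2 ∂Measure.pi ν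
      ≤ (n : ℝ)⁻¹ ^ 2 * (2 * (X₄ + 1) * ∑ k, ∑ l, ‖H k l‖ ^ 2) := by gcongr
    _ = _ := by ring

theorem integral_quad_row_complex (hν : ∀ k, HasUnitMoments (ν k) X₄)
    (H : Matrix (Fin m) (Fin m) ℂ) :
    Integrable (fun t => quad H ((√(n : ℝ))⁻¹ • t)) (Measure.pi ν) ∧
    ∫ t, quad H ((√(n : ℝ))⁻¹ • t) ∂Measure.pi ν = (n : ℂ)⁻¹ * H.trace := by
  simp only [quad_inv_sqrt_smul]
  exact ⟨(integrable_quad hν H).const_mul _, by rw [integral_const_mul, integral_quad hν]⟩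

/-- Replacing the row-dependent ratio `Q / D` in the trace of the perturbed resolvent by the ratio
of the means of `Q` and `D` costs `O(1 / (n |Im z|²))` times `min n (frobMean / |meanDenom|²)` in
mean square. -/
theorem integral_norm_ratio_sub_sq_le (hν : ∀ k, HasUnitMoments (ν k) X₄) (hX : 0 ≤ X₄)
    (hM : M.PosSemidef) (hz : z.im ≠ 0) (hn : 1 ≤ n) :
    ∫ t : Fin m → ℝ, ‖quad (greenMatrix M z * greenMatrix M z) ((√(n : ℝ))⁻¹ • t) /
        (1 + quad (greenMatrix M z) ((√(n : ℝ))⁻¹ • t)) -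
      (n : ℂ)⁻¹ * (greenMatrix M z * greenMatrix M z).trace / meanDenom n M z‖ ^ 2 ∂Measure.pi ν ≤
    8 * (X₄ + 1) / (n * |z.im| ^ 2) * min (n : ℝ) (frobMean n M z / ‖meanDenom n M z‖ ^ 2) := by
  have := fun k => (hν k).isProb
  have hv : 0 < |z.im| := abs_pos.mpr hz
  have hn0 : (0 : ℝ) < n := by exact_mod_cast hn
  set G := greenMatrix M z with hG
  set D0 := meanDenom n M z with hD0
  have hD0n : D0 ≠ 0 := meanDenom_ne_zero hM hz n
  have hD0p : 0 < ‖D0‖ := norm_pos_iff.mpr hD0n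
  set Q0 := (n : ℂ)⁻¹ * (G * G).trace
  have hr0 : ‖Q0 / D0‖ ≤ |z.im|⁻¹ := norm_trace_sq_div_le hM hz n
  have hr : ∀ y, ‖quad (G * G) y / (1 + quad G y)‖ ≤ |z.im|⁻¹ := norm_quad_sq_div_le hM hz
  have hJ := frobMean_nonneg (M := M) (z := z) n
  rw [mul_min_of_nonneg _ _ (by positivity)]
  refine le_min ?_ ?_
  · refine (integral_mono_of_nonneg (Filter.Eventually.of_forall fun t => sq_nonneg _)
      (integrable_const ((|z.im|⁻¹ + |z.im|⁻¹) ^ 2)) (Filter.Eventually.of_forall fun t =>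
        pow_le_pow_left₀ (norm_nonneg _)
          ((norm_sub_le _ _).trans (add_le_add (hr _) hr0)) 2)).trans ?_
    simp only [integral_const, probReal_univ, one_smul]
    rw [show (|z.im|⁻¹ + |z.im|⁻¹) ^ 2 = 4 / |z.im| ^ 2 by field_simp; ring,
      show 8 * (X₄ + 1) / (n * |z.im| ^ 2) * n = 8 * (X₄ + 1) / |z.im| ^ 2 by field_simp]
    gcongr
    linarith
  · obtain ⟨i1, b1⟩ := integral_norm_quad_row_sub_sq_le (n := n) hν (G * G)
    obtain ⟨i2, b2⟩ := integral_norm_quad_row_sub_sq_le (n := n) hν G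
    have hpt : ∀ t : Fin m → ℝ, ‖quad (G * G) ((√(n : ℝ))⁻¹ • t) /
        (1 + quad G ((√(n : ℝ))⁻¹ • t)) - Q0 / D0‖ ^ 2 ≤
        2 / ‖D0‖ ^ 2 * ‖quad (G * G) ((√(n : ℝ))⁻¹ • t) - Q0‖ ^ 2 +
        2 / (|z.im| ^ 2 * ‖D0‖ ^ 2) *
          ‖quad G ((√(n : ℝ))⁻¹ • t) - (n : ℂ)⁻¹ * G.trace‖ ^ 2 := by
      intro t
      have hD := one_add_quad_ne_zero hM hz ((√(n : ℝ))⁻¹ • t)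
      rw [← hG] at hD
      have hq := hr ((√(n : ℝ))⁻¹ • t)
      set Q := quad (G * G) ((√(n : ℝ))⁻¹ • t)
      set d := quad G ((√(n : ℝ))⁻¹ • t)
      have e : Q / (1 + d) - Q0 / D0 =
          (Q - Q0) / D0 - Q / (1 + d) * ((d - (n : ℂ)⁻¹ * G.trace) / D0) := by
        have : d - (n : ℂ)⁻¹ * G.trace = (1 + d) - D0 := by rw [hD0, meanDenom]; ring
        rw [this]
        field_simp
        ring
      have h1 : ‖Q / (1 + d) - Q0 / D0‖ ≤
          ‖Q - Q0‖ / ‖D0‖ + |z.im|⁻¹ * (‖d - (n : ℂ)⁻¹ * G.trace‖ / ‖D0‖) := by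
        rw [e]
        refine (norm_sub_le _ _).trans ?_
        rw [norm_div, norm_mul, norm_div (d - _)]
        gcongr
      refine (pow_le_pow_left₀ (norm_nonneg _) h1 2).trans ?_
      refine add_sq_le.trans (le_of_eq ?_)
      field_simp
    refine (integral_mono_of_nonneg (Filter.Eventually.of_forall fun t => sq_nonneg _)
      ((i1.const_mul _).add (i2.const_mul _)) (Filter.Eventually.of_forall hpt)).trans ?_
    simp only [Pi.add_apply]
    rw [integral_add (i1.const_mul _) (i2.const_mul _), integral_const_mul, integral_const_mul]
    have hb := sum_norm_sq_green_sq_le hM hz n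
    have b1' := b1.trans (mul_le_mul_of_nonneg_left (mul_le_mul_of_nonneg_left hb
      (by positivity : 0 ≤ (n : ℝ)⁻¹)) (by positivity))
    calc _ ≤ 2 / ‖D0‖ ^ 2 * (2 * (X₄ + 1) * ((n : ℝ)⁻¹ * (frobMean n M z / |z.im| ^ 2))) +
          2 / (|z.im| ^ 2 * ‖D0‖ ^ 2) * (2 * (X₄ + 1) * ((n : ℝ)⁻¹ * frobMean n M z)) := by
          gcongr
          exact b2
      _ = _ := by
          field_simp
          ring

theorem one_sub_mul_le_rpow_neg {s p : ℝ} (hs : 0 < s) (hp : 0 ≤ p) :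
    1 - p * (s - 1) ≤ s ^ (-p) := by
  rw [Real.rpow_def_of_pos hs]
  have h1 := Real.add_one_le_exp (Real.log s * -p)
  have h2 := mul_le_mul_of_nonneg_left (Real.log_le_sub_one_of_pos hs) hp
  linarith

/-- Jensen's inequality for `s ↦ s ^ (-p)`. -/
theorem rpow_neg_le_integral {α : Type*} [MeasurableSpace α] {μ : Measure α}
    [IsProbabilityMeasure μ] {f : α → ℝ} (hf : ∀ x, 0 < f x) (hfi : Integrable f μ) {p : ℝ}
    (hp : 0 ≤ p) (hfp : Integrable (fun x => f x ^ (-p)) μ) {a : ℝ} (ha : 0 < a)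
    (h : ∫ x, f x ∂μ ≤ a) : a ^ (-p) ≤ ∫ x, f x ^ (-p) ∂μ := by
  have hpt : ∀ x, a ^ (-p) * (1 - p * (f x / a - 1)) ≤ f x ^ (-p) := by
    intro x
    have h1 := one_sub_mul_le_rpow_neg (div_pos (hf x) ha) hp
    have h2 := mul_le_mul_of_nonneg_left h1 (Real.rpow_nonneg ha.le (-p))
    rwa [← Real.mul_rpow ha.le (div_pos (hf x) ha).le, mul_div_cancel₀ _ ha.ne'] at h2
  have hi : Integrable (fun x => p * (f x / a - 1)) μ :=
    ((hfi.div_const _).sub (integrable_const _)).const_mul _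
  refine le_trans ?_ (integral_mono (((integrable_const _).sub hi).const_mul _) hfp hpt)
  rw [integral_const_mul]
  simp only [Pi.sub_apply]
  rw [integral_sub (integrable_const _) hi, integral_const_mul,
    integral_sub (hfi.div_const _) (integrable_const _), integral_div]
  simp only [integral_const, probReal_univ, one_smul]
  refine le_mul_of_one_le_right (Real.rpow_nonneg ha.le _) ?_
  have : (∫ x, f x ∂μ) / a ≤ 1 := (div_le_one ha).mpr h
  nlinarith

/-- The mean of `1 + yᵀ G y` over the row is `meanDenom`, and its variance is `O(frobMean / n)`. -/
theorem integral_norm_one_add_quad_sq_le (hν : ∀ k, HasUnitMoments (ν k) X₄) :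
    Integrable (fun t => ‖1 + quad (greenMatrix M z) ((√(n : ℝ))⁻¹ • t)‖ ^ 2) (Measure.pi ν) ∧
    ∫ t, ‖1 + quad (greenMatrix M z) ((√(n : ℝ))⁻¹ • t)‖ ^ 2 ∂Measure.pi ν ≤
      ‖meanDenom n M z‖ ^ 2 + 2 * (X₄ + 1) * (frobMean n M z / n) := by
  have := fun k => (hν k).isProb
  set G := greenMatrix M z
  obtain ⟨i2, b2⟩ := integral_norm_quad_row_sub_sq_le (n := n) hν G
  obtain ⟨i1, b1⟩ := integral_quad_row_complex (n := n) hν G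
  have e : ∀ t : Fin m → ℝ, ‖1 + quad G ((√(n : ℝ))⁻¹ • t)‖ ^ 2 = ‖meanDenom n M z‖ ^ 2 +
      2 * inner ℝ (meanDenom n M z) (quad G ((√(n : ℝ))⁻¹ • t) - (n : ℂ)⁻¹ * G.trace) +
      ‖quad G ((√(n : ℝ))⁻¹ • t) - (n : ℂ)⁻¹ * G.trace‖ ^ 2 := by
    intro t
    rw [← norm_add_sq_real]
    congr 2
    rw [meanDenom]
    ring
  have i3 : Integrable (fun t : Fin m → ℝ => quad G ((√(n : ℝ))⁻¹ • t) - (n : ℂ)⁻¹ * G.trace)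
      (Measure.pi ν) := i1.sub (integrable_const _)
  have i4 := (i3.const_inner (𝕜 := ℝ) (meanDenom n M z)).const_mul 2
  simp only [e]
  refine ⟨((integrable_const _).add i4).add i2, ?_⟩
  rw [integral_add (by exact (integrable_const _).add i4) i2, integral_add (integrable_const _) i4,
    integral_const_mul, integral_inner i3, integral_sub i1 (integrable_const _), b1]
  simp only [integral_const, probReal_univ, one_smul, sub_self, inner_zero_right, mul_zero,
    add_zero]
  refine add_le_add le_rfl (b2.trans (le_of_eq ?_))
  rw [frobMean]
  ring

/-- The lower bound `(K |z|² (|meanDenom|² + frobMean / n)) ^ (-(1 + δ) / 2)`, for a constant `K`,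
of the conditional `(1 + δ)`-th absolute moment of a diagonal entry of the resolvent given all rows
but one. -/
noncomputable def rowWeight (K δ : ℝ) (n : ℕ) (M : Matrix (Fin m) (Fin m) ℝ) (z : ℂ) : ℝ :=
  (K * ‖z‖ ^ 2 * (‖meanDenom n M z‖ ^ 2 + frobMean n M z / n)) ^ (-((1 + δ) / 2))

theorem meanDenom_sq_add_pos (hM : M.PosSemidef) (hz : z.im ≠ 0) (n : ℕ) :
    0 < ‖meanDenom n M z‖ ^ 2 + frobMean n M z / n := by
  have h1 : 0 < ‖meanDenom n M z‖ := norm_pos_iff.mpr (meanDenom_ne_zero hM hz n)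
  have h2 := frobMean_nonneg (M := M) (z := z) n
  positivity

theorem norm_inv_rpow_le (hM : M.PosSemidef) (hz : z.im ≠ 0) {δ : ℝ} (hδ : 0 < δ)
    (t : Fin m → ℝ) :
    ‖(z * (1 + quad (greenMatrix M z) t))⁻¹‖ ^ (1 + δ) ≤ |z.im|⁻¹ ^ (1 + δ) := by
  refine Real.rpow_le_rpow (norm_nonneg _) ?_ (by linarith)
  rw [norm_inv, norm_mul]
  exact inv_anti₀ (abs_pos.mpr hz) (abs_im_le_norm_mul_one_add_quad hM hz t)

/-- By Jensen's inequality and the second moment of `1 + yᵀ G y`. -/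
theorem rowWeight_le_integral (hν : ∀ k, HasUnitMoments (ν k) X₄) (hX : 0 ≤ X₄)
    (hM : M.PosSemidef) (hz : z.im ≠ 0) {δ : ℝ} (hδ : 0 < δ) :
    rowWeight (2 * (X₄ + 1)) δ n M z ≤
      ∫ t, ‖(z * (1 + quad (greenMatrix M z) ((√(n : ℝ))⁻¹ • t)))⁻¹‖ ^ (1 + δ) ∂Measure.pi ν := by
  have := fun k => (hν k).isProb
  have hz0 : 0 < ‖z‖ := norm_pos_iff.mpr fun h => hz (by simp [h])
  set G := greenMatrix M z
  have hD := fun t => norm_pos_iff.mpr (one_add_quad_ne_zero hM hz t)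
  have e : ∀ t : Fin m → ℝ, ‖(z * (1 + quad G ((√(n : ℝ))⁻¹ • t)))⁻¹‖ ^ (1 + δ) =
      (‖z‖ ^ 2 * ‖1 + quad G ((√(n : ℝ))⁻¹ • t)‖ ^ 2) ^ (-((1 + δ) / 2)) := by
    intro t
    have h := mul_pos hz0 (hD ((√(n : ℝ))⁻¹ • t))
    rw [norm_inv, norm_mul, ← mul_pow, ← Real.rpow_natCast, ← Real.rpow_mul h.le,
      Real.inv_rpow h.le, ← Real.rpow_neg h.le]
    congr 1
    push_cast
    ring
  obtain ⟨i1, b1⟩ := integral_norm_one_add_quad_sq_le (n := n) (M := M) (z := z) hν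
  have hint : Integrable (fun t : Fin m → ℝ =>
      ‖(z * (1 + quad G ((√(n : ℝ))⁻¹ • t)))⁻¹‖ ^ (1 + δ)) (Measure.pi ν) := by
    refine integrable_of_bound (B := |z.im|⁻¹ ^ (1 + δ)) (Measurable.stronglyMeasurable ?_)
      fun t => ?_
    · have : Measurable (quad G) := (continuous_quad G).measurable
      have h2 : Measurable fun t : Fin m → ℝ => quad G ((√(n : ℝ))⁻¹ • t) :=
        this.comp (measurable_const_smul _)
      exact ((h2.const_add _).const_mul _).inv.norm.pow_const _
    · rw [Real.norm_of_nonneg (by positivity)]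
      exact norm_inv_rpow_le hM hz hδ _
  simp only [e] at hint ⊢
  refine rpow_neg_le_integral (fun t => mul_pos (pow_pos hz0 2) (pow_pos (hD _) 2))
    (i1.const_mul _) (by linarith) hint
    (mul_pos (by positivity) (meanDenom_sq_add_pos hM hz n)) ?_
  rw [integral_const_mul]
  refine (mul_le_mul_of_nonneg_left b1 (by positivity)).trans ?_
  rw [mul_comm (2 * (X₄ + 1)) (‖z‖ ^ 2), mul_assoc (‖z‖ ^ 2)]
  refine mul_le_mul_of_nonneg_left ?_ (by positivity)
  have := mul_nonneg (by linarith : 0 ≤ 2 * X₄ + 1) (sq_nonneg ‖meanDenom n M z‖)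
  linarith

theorem min_le_two_mul_div (hM : M.PosSemidef) (hz : z.im ≠ 0) (hn : 1 ≤ n) :
    min (n : ℝ) (frobMean n M z / ‖meanDenom n M z‖ ^ 2) ≤
      2 * (frobMean n M z / (‖meanDenom n M z‖ ^ 2 + frobMean n M z / n)) := by
  have hn0 : (0 : ℝ) < n := by exact_mod_cast hn
  have hP := meanDenom_sq_add_pos hM hz n
  have h1 : 0 < ‖meanDenom n M z‖ := norm_pos_iff.mpr (meanDenom_ne_zero hM hz n)
  have hJ := frobMean_nonneg (M := M) (z := z) n
  rw [← mul_div_assoc, le_div_iff₀ hP]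
  rcases le_total (frobMean n M z / n) (‖meanDenom n M z‖ ^ 2) with h | h
  · refine (mul_le_mul_of_nonneg_right (min_le_right _ _) hP.le).trans ?_
    rw [div_mul_eq_mul_div, div_le_iff₀ (by positivity)]
    nlinarith
  · refine (mul_le_mul_of_nonneg_right (min_le_left _ _) hP.le).trans ?_
    have : n * (frobMean n M z / n) = frobMean n M z := by field_simp
    nlinarith

theorem rowWeight_eq {K : ℝ} (hK : 0 < K) (hM : M.PosSemidef) (hz : z.im ≠ 0) (δ : ℝ) :
    rowWeight K δ n M z = K ^ (-((1 + δ) / 2)) * ‖z‖ ^ (-(1 + δ)) *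
      (‖meanDenom n M z‖ ^ 2 + frobMean n M z / n) ^ (-((1 + δ) / 2)) := by
  have hP := meanDenom_sq_add_pos hM hz n
  rw [rowWeight, Real.mul_rpow (by positivity) hP.le, Real.mul_rpow hK.le (by positivity),
    ← Real.rpow_natCast ‖z‖ 2, ← Real.rpow_mul (norm_nonneg z)]
  congr 3
  push_cast
  ring

/-- Where few eigenvalues exceed a fixed fraction of `|z|`, the row variance is controlled by the
moment of the diagonal entry of the resolvent. -/
theorem min_le_mul_rowWeight {K : ℝ} (hK : 0 < K) (hM : M.PosSemidef) (hz : z.im ≠ 0) (hn : 1 ≤ n)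
    (hmn : (m : ℝ) ≤ κ * n) (k : ℕ) {δ Y c : ℝ} (hδ : 0 < δ) (hδ1 : δ < 1) (hY : |z.im| ≤ Y)
    (hS : (3 ^ k * smoothCount ‖z‖ k M / n) ^ δ * ‖z‖ ^ (1 + δ) ≤ c) :
    min (n : ℝ) (frobMean n M z / ‖meanDenom n M z‖ ^ 2) ≤
      2 * K ^ ((1 + δ) / 2) * (4 * κ * Y ^ (2 * δ) + c) * |z.im| ^ (-(1 + δ)) *
        rowWeight K δ n M z := by
  have hP := meanDenom_sq_add_pos hM hz n
  have hz0 : 0 < ‖z‖ := norm_pos_iff.mpr fun h => hz (by simp [h])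
  have h1 : 0 < ‖meanDenom n M z‖ := norm_pos_iff.mpr (meanDenom_ne_zero hM hz n)
  have hJ := frobMean_nonneg (M := M) (z := z) n
  have hmain := frobMean_mul_rpow_le hM hz hn hmn k hδ hδ1 hY hS
  rw [rowWeight_eq hK hM hz]
  refine (min_le_two_mul_div hM hz hn).trans ?_
  set P := ‖meanDenom n M z‖ ^ 2 + frobMean n M z / n
  have e1 : P⁻¹ ≤ ‖meanDenom n M z‖ ^ (δ - 1) * P ^ (-((1 + δ) / 2)) := by
    have : P⁻¹ = P ^ ((δ - 1) / 2) * P ^ (-((1 + δ) / 2)) := by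
      rw [← Real.rpow_add hP, ← Real.rpow_neg_one]
      congr 1
      ring
    rw [this]
    gcongr
    have h2 : ‖meanDenom n M z‖ ^ (δ - 1) = (‖meanDenom n M z‖ ^ 2) ^ ((δ - 1) / 2) := by
      rw [← Real.rpow_natCast, ← Real.rpow_mul h1.le]
      congr 1
      push_cast
      ring
    rw [h2]
    refine Real.rpow_le_rpow_of_nonpos (by positivity) ?_ (by linarith)
    exact le_add_of_nonneg_right (by positivity)
  have e2 : K ^ ((1 + δ) / 2) * K ^ (-((1 + δ) / 2)) = 1 := by
    rw [← Real.rpow_add hK]; simp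
  have e3 : ‖z‖ ^ (1 + δ) * ‖z‖ ^ (-(1 + δ)) = 1 := by
    rw [← Real.rpow_add hz0]; simp
  calc 2 * (frobMean n M z / P) = 2 * (frobMean n M z * P⁻¹) := by rw [div_eq_mul_inv]
    _ ≤ 2 * (frobMean n M z * (‖meanDenom n M z‖ ^ (δ - 1) * P ^ (-((1 + δ) / 2)))) := by gcongr
    _ = 2 * (frobMean n M z * ‖meanDenom n M z‖ ^ (δ - 1) * (‖z‖ ^ (1 + δ) * ‖z‖ ^ (-(1 + δ)))) *
          P ^ (-((1 + δ) / 2)) := by rw [e3]; ring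
    _ = 2 * (frobMean n M z * ‖meanDenom n M z‖ ^ (δ - 1) * ‖z‖ ^ (1 + δ)) * ‖z‖ ^ (-(1 + δ)) *
          P ^ (-((1 + δ) / 2)) := by ring
    _ ≤ 2 * ((4 * κ * Y ^ (2 * δ) + c) * |z.im| ^ (-(1 + δ))) * ‖z‖ ^ (-(1 + δ)) *
          P ^ (-((1 + δ) / 2)) := by gcongr
    _ = 2 * (K ^ ((1 + δ) / 2) * K ^ (-((1 + δ) / 2))) *
          ((4 * κ * Y ^ (2 * δ) + c) * |z.im| ^ (-(1 + δ))) * ‖z‖ ^ (-(1 + δ)) *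
          P ^ (-((1 + δ) / 2)) := by rw [e2]; ring
    _ = _ := by ring

/-- The a priori lower bound of the weight. -/
theorem abs_im_rpow_le_rowWeight {K : ℝ} (hK : 0 < K) (hκ : 0 ≤ κ) (hM : M.PosSemidef)
    (hz : z.im ≠ 0) (hn : 1 ≤ n) (hmn : (m : ℝ) ≤ κ * n) {δ Y : ℝ} (hδ : 0 < δ)
    (hY : |z.im| ≤ Y) :
    ‖z‖ ^ (-(1 + δ)) ≤ (K * ((Y + κ) ^ 2 + κ)) ^ ((1 + δ) / 2) * |z.im| ^ (-(1 + δ)) *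
      rowWeight K δ n M z := by
  have hP := meanDenom_sq_add_pos hM hz n
  have hv : 0 < |z.im| := abs_pos.mpr hz
  have hn1 : (1 : ℝ) ≤ n := by exact_mod_cast hn
  set B := (Y + κ) ^ 2 + κ
  have hB : 0 < B := by have := hv.trans_le hY; positivity
  have hJ := frobMean_nonneg (M := M) (z := z) n
  rw [rowWeight_eq hK hM hz]
  set P := ‖meanDenom n M z‖ ^ 2 + frobMean n M z / n with hPdef
  have hPB : P ≤ B * |z.im| ^ (-2 : ℝ) := by
    have h1 : ‖meanDenom n M z‖ ≤ (Y + κ) / |z.im| := by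
      refine (norm_meanDenom_le hM hz hn hmn).trans ?_
      rw [add_div]
      gcongr
      exact (one_le_div hv).mpr hY
    have h2 : frobMean n M z / n ≤ κ / |z.im| ^ 2 :=
      (div_le_self hJ hn1).trans (frobMean_le hM hz hn hmn)
    have h3 := pow_le_pow_left₀ (norm_nonneg _) h1 2
    have e : |z.im| ^ (-2 : ℝ) = (|z.im| ^ 2)⁻¹ := by
      rw [Real.rpow_neg hv.le]; norm_cast
    rw [e, ← div_eq_mul_inv, add_div, ← div_pow]
    exact add_le_add h3 h2
  have h4 : (B * |z.im| ^ (-2 : ℝ)) ^ (-((1 + δ) / 2)) ≤ P ^ (-((1 + δ) / 2)) :=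
    Real.rpow_le_rpow_of_nonpos hP hPB (by linarith)
  rw [Real.mul_rpow hB.le (by positivity), ← Real.rpow_mul hv.le,
    show (-2 : ℝ) * (-((1 + δ) / 2)) = 1 + δ by ring] at h4
  have e1 : (K * B) ^ ((1 + δ) / 2) * (K ^ (-((1 + δ) / 2)) * B ^ (-((1 + δ) / 2))) = 1 := by
    rw [← Real.mul_rpow hK.le hB.le, ← Real.rpow_add (by positivity)]; simp
  have e2 : |z.im| ^ (-(1 + δ)) * |z.im| ^ (1 + δ) = 1 := by
    rw [← Real.rpow_add hv]; simp
  calc ‖z‖ ^ (-(1 + δ)) = ((K * B) ^ ((1 + δ) / 2) * (K ^ (-((1 + δ) / 2)) *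
        B ^ (-((1 + δ) / 2)))) * (|z.im| ^ (-(1 + δ)) * |z.im| ^ (1 + δ)) * ‖z‖ ^ (-(1 + δ)) := by
        rw [e1, e2]; ring
    _ = (K * B) ^ ((1 + δ) / 2) * |z.im| ^ (-(1 + δ)) * (K ^ (-((1 + δ) / 2)) *
        ‖z‖ ^ (-(1 + δ)) * (B ^ (-((1 + δ) / 2)) * |z.im| ^ (1 + δ))) := by ring
    _ ≤ _ := by gcongr

/-- When no eigenvalue is comparable with `|z|` the weight is of order `|z| ^ (-(1 + δ))`. -/
theorem mul_one_sub_le_rowWeight {K : ℝ} (hK : 0 < K) (hκ : 0 ≤ κ) (hM : M.PosSemidef)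
    (hz : z.im ≠ 0) (hn : 1 ≤ n) (hmn : (m : ℝ) ≤ κ * n) (k : ℕ) {δ : ℝ} (hδ : 0 < δ)
    (hκz : 8 * κ ≤ ‖z‖) (h1z : 1 ≤ ‖z‖) :
    (K * (2 + 4 * κ)) ^ (-((1 + δ) / 2)) * ‖z‖ ^ (-(1 + δ)) *
      (1 - 3 ^ k * smoothCount ‖z‖ k M) ≤ rowWeight K δ n M z := by
  have hP := meanDenom_sq_add_pos hM hz n
  have hn1 : (1 : ℝ) ≤ n := by exact_mod_cast hn
  have hJ := frobMean_nonneg (M := M) (z := z) n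
  have hS0 : 0 ≤ 3 ^ k * smoothCount ‖z‖ k M :=
    mul_nonneg (by positivity) (smoothCount_nonneg hM (by linarith) k)
  rw [rowWeight_eq hK hM hz]
  by_cases hS : 3 ^ k * smoothCount ‖z‖ k M < 1
  · obtain ⟨h1, -, h2⟩ := meanDenom_bounds_of_smoothCount_lt hM hz hn hmn k hκz hS
    have hPle : ‖meanDenom n M z‖ ^ 2 + frobMean n M z / n ≤ 2 + 4 * κ := by
      have h3 : frobMean n M z / n ≤ 4 * κ := by
        refine (div_le_self hJ hn1).trans (h1.trans (div_le_self (by positivity) ?_))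
        exact one_le_pow₀ h1z
      nlinarith [norm_nonneg (meanDenom n M z)]
    have h4 := Real.rpow_le_rpow_of_nonpos hP hPle (show -((1 + δ) / 2) ≤ 0 by linarith)
    rw [Real.mul_rpow hK.le (by positivity)]
    calc _ ≤ K ^ (-((1 + δ) / 2)) * (2 + 4 * κ) ^ (-((1 + δ) / 2)) * ‖z‖ ^ (-(1 + δ)) :=
          mul_le_of_le_one_right (by positivity) (by linarith)
      _ = K ^ (-((1 + δ) / 2)) * ‖z‖ ^ (-(1 + δ)) * (2 + 4 * κ) ^ (-((1 + δ) / 2)) := by ring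
      _ ≤ _ := by gcongr
  · refine le_trans (mul_nonpos_of_nonneg_of_nonpos (by positivity) (by linarith)) (by positivity)

end Row

/-! ### Averaging over the remaining rows -/

section Integrated
variable {n m : ℕ} {ν : Fin n → Fin m → Measure ℝ} {X₄ κ : ℝ} {z : ℂ}

theorem measurable_trace_green (s : Finset (Fin n)) (z : ℂ) :
    Measurable fun x : Fin n → Fin m → ℝ => (greenMatrix (gram s x) z).trace := by
  simp only [Matrix.trace, Matrix.diag_apply]
  exact Finset.measurable_sum _ fun k _ => measurable_green (measurable_gram s) z k k

theorem measurable_meanDenom (s : Finset (Fin n)) (z : ℂ) :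
    Measurable fun x : Fin n → Fin m → ℝ => meanDenom n (gram s x) z := by
  unfold meanDenom
  exact ((measurable_trace_green s z).const_mul _).const_add _

theorem measurable_frobMean (s : Finset (Fin n)) (z : ℂ) :
    Measurable fun x : Fin n → Fin m → ℝ => frobMean n (gram s x) z := by
  unfold frobMean
  exact (Finset.measurable_sum _ fun k _ => Finset.measurable_sum _ fun l _ =>
    (measurable_green (measurable_gram s) z k l).norm.pow_const 2).const_mul _

theorem integrable_min (hν : ∀ i k, HasUnitMoments (ν i k) X₄) (s : Finset (Fin n)) (z : ℂ) :
    Integrable (fun x => min (n : ℝ) (frobMean n (gram s x) z / ‖meanDenom n (gram s x) z‖ ^ 2))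
      (ensemble ν) := by
  have := isProb_row hν
  refine integrable_of_bound (B := n) (Measurable.stronglyMeasurable (measurable_const.min
    ((measurable_frobMean s z).div ((measurable_meanDenom s z).norm.pow_const 2)))) fun x => ?_
  have h := frobMean_nonneg (M := gram s x) (z := z) n
  rw [Real.norm_of_nonneg (le_min (by positivity) (by positivity))]
  exact min_le_left _ _

theorem integrable_rowWeight (hν : ∀ i k, HasUnitMoments (ν i k) X₄) {K : ℝ} (hK : 0 < K)
    {δ : ℝ} (hδ : 0 < δ) (s : Finset (Fin n)) (hz : z.im ≠ 0) :
    Integrable (fun x => rowWeight K δ n (gram s x) z) (ensemble ν) := by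
  have := isProb_row hν
  have hv : 0 < |z.im| := abs_pos.mpr hz
  refine integrable_of_bound (B := (K * |z.im| ^ 2) ^ (-((1 + δ) / 2)))
    (Measurable.stronglyMeasurable ?_) fun x => ?_
  · unfold rowWeight
    exact ((((measurable_meanDenom s z).norm.pow_const 2).add
      ((measurable_frobMean s z).div_const _)).const_mul _).pow_const _
  · have hM := gram_posSemidef s x
    have h := frobMean_nonneg (M := gram s x) (z := z) n
    rw [rowWeight, Real.norm_of_nonneg (by positivity)]
    refine Real.rpow_le_rpow_of_nonpos (by positivity) ?_ (by linarith)
    rw [mul_assoc]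
    refine mul_le_mul_of_nonneg_left ?_ hK.le
    have h1 := pow_le_pow_left₀ hv.le (abs_im_le_norm_mul_meanDenom hM hz n) 2
    rw [mul_pow] at h1
    refine h1.trans (mul_le_mul_of_nonneg_left ?_ (by positivity))
    exact le_add_of_nonneg_right (by positivity)

/-- The case of bounded `z`, where the trivial bound `m ≤ κ n` on the number of eigenvalues suffices. -/
theorem integral_min_le_of_norm_le (hν : ∀ i k, HasUnitMoments (ν i k) X₄) {K : ℝ} (hK : 0 < K)
    (hκ : 0 ≤ κ) (hz : z.im ≠ 0) (hn : 1 ≤ n) (hmn : (m : ℝ) ≤ κ * n) {δ Y r : ℝ} (hδ : 0 < δ)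
    (hδ1 : δ < 1) (hY : |z.im| ≤ Y) (hr : ‖z‖ ≤ r) (s : Finset (Fin n)) :
    ∫ x, min (n : ℝ) (frobMean n (gram s x) z / ‖meanDenom n (gram s x) z‖ ^ 2) ∂ensemble ν ≤
      2 * K ^ ((1 + δ) / 2) * (4 * κ * Y ^ (2 * δ) + κ ^ δ * r ^ (1 + δ)) * |z.im| ^ (-(1 + δ)) *
        ∫ x, rowWeight K δ n (gram s x) z ∂ensemble ν := by
  have hn0 : (0 : ℝ) < n := by exact_mod_cast hn
  have hz0 : 0 < ‖z‖ := norm_pos_iff.mpr fun h => hz (by simp [h])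
  rw [← integral_const_mul]
  refine integral_mono (integrable_min hν s z) ((integrable_rowWeight hν hK hδ s hz).const_mul _)
    fun x => ?_
  refine min_le_mul_rowWeight hK (gram_posSemidef s x) hz hn hmn 0 hδ hδ1 hY ?_
  have hS := smoothCount_le (gram_posSemidef s x) hz0 0
  have hS0 := smoothCount_nonneg (gram_posSemidef s x) hz0 0
  rw [pow_zero, one_mul]
  gcongr
  rw [div_le_iff₀ hn0]
  exact hS.trans hmn

/-- The case of large `z` and `n ≤ ‖z‖ ^ (2 q)`: with probability at least one half there is no
eigenvalue of order `‖z‖`, and the expected number of such eigenvalues is `O(‖z‖⁻²)`. -/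
theorem integral_min_le_of_le_pow (hν : ∀ i k, HasUnitMoments (ν i k) X₄) {K : ℝ} (hK : 0 < K)
    (hκ : 0 ≤ κ) (hz : z.im ≠ 0) (hn : 1 ≤ n) (hmn : (m : ℝ) ≤ κ * n) {δ Y C : ℝ} (hδ : 0 < δ)
    (hδ1 : δ < 1) (hY : |z.im| ≤ Y) (s : Finset (Fin n)) {q : ℕ} (hC : 0 ≤ C)
    (hE : ∫ x, smoothCount ‖z‖ (2 * q + 3) (gram s x) ∂ensemble ν ≤
      C * (n / ‖z‖ ^ (2 * q + 2) + 1 / ‖z‖ ^ 2))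
    (h1z : 1 ≤ ‖z‖) (hκz : 8 * κ ≤ ‖z‖) (hCz : 4 * 3 ^ (2 * q + 3) * C ≤ ‖z‖)
    (hnz : (n : ℝ) ≤ ‖z‖ ^ (2 * q)) :
    ∫ x, min (n : ℝ) (frobMean n (gram s x) z / ‖meanDenom n (gram s x) z‖ ^ 2) ∂ensemble ν ≤
      2 * (K * (2 + 4 * κ)) ^ ((1 + δ) / 2) *
        (64 * κ * Y ^ (1 + δ) + 8 * (3 ^ (2 * q + 3) * C) * Y ^ δ) * |z.im| ^ (-(1 + δ)) *
        ∫ x, rowWeight K δ n (gram s x) z ∂ensemble ν := by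
  have := isProb_row hν
  have hv : 0 < |z.im| := abs_pos.mpr hz
  have hz0 : 0 < ‖z‖ := by linarith
  have hYp : 0 < Y := hv.trans_le hY
  set T : ℝ := 3 ^ (2 * q + 3) with hT
  have hI := integrable_smoothCount hν hz0 (2 * q + 3) s
  set W := ∫ x, rowWeight K δ n (gram s x) z ∂ensemble ν with hW
  set ES := ∫ x, smoothCount ‖z‖ (2 * q + 3) (gram s x) ∂ensemble ν with hES
  have hES2 : ES ≤ 2 * C / ‖z‖ ^ 2 := by
    refine hE.trans ?_
    have : (n : ℝ) / ‖z‖ ^ (2 * q + 2) ≤ 1 / ‖z‖ ^ 2 := by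
      rw [div_le_div_iff₀ (by positivity) (by positivity), pow_add, one_mul]
      gcongr
    calc C * (n / ‖z‖ ^ (2 * q + 2) + 1 / ‖z‖ ^ 2) ≤ C * (1 / ‖z‖ ^ 2 + 1 / ‖z‖ ^ 2) := by gcongr
      _ = _ := by ring
  -- The expected number of large eigenvalues is at most one half.
  have hhalf : T * ES ≤ 1 / 2 := by
    have h1 : T * ES ≤ T * (2 * C / ‖z‖ ^ 2) := by gcongr
    refine h1.trans ?_
    rw [← mul_div_assoc, div_le_div_iff₀ (by positivity) (by norm_num)]
    nlinarith
  have hlow : (K * (2 + 4 * κ)) ^ (-((1 + δ) / 2)) * ‖z‖ ^ (-(1 + δ)) * (1 / 2) ≤ W := by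
    have h := integral_mono (μ := ensemble ν) (((integrable_const (1 : ℝ)).sub
      (hI.const_mul T)).const_mul ((K * (2 + 4 * κ)) ^ (-((1 + δ) / 2)) * ‖z‖ ^ (-(1 + δ))))
      (integrable_rowWeight hν hK hδ s hz)
      fun x => mul_one_sub_le_rowWeight hK hκ (gram_posSemidef s x) hz hn hmn (2 * q + 3) hδ hκz h1z
    rw [integral_const_mul] at h
    simp only [Pi.sub_apply] at h
    rw [integral_sub (integrable_const _) (hI.const_mul T), integral_const_mul] at h
    simp only [integral_const, probReal_univ, one_smul] at h
    refine le_trans ?_ h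
    gcongr
    linarith
  have hup : ∫ x, min (n : ℝ) (frobMean n (gram s x) z / ‖meanDenom n (gram s x) z‖ ^ 2)
      ∂ensemble ν ≤ 64 * κ / ‖z‖ ^ 2 + 4 * (T * ES) / |z.im| := by
    refine (integral_mono (integrable_min hν s z) ((integrable_const (64 * κ / ‖z‖ ^ 2)).add
      ((hI.const_mul T).const_mul (4 / |z.im|))) fun x => ?_).trans (le_of_eq ?_)
    · refine (min_le_smoothCount (gram_posSemidef s x) hz hn hmn (2 * q + 3) hκz).trans
        (le_of_eq ?_)
      simp only [Pi.add_apply]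
      ring
    · simp only [Pi.add_apply]
      rw [integral_add (integrable_const _) ((hI.const_mul T).const_mul _), integral_const_mul,
        integral_const_mul]
      simp only [integral_const, probReal_univ, one_smul]
      ring
  set p := (1 + δ) / 2 with hp
  set A := K * (2 + 4 * κ) with hA
  have hA0 : 0 < A := by positivity
  have eA : A ^ p * A ^ (-p) = 1 := by rw [← Real.rpow_add hA0]; simp
  have hz2 : 1 / ‖z‖ ^ 2 ≤ ‖z‖ ^ (-(1 + δ)) := by
    rw [one_div, ← Real.rpow_natCast, ← Real.rpow_neg hz0.le]
    exact Real.rpow_le_rpow_of_exponent_le h1z (by push_cast; linarith)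
  have hz3 : 1 / ‖z‖ ^ 2 ≤ 2 * A ^ p * W := by
    have h := mul_le_mul_of_nonneg_left hlow (by positivity : 0 ≤ 2 * A ^ p)
    have e : 2 * A ^ p * (A ^ (-p) * ‖z‖ ^ (-(1 + δ)) * (1 / 2)) = ‖z‖ ^ (-(1 + δ)) := by
      linear_combination ‖z‖ ^ (-(1 + δ)) * eA
    rw [e] at h
    exact hz2.trans h
  have ev : |z.im| ^ (-(1 + δ)) * |z.im| ^ (1 + δ) = 1 := by rw [← Real.rpow_add hv]; simp
  have ev1 : |z.im| ^ (-(1 + δ)) * |z.im| ^ δ = 1 / |z.im| := by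
    rw [← Real.rpow_add hv, one_div, ← Real.rpow_neg_one]; congr 1; ring
  have hv1 : 64 * κ + 8 * (T * C) / |z.im| ≤
      (64 * κ * Y ^ (1 + δ) + 8 * (T * C) * Y ^ δ) * |z.im| ^ (-(1 + δ)) := by
    have e : 64 * κ + 8 * (T * C) / |z.im| = (64 * κ * |z.im| ^ (1 + δ) +
        8 * (T * C) * |z.im| ^ δ) * |z.im| ^ (-(1 + δ)) := by
      linear_combination (-64 * κ) * ev - 8 * (T * C) * ev1
    rw [e]
    gcongr
  calc _ ≤ 64 * κ / ‖z‖ ^ 2 + 4 * (T * ES) / |z.im| := hup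
    _ ≤ 64 * κ / ‖z‖ ^ 2 + 4 * (T * (2 * C / ‖z‖ ^ 2)) / |z.im| := by gcongr
    _ = (64 * κ + 8 * (T * C) / |z.im|) * (1 / ‖z‖ ^ 2) := by ring
    _ ≤ ((64 * κ * Y ^ (1 + δ) + 8 * (T * C) * Y ^ δ) * |z.im| ^ (-(1 + δ))) *
        (2 * A ^ p * W) := by gcongr
    _ = _ := by ring

/-- The case of large `z` and `n ≥ ‖z‖ ^ (2 q)`: by Chebyshev, the proportion of eigenvalues of order
`‖z‖` is below a constant times `‖z‖ ^ (-q)` except on an event of probability `O(n⁻¹ ‖z‖⁻²)`, where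
the trivial bound `n` and the a priori lower bound of the weight suffice. -/
theorem integral_min_le_of_pow_le (hν : ∀ i k, HasUnitMoments (ν i k) X₄) {K : ℝ} (hK : 0 < K)
    (hκ : 0 ≤ κ) (hz : z.im ≠ 0) (hn : 1 ≤ n) (hmn : (m : ℝ) ≤ κ * n) {δ Y C C' : ℝ} (hδ : 0 < δ)
    (hδ1 : δ < 1) (hY : |z.im| ≤ Y) (s : Finset (Fin n)) {q : ℕ} (hC : 0 ≤ C) (hC' : 0 ≤ C')
    (hq : 1 + δ ≤ q * δ)
    (hE : ∫ x, smoothCount ‖z‖ (2 * q + 3) (gram s x) ∂ensemble ν ≤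
      C * (n / ‖z‖ ^ (2 * q + 2) + 1 / ‖z‖ ^ 2))
    (hV : ∫ x, (smoothCount ‖z‖ (2 * q + 3) (gram s x) -
      ∫ y, smoothCount ‖z‖ (2 * q + 3) (gram s y) ∂ensemble ν) ^ 2 ∂ensemble ν ≤
      C' * (n / ‖z‖ ^ (2 * (2 * q + 2)) + 1 / ‖z‖ ^ 2))
    (h1z : 1 ≤ ‖z‖) (hCz : 4 * 3 ^ (2 * q + 3) * C ≤ ‖z‖) (hnz : ‖z‖ ^ (2 * q) ≤ (n : ℝ)) :
    ∫ x, min (n : ℝ) (frobMean n (gram s x) z / ‖meanDenom n (gram s x) z‖ ^ 2) ∂ensemble ν ≤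
      (2 * K ^ ((1 + δ) / 2) * (4 * κ * Y ^ (2 * δ) + 1) + 8 * (3 ^ (2 * q + 3)) ^ 2 * C' *
        (K * ((Y + κ) ^ 2 + κ)) ^ ((1 + δ) / 2)) * |z.im| ^ (-(1 + δ)) *
        ∫ x, rowWeight K δ n (gram s x) z ∂ensemble ν := by
  have := isProb_row hν
  have hv : 0 < |z.im| := abs_pos.mpr hz
  have hz0 : 0 < ‖z‖ := by linarith
  have hYp : 0 < Y := hv.trans_le hY
  have hn0 : (0 : ℝ) < n := by exact_mod_cast hn
  set T : ℝ := 3 ^ (2 * q + 3) with hT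
  have hT0 : 0 < T := by positivity
  have hI := integrable_smoothCount hν hz0 (2 * q + 3) s
  have hIW := integrable_rowWeight hν hK hδ s hz
  set W := ∫ x, rowWeight K δ n (gram s x) z ∂ensemble ν with hW
  set ES := ∫ x, smoothCount ‖z‖ (2 * q + 3) (gram s x) ∂ensemble ν with hES
  -- The threshold for the smooth count below which the pointwise bound applies.
  set θ : ℝ := n / (T * ‖z‖ ^ q) with hθ
  have hθ0 : 0 < θ := by positivity
  have hzq : 1 ≤ ‖z‖ ^ q := one_le_pow₀ h1z
  have hq2 : ‖z‖ ^ (2 * q) = ‖z‖ ^ q * ‖z‖ ^ q := by rw [← pow_add]; congr 1; omega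
  have hESθ : ES ≤ θ / 2 := by
    refine hE.trans ?_
    have h1 : (n : ℝ) / ‖z‖ ^ (2 * q + 2) ≤ n / (‖z‖ ^ q * ‖z‖ ^ 2) := by
      rw [pow_add, hq2]
      gcongr
      exact le_mul_of_one_le_left (by positivity) hzq
    have h2 : 1 / ‖z‖ ^ 2 ≤ n / (‖z‖ ^ q * ‖z‖ ^ 2) := by
      rw [div_le_div_iff₀ (by positivity) (by positivity), one_mul]
      gcongr
      refine le_trans ?_ hnz
      rw [hq2]
      exact le_mul_of_one_le_left (by positivity) hzq
    calc C * (n / ‖z‖ ^ (2 * q + 2) + 1 / ‖z‖ ^ 2)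
        ≤ C * (n / (‖z‖ ^ q * ‖z‖ ^ 2) + n / (‖z‖ ^ q * ‖z‖ ^ 2)) := by gcongr
      _ = (4 * T * C) / ‖z‖ ^ 2 * (θ / 2) := by
          rw [hθ]
          field_simp
          ring
      _ ≤ 1 * (θ / 2) := by
          gcongr
          rw [div_le_one (by positivity)]
          nlinarith
      _ = θ / 2 := one_mul _
  have hIV : Integrable (fun x => (smoothCount ‖z‖ (2 * q + 3) (gram s x) - ES) ^ 2)
      (ensemble ν) := by
    have := integrable_norm_sq_of_bound (ν := ensemble ν)
      ((measurable_smoothCount (m := m) ‖z‖ (2 * q + 3) s).sub_const ES).stronglyMeasurable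
      (B := m + ‖ES‖) fun x => by
        refine (norm_sub_le _ _).trans (add_le_add ?_ le_rfl)
        rw [Real.norm_of_nonneg (smoothCount_nonneg (gram_posSemidef s x) hz0 _)]
        exact smoothCount_le (gram_posSemidef s x) hz0 _
    simpa only [Real.norm_eq_abs, sq_abs] using this
  set c₁ := 2 * K ^ ((1 + δ) / 2) * (4 * κ * Y ^ (2 * δ) + 1) * |z.im| ^ (-(1 + δ)) with hc₁
  have hpt : ∀ x : Fin n → Fin m → ℝ,
      min (n : ℝ) (frobMean n (gram s x) z / ‖meanDenom n (gram s x) z‖ ^ 2) ≤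
      c₁ * rowWeight K δ n (gram s x) z +
        4 * n / θ ^ 2 * (smoothCount ‖z‖ (2 * q + 3) (gram s x) - ES) ^ 2 := by
    intro x
    have hM := gram_posSemidef s x
    have hS0 := smoothCount_nonneg hM hz0 (2 * q + 3)
    set L := smoothCount ‖z‖ (2 * q + 3) (gram s x)
    have hw0 : 0 ≤ rowWeight K δ n (gram s x) z := by
      have := frobMean_nonneg (M := gram s x) (z := z) n
      rw [rowWeight]
      positivity
    rcases le_total L θ with h | h
    · refine (min_le_mul_rowWeight (c := 1) hK hM hz hn hmn (2 * q + 3) hδ hδ1 hY ?_).trans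
        (le_add_of_nonneg_right (by positivity))
      have h1 : T * L / n ≤ ‖z‖ ^ (-(q : ℝ)) := by
        rw [Real.rpow_neg hz0.le, Real.rpow_natCast, ← one_div,
          div_le_div_iff₀ hn0 (by positivity)]
        have h2 : L * (T * ‖z‖ ^ q) ≤ n := by
          rwa [hθ, le_div_iff₀ (by positivity)] at h
        linarith
      calc (T * L / n) ^ δ * ‖z‖ ^ (1 + δ) ≤ (‖z‖ ^ (-(q : ℝ))) ^ δ * ‖z‖ ^ (1 + δ) := by gcongr
        _ = ‖z‖ ^ (1 + δ - q * δ) := by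
            rw [← Real.rpow_mul hz0.le, ← Real.rpow_add hz0]
            congr 1
            ring
        _ ≤ 1 := Real.rpow_le_one_of_one_le_of_nonpos h1z (by linarith)
    · refine (min_le_left _ _).trans (le_trans ?_ (le_add_of_nonneg_left (by positivity)))
      rw [div_mul_eq_mul_div, le_div_iff₀ (by positivity)]
      have h1 : θ / 2 ≤ L - ES := by linarith
      have h2 := pow_le_pow_left₀ (by positivity) h1 2
      have h3 := mul_le_mul_of_nonneg_left h2 (by positivity : (0 : ℝ) ≤ 4 * n)
      linarith
  have hz2 : 1 / ‖z‖ ^ 2 ≤ ‖z‖ ^ (-(1 + δ)) := by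
    rw [one_div, ← Real.rpow_natCast, ← Real.rpow_neg hz0.le]
    exact Real.rpow_le_rpow_of_exponent_le h1z (by push_cast; linarith)
  have hlow : ‖z‖ ^ (-(1 + δ)) ≤ (K * ((Y + κ) ^ 2 + κ)) ^ ((1 + δ) / 2) *
      |z.im| ^ (-(1 + δ)) * W := by
    have h := integral_mono (μ := ensemble ν) (integrable_const _) (hIW.const_mul
      ((K * ((Y + κ) ^ 2 + κ)) ^ ((1 + δ) / 2) * |z.im| ^ (-(1 + δ)))) fun x =>
      abs_im_rpow_le_rowWeight hK hκ (gram_posSemidef s x) hz hn hmn hδ hY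
    rw [integral_const_mul] at h
    simpa only [integral_const, probReal_univ, one_smul] using h
  have hbad : 4 * n / θ ^ 2 * (C' * (n / ‖z‖ ^ (2 * (2 * q + 2)) + 1 / ‖z‖ ^ 2)) ≤
      8 * T ^ 2 * C' * (1 / ‖z‖ ^ 2) := by
    have e : 4 * n / θ ^ 2 * (C' * (n / ‖z‖ ^ (2 * (2 * q + 2)) + 1 / ‖z‖ ^ 2)) =
        4 * T ^ 2 * C' * (1 / (‖z‖ ^ (2 * q) * ‖z‖ ^ 2) + ‖z‖ ^ (2 * q) / n) * (1 / ‖z‖ ^ 2) := by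
      rw [hθ, show 2 * (2 * q + 2) = 2 * q + 2 + (2 * q + 2) by ring, pow_add _ (2 * q + 2),
        pow_add _ (2 * q), hq2]
      field_simp
    rw [e]
    have h1 : 1 / (‖z‖ ^ (2 * q) * ‖z‖ ^ 2) ≤ 1 := by
      rw [div_le_one (by positivity), ← pow_add]
      exact one_le_pow₀ h1z
    have h2 : ‖z‖ ^ (2 * q) / n ≤ 1 := (div_le_one hn0).mpr hnz
    calc _ ≤ 4 * T ^ 2 * C' * (1 + 1) * (1 / ‖z‖ ^ 2) := by gcongr
      _ = _ := by ring
  calc _ ≤ ∫ x, (c₁ * rowWeight K δ n (gram s x) z +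
        4 * n / θ ^ 2 * (smoothCount ‖z‖ (2 * q + 3) (gram s x) - ES) ^ 2) ∂ensemble ν :=
        integral_mono (integrable_min hν s z) ((hIW.const_mul _).add (hIV.const_mul _)) hpt
    _ = c₁ * W + 4 * n / θ ^ 2 *
        ∫ x, (smoothCount ‖z‖ (2 * q + 3) (gram s x) - ES) ^ 2 ∂ensemble ν := by
        rw [integral_add (hIW.const_mul _) (hIV.const_mul _), integral_const_mul,
          integral_const_mul]
    _ ≤ c₁ * W + 4 * n / θ ^ 2 * (C' * (n / ‖z‖ ^ (2 * (2 * q + 2)) + 1 / ‖z‖ ^ 2)) := by gcongr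
    _ ≤ c₁ * W + 8 * T ^ 2 * C' * ((K * ((Y + κ) ^ 2 + κ)) ^ ((1 + δ) / 2) *
      |z.im| ^ (-(1 + δ)) * W) := by
        refine add_le_add le_rfl (hbad.trans ?_)
        gcongr
        exact hz2.trans hlow
    _ = _ := by rw [hc₁]; ring

/-- The row variance is bounded by the lower bound of the moment of the resolvent entry, uniformly
in the spectral parameter. -/
theorem exists_integral_min_le (hκ : 0 ≤ κ) (hX : 0 ≤ X₄) {K : ℝ} (hK : 0 < K) {δ Y : ℝ}
    (hδ : 0 < δ) (hδ1 : δ < 1) (hY : 0 < Y) :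
    ∃ C : ℝ, 0 ≤ C ∧ ∀ (n m : ℕ) (ν : Fin n → Fin m → Measure ℝ) (s : Finset (Fin n)) (z : ℂ),
      1 ≤ n → (m : ℝ) ≤ κ * n → (∀ i k, HasUnitMoments (ν i k) X₄) → z.im ≠ 0 → |z.im| ≤ Y →
      ∫ x, min (n : ℝ) (frobMean n (gram s x) z / ‖meanDenom n (gram s x) z‖ ^ 2) ∂ensemble ν ≤
        C * |z.im| ^ (-(1 + δ)) * ∫ x, rowWeight K δ n (gram s x) z ∂ensemble ν := by
  obtain ⟨q, hq⟩ := exists_nat_ge ((1 + δ) / δ)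
  rw [div_le_iff₀ hδ] at hq
  obtain ⟨C, hC, hE⟩ := exists_integral_smoothCount_le hκ hX (2 * q + 2)
  obtain ⟨C', hC', hV⟩ := exists_variance_smoothCount_le hκ hX (k := 2 * q + 2) (by omega)
  set r : ℝ := 1 + 8 * κ + 4 * 3 ^ (2 * q + 3) * C with hr
  have hr0 : 0 ≤ 4 * 3 ^ (2 * q + 3) * C := by positivity
  set c₁ := 2 * K ^ ((1 + δ) / 2) * (4 * κ * Y ^ (2 * δ) + κ ^ δ * r ^ (1 + δ))
  set c₂ := 2 * (K * (2 + 4 * κ)) ^ ((1 + δ) / 2) *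
        (64 * κ * Y ^ (1 + δ) + 8 * (3 ^ (2 * q + 3) * C) * Y ^ δ)
  set c₃ := 2 * K ^ ((1 + δ) / 2) * (4 * κ * Y ^ (2 * δ) + 1) + 8 * (3 ^ (2 * q + 3)) ^ 2 * C' *
        (K * ((Y + κ) ^ 2 + κ)) ^ ((1 + δ) / 2)
  have h1 : 0 ≤ c₁ := by positivity
  have h2 : 0 ≤ c₂ := by positivity
  have h3 : 0 ≤ c₃ := by positivity
  refine ⟨c₁ + c₂ + c₃, by positivity, fun n m ν s z hn hmn hν hz hzY => ?_⟩
  have hW : 0 ≤ ∫ x, rowWeight K δ n (gram s x) z ∂ensemble ν := by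
    refine integral_nonneg fun x => ?_
    have := frobMean_nonneg (M := gram s x) (z := z) n
    simp only [Pi.zero_apply, rowWeight]
    positivity
  rcases le_total ‖z‖ r with h | h
  · refine (integral_min_le_of_norm_le hν hK hκ hz hn hmn hδ hδ1 hzY h s).trans ?_
    gcongr
    linarith
  · have h1z : 1 ≤ ‖z‖ := by linarith
    rcases le_total (n : ℝ) (‖z‖ ^ (2 * q)) with h' | h'
    · refine (integral_min_le_of_le_pow hν hK hκ hz hn hmn hδ hδ1 hzY s hC
        (hE n m ν ‖z‖ s hn hmn hν h1z) h1z (by linarith) (by linarith) h').trans ?_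
      gcongr
      linarith
    · refine (integral_min_le_of_pow_le hν hK hκ hz hn hmn hδ hδ1 hzY s hC hC' hq
        (hE n m ν ‖z‖ s hn hmn hν h1z) (hV n m ν ‖z‖ s hn hmn hν h1z) h1z (by linarith) h').trans ?_
      refine mul_le_mul_of_nonneg_right (mul_le_mul_of_nonneg_right ?_ (by positivity)) hW
      linarith

end Integrated

/-! ### The variance of the trace of the resolvent -/

section Variance
variable {n m : ℕ} {ν : Fin n → Fin m → Measure ℝ} {X₄ κ : ℝ} {z : ℂ}

theorem measurable_trace_green_sq (s : Finset (Fin n)) (z : ℂ) :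
    Measurable fun x : Fin n → Fin m → ℝ =>
      (greenMatrix (gram s x) z * greenMatrix (gram s x) z).trace := by
  simp only [Matrix.trace, Matrix.diag_apply, Matrix.mul_apply]
  exact Finset.measurable_sum _ fun k _ => Finset.measurable_sum _ fun l _ =>
    (measurable_green (measurable_gram s) z k l).mul (measurable_green (measurable_gram s) z l k)

/-- The variance of the trace is bounded by the sum over the rows of the row variances. -/
theorem variance_trace_green_le (hν : ∀ i k, HasUnitMoments (ν i k) X₄) (hX : 0 ≤ X₄)
    (hz : z.im ≠ 0) (hn : 1 ≤ n) :
    ∫ x, ‖(greenMatrix (gram Finset.univ x) z).trace -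
      ∫ y, (greenMatrix (gram Finset.univ y) z).trace ∂ensemble ν‖ ^ 2 ∂ensemble ν ≤
    8 * (X₄ + 1) / (n * |z.im| ^ 2) * ∑ i, ∫ x, min (n : ℝ)
      (frobMean n (gram (Finset.univ.erase i) x) z /
        ‖meanDenom n (gram (Finset.univ.erase i) x) z‖ ^ 2) ∂ensemble ν := by
  have := isProb_row hν
  have hv : 0 < |z.im| := abs_pos.mpr hz
  have hB : ∀ s (x : Fin n → Fin m → ℝ), ‖(greenMatrix (gram s x) z).trace‖ ≤ m * |z.im|⁻¹ :=
    fun s x => norm_trace_green_le (gram_posSemidef s x) hz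
  set h : Fin n → (Fin n → Fin m → ℝ) → ℂ := fun i x =>
    (greenMatrix (gram (Finset.univ.erase i) x) z).trace -
      (n : ℂ)⁻¹ * (greenMatrix (gram (Finset.univ.erase i) x) z *
        greenMatrix (gram (Finset.univ.erase i) x) z).trace /
          meanDenom n (gram (Finset.univ.erase i) x) z with hh
  have hhm : ∀ i, Measurable (h i) := fun i => (measurable_trace_green _ z).sub
    (((measurable_trace_green_sq _ z).const_mul _).div (measurable_meanDenom _ z))
  have hhB : ∀ i x, ‖h i x‖ ≤ m * |z.im|⁻¹ + |z.im|⁻¹ := fun i x =>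
    (norm_sub_le _ _).trans (add_le_add (hB _ x)
      (norm_trace_sq_div_le (gram_posSemidef _ x) hz n))
  have hfB : ∀ x : Fin n → Fin m → ℝ,
      ‖(greenMatrix (gram Finset.univ x) z).trace‖ ≤ m * |z.im|⁻¹ + |z.im|⁻¹ := fun x =>
    (hB _ x).trans (le_add_of_nonneg_right (by positivity))
  have hfm := measurable_trace_green (m := m) (Finset.univ : Finset (Fin n)) z
  refine (efron_stein (fun i => Measure.pi (ν i)) hfm.stronglyMeasurable hfB
    (fun i => (hhm i).stronglyMeasurable) hhB fun i x t => by
      simp only [hh, gram_update (Finset.notMem_erase i Finset.univ)]).trans ?_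
  rw [Finset.mul_sum]
  refine Finset.sum_le_sum fun i _ => ?_
  rw [← integral_const_mul]
  refine integral_le_of_integral_update_le (fun i => Measure.pi (ν i))
    (integrable_norm_sq_of_bound ((hfm.sub (hhm i)).stronglyMeasurable)
      (B := (m * |z.im|⁻¹ + |z.im|⁻¹) + (m * |z.im|⁻¹ + |z.im|⁻¹)) fun x =>
      (norm_sub_le _ _).trans (add_le_add (hfB x) (hhB i x)))
    ((integrable_min hν _ z).const_mul _) i fun x => ?_
  have hM := gram_posSemidef (Finset.univ.erase i) x
  refine le_trans (le_of_eq ?_) (integral_norm_ratio_sub_sq_le (hν i) hX hM hz hn)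
  congr 1
  funext t
  rw [gram_univ_eq i, Function.update_self]
  simp only [hh, gram_update (Finset.notMem_erase i Finset.univ)]
  rw [trace_green_add_vecMulVec hM hz, sub_sub_sub_cancel_left, ← norm_neg, neg_sub]

theorem variance_trace_green_le_div_pow_four (hν : ∀ i k, HasUnitMoments (ν i k) X₄) (hX : 0 ≤ X₄)
    (hz : z.im ≠ 0) (hn : 1 ≤ n) (hmn : (m : ℝ) ≤ κ * n) :
    ∫ x, ‖(greenMatrix (gram Finset.univ x) z).trace -
      ∫ y, (greenMatrix (gram Finset.univ y) z).trace ∂ensemble ν‖ ^ 2 ∂ensemble ν ≤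
    8 * (X₄ + 1) * (16 * κ) / |z.im| ^ 4 := by
  have := isProb_row hν
  have hv : 0 < |z.im| := abs_pos.mpr hz
  have hn0 : (0 : ℝ) < n := by exact_mod_cast hn
  refine (variance_trace_green_le hν hX hz hn).trans ?_
  have hterm : ∀ i : Fin n, ∫ x, min (n : ℝ) (frobMean n (gram (Finset.univ.erase i) x) z /
      ‖meanDenom n (gram (Finset.univ.erase i) x) z‖ ^ 2) ∂ensemble ν ≤ 16 * κ / |z.im| ^ 2 := by
    intro i
    refine (integral_mono (integrable_min hν _ z) (integrable_const (16 * κ / |z.im| ^ 2))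
      fun x => (min_le_right _ _).trans ?_).trans (by simp)
    have hM := gram_posSemidef (Finset.univ.erase i) x
    have h1 : 0 < ‖meanDenom n (gram (Finset.univ.erase i) x) z‖ :=
      norm_pos_iff.mpr (meanDenom_ne_zero hM hz n)
    rw [div_le_div_iff₀ (by positivity) (by positivity)]
    have := frobMean_le_norm_meanDenom_sq hM hz hn hmn
    linarith
  calc _ ≤ 8 * (X₄ + 1) / (n * |z.im| ^ 2) * ∑ i : Fin n, 16 * κ / |z.im| ^ 2 := by
        gcongr with i
        exact hterm i
    _ = _ := by
        rw [Finset.sum_const, Finset.card_univ, Fintype.card_fin, nsmul_eq_mul]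
        field_simp

theorem measurable_green_sampleCov (z : ℂ) (i : Fin n) :
    Measurable fun X : Fin n → Fin m → ℝ => greenMatrix (sampleCov (Matrix.of X)) z i i := by
  refine measurable_green (fun j k => ?_) z i i
  simp only [sampleCov, Matrix.smul_apply, Matrix.mul_apply, Matrix.transpose_apply,
    Matrix.of_apply]
  fun_prop

theorem green_diag_of_eq (x : Fin n → Fin m → ℝ) (hz : z.im ≠ 0) (i : Fin n) :
    greenMatrix (sampleCov (Matrix.of x)) z i i =
      -(z * (1 + quad (greenMatrix (gram (Finset.univ.erase i) x) z) ((√(n : ℝ))⁻¹ • x i)))⁻¹ :=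
  green_diag_eq _ hz i

/-- `rowWeight` bounds from below the conditional moment of `G_ii` given the rows other than `i`. -/
theorem integral_rowWeight_le (hν : ∀ i k, HasUnitMoments (ν i k) X₄) (hX : 0 ≤ X₄)
    (hz : z.im ≠ 0) {δ : ℝ} (hδ : 0 < δ) (i : Fin n) :
    ∫ x, rowWeight (2 * (X₄ + 1)) δ n (gram (Finset.univ.erase i) x) z ∂ensemble ν ≤
      ∫ x : Fin n → Fin m → ℝ, ‖greenMatrix (sampleCov (Matrix.of x)) z i i‖ ^ (1 + δ) ∂ensemble ν := by
  have := isProb_row hν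
  have hint : Integrable (fun x : Fin n → Fin m → ℝ =>
      ‖greenMatrix (sampleCov (Matrix.of x)) z i i‖ ^ (1 + δ)) (ensemble ν) := by
    refine integrable_of_bound (B := |z.im|⁻¹ ^ (1 + δ)) (Measurable.stronglyMeasurable
      ((measurable_green_sampleCov z i).norm.pow_const _)) fun x => ?_
    rw [Real.norm_of_nonneg (by positivity), green_diag_of_eq x hz, norm_neg]
    exact norm_inv_rpow_le (gram_posSemidef _ _) hz hδ _
  have h := integral_le_of_integral_update_le (fun i => Measure.pi (ν i)) hint.neg
    (integrable_rowWeight hν (by linarith : 0 < 2 * (X₄ + 1)) hδ (Finset.univ.erase i) hz).neg i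
    fun x => by
      simp only [Pi.neg_apply]
      rw [integral_neg]
      refine neg_le_neg ?_
      have hM := gram_posSemidef (Finset.univ.erase i) x
      refine (rowWeight_le_integral (hν i) hX hM hz hδ).trans (le_of_eq ?_)
      congr 1
      funext t
      rw [green_diag_of_eq _ hz, norm_neg, gram_update (Finset.notMem_erase i Finset.univ),
        Function.update_self]
  simp only [Pi.neg_apply, integral_neg] at h
  exact neg_le_neg_iff.mp h

theorem exists_variance_trace_green_le (hX : 0 ≤ X₄) (hκ : 0 ≤ κ) {δ Y : ℝ} (hδ : 0 < δ)
    (hδ1 : δ < 1) (hY : 0 < Y) :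
    ∃ C : ℝ, ∀ (n m : ℕ) (ν : Fin n → Fin m → Measure ℝ) (z : ℂ),
      1 ≤ n → (m : ℝ) ≤ κ * n → (∀ i k, HasUnitMoments (ν i k) X₄) → z.im ≠ 0 → |z.im| ≤ Y →
      ∫ x, ‖(greenMatrix (gram Finset.univ x) z).trace -
        ∫ y, (greenMatrix (gram Finset.univ y) z).trace ∂ensemble ν‖ ^ 2 ∂ensemble ν ≤
      C * (n : ℝ)⁻¹ * (∑ i : Fin n, ∫ x : Fin n → Fin m → ℝ,
        ‖greenMatrix (sampleCov (Matrix.of x)) z i i‖ ^ (1 + δ) ∂ensemble ν) / |z.im| ^ (3 + δ) := by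
  obtain ⟨C, hC, h⟩ := exists_integral_min_le hκ hX (by linarith : 0 < 2 * (X₄ + 1)) hδ hδ1 hY
  refine ⟨8 * (X₄ + 1) * C, fun n m ν z hn hmn hν hz hzY => ?_⟩
  have hv : 0 < |z.im| := abs_pos.mpr hz
  have hn0 : (0 : ℝ) < n := by exact_mod_cast hn
  refine (variance_trace_green_le hν hX hz hn).trans ?_
  have e : |z.im| ^ (3 + δ) = |z.im| ^ 2 * |z.im| ^ (1 + δ) := by
    rw [← Real.rpow_natCast |z.im| 2, ← Real.rpow_add hv]
    congr 1
    push_cast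
    ring
  calc _ ≤ 8 * (X₄ + 1) / (n * |z.im| ^ 2) * ∑ i : Fin n, C * |z.im| ^ (-(1 + δ)) *
        ∫ x : Fin n → Fin m → ℝ, ‖greenMatrix (sampleCov (Matrix.of x)) z i i‖ ^ (1 + δ) ∂ensemble ν := by
        gcongr with i
        refine (h n m ν _ z hn hmn hν hz hzY).trans (mul_le_mul_of_nonneg_left ?_ (by positivity))
        exact integral_rowWeight_le hν hX hz hδ i
    _ = _ := by
        rw [← Finset.mul_sum, e, Real.rpow_neg hv.le]
        field_simp

end Variance

/-! ### The law of a sample matrix -/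

section Transfer
variable {Ω : Type*} [MeasurableSpace Ω] {μ : Measure Ω} [IsProbabilityMeasure μ] {n m : ℕ}
  {X : Ω → Matrix (Fin n) (Fin m) ℝ} {ε₁ X₄ K : ℝ}

theorem IsSampleMatrix.hasUnitMoments (hX : IsSampleMatrix μ X ε₁ X₄ K) (hε₁ : 0 < ε₁)
    (i : Fin n) (k : Fin m) : HasUnitMoments (μ.map fun ω => X ω i k) X₄ := by
  have hm := hX.measurable_entry i k
  have hmap : ∀ {f : ℝ → ℝ}, Continuous f → ∫ t, f t ∂(μ.map fun ω => X ω i k) =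
      ∫ ω, f (X ω i k) ∂μ := fun hf =>
    integral_map hm.aemeasurable hf.aestronglyMeasurable
  refine ⟨Measure.isProbabilityMeasure_map hm.aemeasurable, ?_, ?_, ?_, ?_⟩
  · rw [integrable_map_measure (by fun_prop) hm.aemeasurable]
    refine ((integrable_const (1 : ℝ)).add (hX.higher_integrable i k)).mono'
      (by fun_prop) (Filter.Eventually.of_forall fun ω => ?_)
    simp only [Function.comp_apply, norm_pow, Real.norm_eq_abs, Pi.add_apply]
    rcases le_total |X ω i k| 1 with h | h
    · exact (pow_le_one₀ (abs_nonneg _) h).trans (le_add_of_nonneg_right (by positivity))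
    · refine le_trans ?_ (le_add_of_nonneg_left zero_le_one)
      rw [← Real.rpow_natCast]
      exact Real.rpow_le_rpow_of_exponent_le h (by push_cast; linarith)
  · rw [hmap continuous_id']
    exact hX.mean i k
  · rw [hmap (continuous_pow 2)]
    exact hX.second_moment i k
  · rw [hmap (continuous_pow 4)]
    exact (hX.fourth_moment i k).le

omit [IsProbabilityMeasure μ] in
theorem IsSampleMatrix.measurable_rows (hX : IsSampleMatrix μ X ε₁ X₄ K) :
    Measurable fun ω => fun i k => X ω i k :=
  measurable_pi_lambda _ fun i => measurable_pi_lambda _ fun k => hX.measurable_entry i k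

/-- The law of a sample matrix is a product over the rows of products over the columns. -/
theorem IsSampleMatrix.map_rows (hX : IsSampleMatrix μ X ε₁ X₄ K) :
    μ.map (fun ω => fun i k => X ω i k) = ensemble fun i k => μ.map fun ω => X ω i k := by
  have hp := fun (i : Fin n) (k : Fin m) =>
    Measure.isProbabilityMeasure_map (μ := μ) (hX.measurable_entry i k).aemeasurable
  have h := hX.indep.map_fun_eq_infinitePi_map fun p : Fin n × Fin m =>
    hX.measurable_entry p.1 p.2
  have h2 := Measure.infinitePi_map_curry fun i k => μ.map fun ω => X ω i k
  rw [← h, Measure.map_map (MeasurableEquiv.measurable _)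
    (measurable_pi_lambda _ fun p : Fin n × Fin m =>
    hX.measurable_entry p.1 p.2)] at h2
  simp only [Measure.infinitePi_eq_pi] at h2
  exact h2

theorem IsSampleMatrix.integral_rows (hX : IsSampleMatrix μ X ε₁ X₄ K) {F : Type*}
    [NormedAddCommGroup F] [NormedSpace ℝ F] {f : (Fin n → Fin m → ℝ) → F}
    (hf : StronglyMeasurable f) :
    ∫ ω, f (fun i k => X ω i k) ∂μ = ∫ x, f x ∂ensemble fun i k => μ.map fun ω => X ω i k := by
  rw [← hX.map_rows, integral_map hX.measurable_rows.aemeasurable hf.aestronglyMeasurable]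

/-- The two traces differ by a constant, so their variances agree. -/
theorem IsSampleMatrix.complexVar_gammaTrace (hX : IsSampleMatrix μ X ε₁ X₄ K) (hε₁ : 0 < ε₁)
    {z : ℂ} (hz : z.im ≠ 0) :
    complexVar (fun ω => gammaTrace (X ω) z) μ =
      ∫ x, ‖(greenMatrix (gram Finset.univ x) z).trace -
        ∫ y, (greenMatrix (gram Finset.univ y) z).trace
          ∂ensemble fun i k => μ.map fun ω => X ω i k‖ ^ 2
            ∂ensemble fun i k => μ.map fun ω => X ω i k := by
  have hν := hX.hasUnitMoments hε₁
  have := isProb_row hν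
  have hm := (measurable_trace_green (m := m) (Finset.univ : Finset (Fin n)) z).stronglyMeasurable
  have hint : Integrable (fun ω => (greenMatrix (gram Finset.univ fun i k => X ω i k) z).trace)
      μ := integrable_of_bound (hm.comp_measurable hX.measurable_rows) fun ω =>
    norm_trace_green_le (gram_posSemidef _ _) hz
  have hE : ∫ ω, gammaTrace (X ω) z ∂μ = (∫ y, (greenMatrix (gram Finset.univ y) z).trace
      ∂ensemble fun i k => μ.map fun ω => X ω i k) + z⁻¹ * ((m : ℂ) - n) := by
    rw [← hX.integral_rows hm]
    simp only [gammaTrace_eq _ hz]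
    refine (integral_add hint (integrable_const _)).trans ?_
    simp only [integral_const, probReal_univ, one_smul]
  rw [complexVar, hE]
  refine Eq.trans ?_ (hX.integral_rows ((hm.sub (stronglyMeasurable_const (b := ∫ y,
    (greenMatrix (gram Finset.univ y) z).trace ∂ensemble fun i k => μ.map fun ω => X ω i k))).norm.pow
      2))
  congr 1
  funext ω
  rw [gammaTrace_eq _ hz, add_sub_add_right_eq_sub]

theorem IsSampleMatrix.integral_norm_green_rpow (hX : IsSampleMatrix μ X ε₁ X₄ K) (z : ℂ) (δ : ℝ)
    (i : Fin n) :
    ∫ ω, ‖greenMatrix (sampleCov (X ω)) z i i‖ ^ (1 + δ) ∂μ =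
      ∫ x, ‖greenMatrix (sampleCov (Matrix.of x)) z i i‖ ^ (1 + δ)
        ∂ensemble fun i k => μ.map fun ω => X ω i k :=
  hX.integral_rows ((measurable_green_sampleCov z i).norm.pow_const _).stronglyMeasurable

theorem HasUnitMoments.mono {ν : Measure ℝ} {a b : ℝ} (h : HasUnitMoments ν a) (hab : a ≤ b) :
    HasUnitMoments ν b :=
  ⟨h.isProb, h.integrable_four, h.mean, h.second, h.fourth.trans hab⟩

end Transfer

end SampleCov

theorem proposition4 (ε₁ X₄ K κ : ℝ) (hε₁ : 0 < ε₁) :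
    (∀ δ : ℝ, 0 < δ → δ < 1 → ∀ Y : ℝ, 0 < Y → ∃ C : ℝ,
      ∀ (n m : ℕ), 1 ≤ n → (m : ℝ) ≤ κ * n →
      ∀ (Ω : Type*) [MeasurableSpace Ω] (μ : Measure Ω) [IsProbabilityMeasure μ]
        (X : Ω → Matrix (Fin n) (Fin m) ℝ), SampleCov.IsSampleMatrix μ X ε₁ X₄ K →
      ∀ z : ℂ, 0 < |z.im| → |z.im| ≤ Y →
        SampleCov.complexVar (fun ω => SampleCov.gammaTrace (X ω) z) μ ≤
          C * (n : ℝ)⁻¹ *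
            (∑ i : Fin n,
              ∫ ω, ‖SampleCov.greenMatrix (SampleCov.sampleCov (X ω)) z i i‖ ^ (1 + δ) ∂μ) /
            |z.im| ^ (3 + δ)) ∧
    (∃ C : ℝ,
      ∀ (n m : ℕ), 1 ≤ n → (m : ℝ) ≤ κ * n →
      ∀ (Ω : Type*) [MeasurableSpace Ω] (μ : Measure Ω) [IsProbabilityMeasure μ]
        (X : Ω → Matrix (Fin n) (Fin m) ℝ), SampleCov.IsSampleMatrix μ X ε₁ X₄ K →
      ∀ z : ℂ, 0 < |z.im| →
        SampleCov.complexVar (fun ω => SampleCov.gammaTrace (X ω) z) μ ≤ C / |z.im| ^ 4) := by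
  -- Negative `κ` or `X₄` leave no admissible matrices except, for `X₄`, those without entries.
  have hκ' : ∀ n : ℕ, κ * n ≤ max κ 0 * n := fun n => by gcongr; exact le_max_left _ _
  refine ⟨fun δ hδ hδ1 Y hY => ?_, ?_⟩
  · obtain ⟨C, h⟩ := SampleCov.exists_variance_trace_green_le (le_max_right X₄ 0)
      (le_max_right κ 0) hδ hδ1 hY
    refine ⟨C, fun n m hn hmn Ω _ μ _ X hX z hz hzY => ?_⟩
    rw [abs_pos] at hz
    rw [hX.complexVar_gammaTrace hε₁ hz]
    simp only [hX.integral_norm_green_rpow]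
    exact h n m _ z hn (hmn.trans (hκ' n))
      (fun i k => (hX.hasUnitMoments hε₁ i k).mono (le_max_left _ _)) hz hzY
  · refine ⟨8 * (max X₄ 0 + 1) * (16 * max κ 0), fun n m hn hmn Ω _ μ _ X hX z hz => ?_⟩
    rw [abs_pos] at hz
    rw [hX.complexVar_gammaTrace hε₁ hz]
    exact SampleCov.variance_trace_green_le_div_pow_four
      (fun i k => (hX.hasUnitMoments hε₁ i k).mono (le_max_left _ _)) (le_max_right _ _) hz hn
      (hmn.trans (hκ' n))
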